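/- Let $\kappa\in C^\infty_b(\mathbb R^2)$ be real-valued (smooth, bounded together with all its derivatives) with $\inf\{|\nabla\kappa(y)| : \kappa(y)=0\}>0$, and let $\Gamma=\kappa^{-1}(0)$. For $\varepsilon\in(0,1]$ let $$H=\begin{pmatrix}\kappa(x) & \varepsilon D_{x_1}-i\varepsilon D_{x_2}\\ \varepsilon D_{x_1}+i\varepsilon D_{x_2} & -\kappa(x)\end{pmatrix},\qquad D_{x_j}=-i\partial_{x_j},\quad D_t=-i\partial_t .$$ Fix $y_0\in\Gamma$ and let $y_t$, $t\ge 0$, solve $\dot y_t=\nabla\kappa(y_t)^\perp/|\nabla\kappa(y_t)|$, where $(w_1,w_2)^\perp=(-w_2,w_1)$. Let $r_t=|\nabla\kappa(y_t)|$ and let $\theta_t$ be a continuous real function of $t\ge 0$ with $\nabla\kappa(y_t)=r_t(-\sin\theta_t,\cos\theta_t)$. For $f\in\mathcal S(\mathbb R)$ (complex-valued) and $x\in\mathbb R^2$ set $$\mathcal K_tf(x)=r_t^{1/4}\, f(x_1\cos\theta_t+x_2\sin\theta_t)\, \exp\!\Big(-\frac{r_t}{2}\,(-x_1\sin\theta_t+x_2\cos\theta_t)^2\Big)\begin{pmatrix}e^{-i\theta_t/2}\\-e^{i\theta_t/2}\end{pmatrix}.$$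 Then for every $f\in\mathcal S(\mathbb R)$ and $\varepsilon\in(0,1]$ the equation $(\varepsilon D_t+H)\psi_t=0$ with initial data $\psi_0(x)=\varepsilon^{-1/2}\,\mathcal K_0f\big((x-y_0)/\sqrt\varepsilon\big)$ has a unique solution $\psi\in C([0,\infty),L^2(\mathbb R^2,\mathbb C^2))$, in the sense that $\frac{d}{dt}\langle\varphi,\psi_t\rangle_{L^2}=-\frac{i}{\varepsilon}\langle H\varphi,\psi_t\rangle_{L^2}$ for all $t\ge 0$ and all $\varphi\in\mathcal S(\mathbb R^2,\mathbb C^2)$ (the inner product being conjugate-linear in its first argument). Moreover there is a constant $C>0$, independent of $\varepsilon$ and $t$, such that for all $\varepsilon\in(0,1]$ and $t>0$ $$\Big\|\psi_t-\varepsilon^{-1/2}\,\mathcal K_tf\Big(\frac{\cdot-y_t}{\sqrt\varepsilon}\Big)\Big\|_{L^2(\mathbb R^2,\mathbb C^2)}\le C\,\varepsilon^{1/2}\,(1+t^2)^{1/2}.$$ -/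

import Mathlib

open MeasureTheory Set
open scoped ContDiff ENNReal SchwartzMap

/-- The plane `ℝ²` with its Euclidean structure. -/
abbrev Plane : Type := EuclideanSpace ℝ (Fin 2)

/-- The space `ℂ²` of spinors with its Hermitian structure. -/
abbrev Spinor : Type := EuclideanSpace ℂ (Fin 2)

/-- The Hilbert space `L²(ℝ², ℂ²)`. -/
abbrev SpinorL2 : Type := Lp Spinor 2 (volume : Measure Plane)

/-- `κ ∈ C^∞_b(ℝ²)`: smooth, and bounded together with its derivatives of every order. -/
def SmoothBounded (κ : Plane → ℝ) : Prop :=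
  ContDiff ℝ ∞ κ ∧ ∀ n : ℕ, ∃ M : ℝ, ∀ x : Plane, ‖iteratedFDeriv ℝ n κ x‖ ≤ M

/-- The transversality condition `inf {|∇κ(y)| : κ(y) = 0} > 0`; the infimum is taken in `[0, ∞]`. -/
def Transversal (κ : Plane → ℝ) : Prop :=
  0 < ⨅ y ∈ {y : Plane | κ y = 0}, ‖gradient κ y‖ₑ

/-- Counterclockwise rotation by `π/2`. -/
def perp (w : Plane) : Plane := !₂[-w 1, w 0]

/-- The unit tangent field `v(y) = ∇κ(y)^⊥ / |∇κ(y)|`. -/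
noncomputable def tangentField (κ : Plane → ℝ) (y : Plane) : Plane :=
  (‖gradient κ y‖)⁻¹ • perp (gradient κ y)

/-- For times `t ≥ 0`: `y` is the curve in `Γ = κ⁻¹(0)` that follows the unit tangent field,
`r_t = |∇κ(y_t)|`, and `θ` is a continuous angle with `∇κ(y_t) = r_t (-sin θ_t, cos θ_t)`. -/
structure IsInterfaceFlow (κ : Plane → ℝ) (y : ℝ → Plane) (θ r : ℝ → ℝ) : Prop where
  start : κ (y 0) = 0
  ode : ∀ t ∈ Ici (0 : ℝ), HasDerivWithinAt y (tangentField κ (y t)) (Ici 0) t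
  modulus : ∀ t ∈ Ici (0 : ℝ), r t = ‖gradient κ (y t)‖
  angle_continuous : ContinuousOn θ (Ici 0)
  angle : ∀ t ∈ Ici (0 : ℝ),
    gradient κ (y t) = r t • (!₂[-Real.sin (θ t), Real.cos (θ t)] : Plane)

/-- `D_{x_j} u = -i ∂_{x_j} u` (coordinates numbered `0, 1`). -/
noncomputable def Dx (j : Fin 2) (u : Plane → Spinor) (x : Plane) : Spinor :=
  (-Complex.I) • fderiv ℝ u x (EuclideanSpace.single j (1 : ℝ))

/-- The Dirac operator
`H = [[κ, ε D_{x_1} - i ε D_{x_2}], [ε D_{x_1} + i ε D_{x_2}, -κ]]` on differentiable spinors. -/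
noncomputable def diracH (κ : Plane → ℝ) (ε : ℝ) (u : Plane → Spinor) (x : Plane) : Spinor :=
  !₂[(κ x : ℂ) * u x 0 + ((ε : ℂ) * Dx 0 u x 1 - Complex.I * (ε : ℂ) * Dx 1 u x 1),
    ((ε : ℂ) * Dx 0 u x 0 + Complex.I * (ε : ℂ) * Dx 1 u x 0) - (κ x : ℂ) * u x 1]

/-- `ψ ∈ C([0, ∞), L²(ℝ², ℂ²))` solves `(ε D_t + H) ψ_t = 0`, `D_t = -i ∂_t`, for `t ≥ 0`, with initial
value `ψ₀`. The equation `∂_t ψ = -(i/ε) H ψ` is understood weakly in `x`: as `H` is symmetric, it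
says `d/dt ⟨φ, ψ_t⟩ = -(i/ε) ⟨H φ, ψ_t⟩` for every Schwartz function `φ`, where
`⟨u, v⟩ = ∫ ū · v`. -/
structure IsDiracSolution (κ : Plane → ℝ) (ε : ℝ) (ψ₀ : Plane → Spinor) (ψ : ℝ → SpinorL2) :
    Prop where
  continuous : ContinuousOn ψ (Ici 0)
  initial : ψ 0 =ᵐ[volume] ψ₀
  equation : ∀ φ : 𝓢(Plane, Spinor), ∀ t ∈ Ici (0 : ℝ),
    HasDerivWithinAt (fun s : ℝ => ∫ x, inner ℂ (φ x) (ψ s x))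
      (-(Complex.I / (ε : ℂ)) * ∫ x, inner ℂ (diracH κ ε φ x) (ψ t x)) (Ici 0) t

/-- `R_θ x`, the rotation with matrix `[[cos θ, sin θ], [-sin θ, cos θ]]`. -/
noncomputable def rotate (θ : ℝ) (x : Plane) : Plane :=
  !₂[Real.cos θ * x 0 + Real.sin θ * x 1, -Real.sin θ * x 0 + Real.cos θ * x 1]

/-- The edge state profile
`r^{1/4} f((R_θ x)_1) exp(-r (R_θ x)_2² / 2) (e^{-iθ/2}, -e^{iθ/2})`. -/
noncomputable def edgeProfile (θ r : ℝ) (f : 𝓢(ℝ, ℂ)) (x : Plane) : Spinor :=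
  ((r ^ (1 / 4 : ℝ) : ℝ) * f (rotate θ x 0) * (Real.exp (-(r / 2) * rotate θ x 1 ^ 2) : ℝ) : ℂ) •
    (!₂[Complex.exp (-Complex.I * θ / 2), -Complex.exp (Complex.I * θ / 2)] : Spinor)

/-- The wave packet `ε^{-1/2} a((x - y) / √ε)`. -/
noncomputable def wavePacket (ε : ℝ) (y : Plane) (a : Plane → Spinor) (x : Plane) : Spinor :=
  (√ε)⁻¹ • a ((√ε)⁻¹ • (x - y))

/-!
The error of the wave packet is controlled by an energy estimate: `H` is symmetric, so the `L²` norm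
of a solution of `(ε D_t + H) w = -iε g` grows at most at the rate `‖g‖`. It therefore suffices to
find an approximate solution within `O(√ε)` of the wave packet whose residual, divided by `ε`, is
`O(√ε)` uniformly in time; integrating up to time `t` gives `O(√ε (1 + t))`.

**Energy estimate and well-posedness.** Solutions are only continuous in `L²` and satisfy the
equation when tested against Schwartz functions, so that they must be regularized before the norm
can be differentiated. The structure `SmoothedGenerator` collects what this takes: symmetric
contractions `J n` commuting with the symmetric operator `A`, with `A ∘ J n` bounded and `J n → 1`.
For `A` the free Dirac operator these are the Fourier multipliers
`(1 + |ξ|² / (n + 1)²)^{-1/2}` (`diracGenerator`), while the mass term `(κ / ε) σ₃` is a bounded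
symmetric perturbation. The energy estimate is `SmoothedGenerator.norm_le_of_weak_solution`, which
also yields uniqueness; existence is `SmoothedGenerator.exists_weak_solution`, where the unitary
groups generated by `A ∘ J n + V` are shown to converge.

**The approximate solution.** Put `δ = √ε`, and let `a`, `b` be the tangential and normal coordinates
centred at `y_t`, scaled by `δ`. There `κ = δ r b + δ² Q(a, b) / 2 + O(δ³)`, with coefficients and
remainders uniform in time since `κ` has bounded derivatives and `r` is bounded below
(`IsInterfaceFlow.interfaceGeometry`). Let `s`, `o` be the eigenvectors of `σ · τ`, with `τ` the unit
tangent; the edge spinor `s` belongs to the eigenvalue `-1` and is carried along `-τ`, the velocity of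
`y`. For the ansatz `δ⁻¹ ((u₀ + δ u₁) s + δ w o)` the equation is solved order by order:

* at leading order `(∂_b + r b) u₀ = 0`, so `u₀` is Gaussian in `b`;
* at the next order, along `s`, `(-∂_b + r b) w = i (∂ₜ + α (b ∂ₐ - a ∂_b)) u₀` with `α = θ'`, which
  has a decaying solution only because of the factor `r^{1/4}` in `u₀`
  (`InterfaceGeometry.transport_equation`);
* at the same order, along `o`, `(∂_b + r b) u₁ = 2i ∂ₐ w + (α - Q) u₀ / 2`, which can always be solved
  (`InterfaceGeometry.corrector_equation`).

The solutions `w` and `u₁` are explicit: `f`, `f'`, `f''` and the Gaussian times polynomials in `a`,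
`b` whose coefficients are bounded in time with bounded derivative. The remaining terms are `O(δ³)`
with rapid decay in `a`, `b` (`InterfaceGeometry.exists_ansatz_bound`), and pass to `L²` in
`InterfaceGeometry.exists_approximate_solution`.
-/

set_option maxSynthPendingDepth 3

/-! ### Symmetric generators with commuting smoothing operators -/

/-- A symmetric operator `A` on a dense domain `S` of a Hilbert space `E`, embedded by `ι`, together
with symmetric contractions `J n` that commute with `A`, make `A ∘ J n` bounded, and tend to the
identity at the rate `δ n`, measured in the graph norm of `A`. This is what is needed to solve
`∂ₜ ψ = -i (A + V) ψ` for bounded symmetric `V` and to prove uniqueness for its weak solutions. The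
domain is a bare module: the fields only mention the norm of `E`. -/
structure SmoothedGenerator (S E : Type*) [AddCommGroup S] [Module ℂ S]
    [NormedAddCommGroup E] [InnerProductSpace ℂ E] where
  ι : S →ₗ[ℂ] E
  A : S →ₗ[ℂ] S
  J : ℕ → S →ₗ[ℂ] S
  δ : ℕ → ℝ
  dense : DenseRange ι
  symm_A : ∀ φ χ, inner ℂ (ι (A φ)) (ι χ) = inner ℂ (ι φ) (ι (A χ))
  symm_J : ∀ n φ χ, inner ℂ (ι (J n φ)) (ι χ) = inner ℂ (ι φ) (ι (J n χ))
  comm : ∀ n φ, A (J n φ) = J n (A φ)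
  norm_J_le : ∀ n φ, ‖ι (J n φ)‖ ≤ ‖ι φ‖
  norm_AJ_le : ∀ n, ∃ C : ℝ, ∀ φ, ‖ι (A (J n φ))‖ ≤ C * ‖ι φ‖
  norm_sub_J_le : ∀ n φ, ‖ι φ - ι (J n φ)‖ ≤ δ n * ‖ι (A (J n φ))‖
  δ_nonneg : ∀ n, 0 ≤ δ n
  tendsto_δ : Filter.Tendsto δ Filter.atTop (nhds 0)

namespace SmoothedGenerator

open Filter Topology

variable {S E : Type*} [AddCommGroup S] [Module ℂ S]
    [NormedAddCommGroup E] [InnerProductSpace ℂ E] [CompleteSpace E] (G : SmoothedGenerator S E)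

/-- The bounded extension of `J n` to the whole Hilbert space. -/
noncomputable def smoothing (n : ℕ) : E →L[ℂ] E := (G.ι ∘ₗ G.J n).extendOfNorm G.ι

/-- The bounded extension of `A ∘ J n`; it plays the role of a Yosida approximation of `A`. -/
noncomputable def bddGenerator (n : ℕ) : E →L[ℂ] E := (G.ι ∘ₗ G.A ∘ₗ G.J n).extendOfNorm G.ι

lemma smoothing_ι (n : ℕ) (φ : S) : G.smoothing n (G.ι φ) = G.ι (G.J n φ) :=
  LinearMap.extendOfNorm_eq G.dense ⟨1, fun φ => by simpa using G.norm_J_le n φ⟩ φ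

lemma bddGenerator_ι (n : ℕ) (φ : S) : G.bddGenerator n (G.ι φ) = G.ι (G.A (G.J n φ)) :=
  LinearMap.extendOfNorm_eq G.dense (G.norm_AJ_le n) φ

lemma norm_smoothing_le (n : ℕ) (x : E) : ‖G.smoothing n x‖ ≤ ‖x‖ := by
  have := LinearMap.norm_extendOfNorm_apply_le (f := G.ι ∘ₗ G.J n) (e := G.ι) G.dense 1
    (fun φ => by simpa using G.norm_J_le n φ) x
  simpa [smoothing] using this

lemma inner_smoothing (n : ℕ) (x y : E) :
    inner ℂ (G.smoothing n x) y = inner ℂ x (G.smoothing n y) := by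
  refine G.dense.induction_on₂ (isClosed_eq (by fun_prop) (by fun_prop)) (fun φ χ => ?_) x y
  simp only [smoothing_ι, G.symm_J]

lemma inner_bddGenerator (n : ℕ) (x y : E) :
    inner ℂ (G.bddGenerator n x) y = inner ℂ x (G.bddGenerator n y) := by
  refine G.dense.induction_on₂ (isClosed_eq (by fun_prop) (by fun_prop)) (fun φ χ => ?_) x y
  simp only [bddGenerator_ι, G.symm_A, G.symm_J, G.comm]

lemma norm_sub_smoothing_le (n : ℕ) (x : E) :
    ‖x - G.smoothing n x‖ ≤ G.δ n * ‖G.bddGenerator n x‖ := by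
  refine G.dense.induction_on x (isClosed_le (by fun_prop) (by fun_prop)) (fun φ => ?_)
  simpa only [bddGenerator_ι, smoothing_ι] using G.norm_sub_J_le n φ

lemma norm_bddGenerator_ι_le (n : ℕ) (φ : S) :
    ‖G.bddGenerator n (G.ι φ)‖ ≤ ‖G.ι (G.A φ)‖ := by
  rw [bddGenerator_ι, G.comm]; exact G.norm_J_le _ _

lemma tendsto_smoothing (x : E) : Tendsto (fun n => G.smoothing n x) atTop (𝓝 x) := by
  rw [Metric.tendsto_atTop]
  intro e he
  obtain ⟨φ, hφ⟩ := G.dense.exists_dist_lt x (show 0 < e / 3 by positivity)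
  have h1 : Tendsto (fun n => G.δ n * ‖G.ι (G.A φ)‖) atTop (𝓝 0) := by
    simpa using G.tendsto_δ.mul_const ‖G.ι (G.A φ)‖
  obtain ⟨N, hN⟩ := eventually_atTop.1 (h1.eventually_lt_const (show 0 < e / 3 by positivity))
  refine ⟨N, fun n hn => ?_⟩
  rw [dist_eq_norm] at hφ ⊢
  have h2 : ‖G.ι φ - G.smoothing n (G.ι φ)‖ < e / 3 :=
    ((G.norm_sub_smoothing_le n _).trans (mul_le_mul_of_nonneg_left
      (G.norm_bddGenerator_ι_le n φ) (G.δ_nonneg n))).trans_lt (hN n hn)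
  have h3 : ‖G.smoothing n (x - G.ι φ)‖ < e / 3 := (G.norm_smoothing_le n _).trans_lt hφ
  have h4 : G.smoothing n x - x = G.smoothing n (x - G.ι φ) - (G.ι φ - G.smoothing n (G.ι φ))
      - (x - G.ι φ) := by rw [map_sub]; abel
  rw [h4]
  linarith [norm_sub_le (G.smoothing n (x - G.ι φ) - (G.ι φ - G.smoothing n (G.ι φ))) (x - G.ι φ),
    norm_sub_le (G.smoothing n (x - G.ι φ)) (G.ι φ - G.smoothing n (G.ι φ))]

lemma tendsto_bddGenerator (φ : S) :
    Tendsto (fun n => G.bddGenerator n (G.ι φ)) atTop (𝓝 (G.ι (G.A φ))) := by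
  simp only [bddGenerator_ι, G.comm, ← G.smoothing_ι]
  exact G.tendsto_smoothing _

/-- On the domain this is the reality of `⟨u, A u⟩` with `u = J n φ - J m χ`; it compares the
approximate generators of two different levels. -/
lemma im_inner_smoothing_sub (n m : ℕ) (x y : E) :
    (inner ℂ (G.smoothing n x - G.smoothing m y)
      (G.bddGenerator n x - G.bddGenerator m y)).im = 0 := by
  refine G.dense.induction_on₂ (isClosed_eq ?_ (by fun_prop)) (fun φ χ => ?_) x y
  · exact Complex.continuous_im.comp (by fun_prop)
  · simp only [bddGenerator_ι, smoothing_ι, ← map_sub]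
    rw [← Complex.conj_eq_iff_im, inner_conj_symm, G.symm_A]

lemma im_inner_smoothing (n : ℕ) (x : E) :
    (inner ℂ (G.smoothing n x) (G.bddGenerator n x)).im = 0 := by
  simpa using G.im_inner_smoothing_sub n n x 0

end SmoothedGenerator

/-! ### Norms of weakly differentiable curves -/

/-- The flow of `ψ ↦ -i H ψ` conserves the norm when `⟨x, H x⟩` is real. -/
lemma norm_eq_of_hasDerivAt_symmetric {E : Type*} [NormedAddCommGroup E] [InnerProductSpace ℂ E]
    {ψ : ℝ → E} {H : E → E} (hH : ∀ x, (inner ℂ x (H x)).im = 0)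
    (h : ∀ t, HasDerivAt ψ (-Complex.I • H (ψ t)) t) (t : ℝ) : ‖ψ t‖ = ‖ψ 0‖ := by
  have hd : ∀ t, HasDerivAt (fun s => inner ℂ (ψ s) (ψ s)) 0 t := by
    intro t
    refine ((h t).inner ℂ (h t)).congr_deriv ?_
    rw [inner_smul_left, inner_smul_right, ← inner_conj_symm (H (ψ t)),
      Complex.conj_eq_iff_im.2 (hH (ψ t))]
    simp
  have h2 := is_const_of_deriv_eq_zero (fun t => (hd t).differentiableAt) (fun t => (hd t).deriv) t 0
  simp only [inner_self_eq_norm_sq_to_K] at h2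
  have h3 : ‖ψ t‖ ^ 2 = ‖ψ 0‖ ^ 2 := by exact_mod_cast h2
  exact (sq_eq_sq₀ (norm_nonneg _) (norm_nonneg _)).1 h3

section weak

open Filter Topology

variable {S E : Type*} [NormedAddCommGroup E] [InnerProductSpace ℂ E]

/-- A curve that is differentiable only when tested against a dense family, with weak derivative
bounded by `L`, is Lipschitz in norm with constant `L`. -/
lemma norm_sub_le_of_weak_hasDerivAt {ι : S → E} (hι : DenseRange ι) {w G : ℝ → E} {T L : ℝ}
    (hL : ∀ t ∈ Ioo 0 T, ‖G t‖ ≤ L)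
    (hcont : ∀ φ, ContinuousOn (fun s => (inner ℂ (ι φ) (w s) : ℂ)) (Icc 0 T))
    (hw : ∀ φ, ∀ t ∈ Ioo 0 T,
      HasDerivAt (fun s => (inner ℂ (ι φ) (w s) : ℂ)) (inner ℂ (ι φ) (G t)) t)
    {s t : ℝ} (hs : s ∈ Icc 0 T) (ht : t ∈ Icc 0 T) (hst : s ≤ t) :
    ‖w t - w s‖ ≤ L * (t - s) := by
  have key : ∀ e : E, (inner ℂ e (w t - w s) : ℂ).re ≤ ‖e‖ * (L * (t - s)) := by
    intro e
    refine hι.induction_on e (isClosed_le (Complex.continuous_re.comp (by fun_prop))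
      (by fun_prop)) (fun φ => ?_)
    have hd : ∀ u ∈ Ioo 0 T, HasDerivAt (fun s => (inner ℂ (ι φ) (w s) : ℂ).re)
        ((inner ℂ (ι φ) (G u) : ℂ).re) u := fun u hu => by
      exact Complex.reCLM.hasFDerivAt.comp_hasDerivAt u (hw φ u hu)
    have := (convex_Icc 0 T).image_sub_le_mul_sub_of_deriv_le
      (f := fun s => (inner ℂ (ι φ) (w s) : ℂ).re)
      (Complex.continuous_re.comp_continuousOn (hcont φ))
      (by rw [interior_Icc]; exact fun u hu => (hd u hu).differentiableAt.differentiableWithinAt)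
      (C := ‖ι φ‖ * L) (by
        rw [interior_Icc]; intro u hu
        rw [(hd u hu).deriv]
        exact ((Complex.re_le_norm _).trans (norm_inner_le_norm _ _)).trans
          (mul_le_mul_of_nonneg_left (hL u hu) (norm_nonneg _))) s hs t ht hst
    simpa [inner_sub_right, mul_assoc] using this
  -- test against the increment itself and cancel one factor of its norm
  have h1 := key (w t - w s)
  have h2 : (inner ℂ (w t - w s) (w t - w s) : ℂ).re = ‖w t - w s‖ * ‖w t - w s‖ := by
    have := inner_self_eq_norm_mul_norm (𝕜 := ℂ) (w t - w s); exact this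
  rw [h2] at h1
  rcases (norm_nonneg (w t - w s)).eq_or_lt with h0 | h0
  · rw [← h0]
    rcases hst.eq_or_lt with h | h
    · simp [h]
    · have hu : (s + t) / 2 ∈ Ioo 0 T := ⟨by linarith [hs.1], by linarith [ht.2]⟩
      exact mul_nonneg ((norm_nonneg _).trans (hL _ hu)) (by linarith)
  · exact le_of_mul_le_mul_left h1 h0

/-- The product rule for `‖w‖²` when `w` is Lipschitz at `t` but differentiable only weakly: the
weak derivative is tested against an approximation of `w t` from the dense family, and the error
is absorbed by the Lipschitz bound. -/
lemma hasDerivAt_norm_sq_of_weak {ι : S → E} (hι : DenseRange ι) {w : ℝ → E} {G : E} {t L : ℝ}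
    (hlip : ∀ᶠ s in 𝓝 t, ‖w s - w t‖ ≤ L * |s - t|)
    (hw : ∀ φ, HasDerivAt (fun s => (inner ℂ (ι φ) (w s) : ℂ)) (inner ℂ (ι φ) G) t) :
    HasDerivAt (fun s => ‖w s‖ ^ 2) (2 * (inner ℂ (w t) G : ℂ).re) t := by
  rw [hasDerivAt_iff_isLittleO, Asymptotics.isLittleO_iff]
  intro c hc
  have hL : 0 ≤ |L| + ‖G‖ := by positivity
  obtain ⟨φ, hφ⟩ := hι.exists_dist_lt (w t) (show 0 < c / 8 / (|L| + ‖G‖ + 1) by positivity)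
  have h1 := (hasDerivAt_iff_isLittleO.1 (hw φ)).def (show 0 < c / 8 by positivity)
  have h2 : ∀ᶠ s in 𝓝 t, L ^ 2 * |s - t| < c / 2 := by
    have : Tendsto (fun s => L ^ 2 * |s - t|) (𝓝 t) (𝓝 (L ^ 2 * |t - t|)) :=
      Continuous.tendsto (by fun_prop) t
    exact this.eventually_lt_const (by simpa using hc)
  filter_upwards [hlip, h1, h2] with s hl h1 h2
  set d := |s - t| with hd
  have hd0 : 0 ≤ d := abs_nonneg _
  have hl' : ‖w s - w t‖ ≤ |L| * d := hl.trans (mul_le_mul_of_nonneg_right (le_abs_self L) hd0)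
  set D := w s - w t - ((s - t : ℝ) : ℂ) • G with hD
  have hDn : ‖D‖ ≤ (|L| + ‖G‖) * d := by
    refine (norm_sub_le _ _).trans ?_
    rw [norm_smul, Complex.norm_real, Real.norm_eq_abs]
    nlinarith
  have h3 : ‖(inner ℂ (ι φ) D : ℂ)‖ ≤ c / 8 * d := by
    refine le_trans (le_of_eq ?_) h1
    congr 1
    simp [hD]
  have h4 : ‖(inner ℂ (w t - ι φ) D : ℂ)‖ ≤ c / 8 * d := by
    refine (norm_inner_le_norm _ _).trans ?_
    rw [dist_eq_norm] at hφ
    have h5 : ‖w t - ι φ‖ * (|L| + ‖G‖ + 1) ≤ c / 8 := by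
      rw [lt_div_iff₀ (by positivity)] at hφ; exact hφ.le
    calc ‖w t - ι φ‖ * ‖D‖ ≤ ‖w t - ι φ‖ * ((|L| + ‖G‖) * d) := by gcongr
      _ ≤ (‖w t - ι φ‖ * (|L| + ‖G‖ + 1)) * d := by
        nlinarith [mul_nonneg (norm_nonneg (w t - ι φ)) hd0]
      _ ≤ _ := by gcongr
  have h6 : ‖(inner ℂ (w t) D : ℂ)‖ ≤ c / 4 * d := by
    have : (inner ℂ (w t) D : ℂ) = inner ℂ (w t - ι φ) D + inner ℂ (ι φ) D := by
      rw [← inner_add_left]; simp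
    rw [this]
    linarith [norm_add_le (inner ℂ (w t - ι φ) D : ℂ) (inner ℂ (ι φ) D)]
  have h7 : ‖w s‖ ^ 2 - ‖w t‖ ^ 2 - (s - t) • (2 * (inner ℂ (w t) G : ℂ).re)
      = 2 * (inner ℂ (w t) D : ℂ).re + ‖w s - w t‖ ^ 2 := by
    have e1 : ‖w s‖ ^ 2 = ‖w t‖ ^ 2 + 2 * (inner ℂ (w t) (w s - w t) : ℂ).re
        + ‖w s - w t‖ ^ 2 := by
      have := norm_add_sq (𝕜 := ℂ) (w t) (w s - w t)
      rw [add_sub_cancel] at this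
      exact this
    rw [e1, hD, inner_sub_right _ (w s - w t), inner_smul_right, Complex.sub_re,
      Complex.re_ofReal_mul, smul_eq_mul]
    ring
  rw [h7, Real.norm_eq_abs, Real.norm_eq_abs]
  refine (abs_add_le _ _).trans ?_
  rw [abs_mul, abs_of_pos (zero_lt_two' ℝ), abs_of_nonneg (sq_nonneg ‖w s - w t‖)]
  have h8 := (Complex.abs_re_le_norm (inner ℂ (w t) D : ℂ)).trans h6
  have h9 : ‖w s - w t‖ ^ 2 ≤ c / 2 * d := by
    calc ‖w s - w t‖ ^ 2 ≤ (L * d) ^ 2 := by gcongr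
      _ = (L ^ 2 * d) * d := by ring
      _ ≤ _ := by gcongr
  linarith

end weak

/-! ### Energy estimate and existence for weak solutions -/

namespace SmoothedGenerator

open Filter Topology

variable {S E : Type*} [AddCommGroup S] [Module ℂ S]
    [NormedAddCommGroup E] [InnerProductSpace ℂ E] [CompleteSpace E] (G : SmoothedGenerator S E)

lemma eventually_norm_smoothing_sub_lt {K : Set E} (hK : IsCompact K) {c : ℝ} (hc : 0 < c) :
    ∀ᶠ n in atTop, ∀ x ∈ K, ‖G.smoothing n x - x‖ < c := by
  refine hK.induction_on (p := fun s => ∀ᶠ n in atTop, ∀ x ∈ s, ‖G.smoothing n x - x‖ < c)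
    (by simp) (fun s t hst h => h.mono fun n hn x hx => hn x (hst hx))
    (fun s t hs ht => by
      filter_upwards [hs, ht] with n h1 h2 x hx
      exact hx.elim (h1 x) (h2 x)) fun x _ => ?_
  have h1 : ∀ᶠ n in atTop, ‖G.smoothing n x - x‖ < c / 3 := by
    have := (G.tendsto_smoothing x).sub_const x
    rw [sub_self] at this
    exact (tendsto_zero_iff_norm_tendsto_zero.1 this).eventually_lt_const (by positivity)
  have h2 : ∀ᶠ y in 𝓝 x, ‖y - x‖ < c / 3 := by
    have : Tendsto (fun y => ‖y - x‖) (𝓝 x) (𝓝 ‖x - x‖) := Continuous.tendsto (by fun_prop) x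
    exact this.eventually_lt_const (by simpa using hc)
  refine ⟨_, mem_nhdsWithin_of_mem_nhds h2, ?_⟩
  filter_upwards [h1] with n hn y hy
  have h3 := (G.norm_smoothing_le n (y - x)).trans_lt hy
  have h4 : G.smoothing n y - y
      = G.smoothing n (y - x) + (G.smoothing n x - x) - (y - x) := by
    rw [map_sub]; abel
  rw [h4]
  linarith [norm_sub_le (G.smoothing n (y - x) + (G.smoothing n x - x)) (y - x),
    norm_add_le (G.smoothing n (y - x)) (G.smoothing n x - x), mem_ofPred.1 hy]

/-- The energy estimate for weak solutions of `∂ₜ w = -i (A + V) w + g` that are merely continuous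
in time. The smoothed curve `J n w` has the bounded weak derivative
`-i (A J n w + J n V w) + J n g`; in the derivative of its squared norm, `A` drops out because
`⟨J n w, A J n w⟩` is real, while the term with `V` is small since `J n w → w` uniformly on compact
time intervals. -/
theorem norm_le_of_weak_solution {V : E →L[ℂ] E}
    (hV : ∀ x y, (inner ℂ (V x) y : ℂ) = inner ℂ x (V y)) {w g : ℝ → E} {M : ℝ}
    (hcont : ContinuousOn w (Ici 0)) (hg : ∀ t, 0 < t → ‖g t‖ ≤ M)
    (hw : ∀ φ, ∀ t, 0 < t → HasDerivAt (fun s => (inner ℂ (G.ι φ) (w s) : ℂ))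
      (-Complex.I * inner ℂ (G.ι (G.A φ) + V (G.ι φ)) (w t) + inner ℂ (G.ι φ) (g t)) t)
    {T : ℝ} (hT : 0 ≤ T) : ‖w T‖ ≤ ‖w 0‖ + M * T := by
  rcases hT.eq_or_lt with rfl | hT
  · simp
  have hM : 0 ≤ M := (norm_nonneg _).trans (hg T hT)
  have hcT : ContinuousOn w (Icc 0 T) := hcont.mono Icc_subset_Ici_self
  have hK : IsCompact (w '' Icc 0 T) := isCompact_Icc.image_of_continuousOn hcT
  obtain ⟨B, hB⟩ := hK.isBounded.exists_norm_le
  have hB' : ∀ t ∈ Icc 0 T, ‖w t‖ ≤ B := fun t ht => hB _ (mem_image_of_mem w ht)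
  have hB0 : 0 ≤ B := (norm_nonneg _).trans (hB' 0 ⟨le_rfl, hT.le⟩)
  -- it suffices to prove the bound up to an arbitrary error
  refine le_of_forall_pos_le_add fun c hc => ?_
  -- `η` regularizes the norm at zero; `κ` bounds `J n w - w`, and is chosen so that the term
  -- with `V` contributes at most `η * (η / T)`
  set η := c / 3 with hη
  have hη0 : 0 < η := by positivity
  set κ := η * η / ((2 * ‖V‖ * B + 1) * T) with hκ
  have hκ0 : 0 < κ := by positivity
  obtain ⟨n, hn⟩ := (G.eventually_norm_smoothing_sub_lt hK (lt_min hκ0 hη0)).exists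
  have hn' : ∀ t ∈ Icc 0 T, ‖G.smoothing n (w t) - w t‖ < min κ η :=
    fun t ht => hn _ (mem_image_of_mem w ht)
  set b := G.bddGenerator n with hb
  set j := G.smoothing n with hj
  set F : ℝ → E := fun t => -Complex.I • (b (w t) + j (V (w t))) + j (g t) with hF
  have hweak : ∀ φ, ∀ t ∈ Ioo 0 T,
      HasDerivAt (fun s => (inner ℂ (G.ι φ) (j (w s)) : ℂ)) (inner ℂ (G.ι φ) (F t)) t := by
    intro φ t ht
    have h := hw (G.J n φ) t ht.1
    rw [← G.bddGenerator_ι, ← G.smoothing_ι, ← hb, ← hj] at h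
    have hjs : ∀ x y, (inner ℂ (j x) y : ℂ) = inner ℂ x (j y) := G.inner_smoothing n
    have hbs : ∀ x y, (inner ℂ (b x) y : ℂ) = inner ℂ x (b y) := G.inner_bddGenerator n
    simp only [← hjs]
    refine h.congr_deriv ?_
    simp only [hF, inner_add_right, inner_smul_right, inner_add_left, hV, hjs, hbs]
  have hFb : ∀ t ∈ Ioo 0 T, ‖F t‖ ≤ (‖b‖ * B + ‖V‖ * B) + M := by
    intro t ht
    have h1 : ‖w t‖ ≤ B := hB' t ⟨ht.1.le, ht.2.le⟩
    refine (norm_add_le _ _).trans (add_le_add ?_ ((G.norm_smoothing_le n _).trans (hg t ht.1)))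
    rw [norm_smul, norm_neg, Complex.norm_I, one_mul]
    refine (norm_add_le _ _).trans (add_le_add ?_ ((G.norm_smoothing_le n _).trans ?_))
    · exact (b.le_opNorm _).trans (mul_le_mul_of_nonneg_left h1 (norm_nonneg _))
    · exact (V.le_opNorm _).trans (mul_le_mul_of_nonneg_left h1 (norm_nonneg _))
  have hjc : ContinuousOn (fun t => j (w t)) (Icc 0 T) := j.continuous.comp_continuousOn hcT
  have hlip := fun s t hs ht hst => norm_sub_le_of_weak_hasDerivAt (s := s) (t := t) G.dense hFb
    (fun φ => (continuousOn_const.inner hjc : ContinuousOn (fun s => (inner ℂ (G.ι φ) (j (w s)) : ℂ)) _))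
    hweak hs ht hst
  have hN : ∀ t ∈ Ioo 0 T, HasDerivAt (fun s => ‖j (w s)‖ ^ 2)
      (2 * (inner ℂ (j (w t)) (F t) : ℂ).re) t := by
    intro t ht
    refine hasDerivAt_norm_sq_of_weak G.dense (L := (‖b‖ * B + ‖V‖ * B) + M) ?_
      (fun φ => hweak φ t ht)
    filter_upwards [Ioo_mem_nhds ht.1 ht.2] with s hs
    rcases le_total s t with h | h
    · rw [norm_sub_rev, abs_of_nonpos (by linarith)]
      simpa using hlip s t (Ioo_subset_Icc_self hs) (Ioo_subset_Icc_self ht) h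
    · rw [abs_of_nonneg (by linarith)]
      exact hlip t s (Ioo_subset_Icc_self ht) (Ioo_subset_Icc_self hs) h
  have hre : ∀ t ∈ Ioo 0 T, (inner ℂ (j (w t)) (F t) : ℂ).re
      ≤ κ * (2 * ‖V‖ * B) + ‖j (w t)‖ * M := by
    intro t ht
    have ht' := Ioo_subset_Icc_self ht
    have e1 : (inner ℂ (j (w t)) (F t) : ℂ).re
        = (inner ℂ (j (w t)) (j (V (w t))) : ℂ).im + (inner ℂ (j (w t)) (j (g t)) : ℂ).re := by
      have := G.im_inner_smoothing n (w t)
      simp only [hF, inner_add_right, inner_smul_right, Complex.add_re, Complex.mul_re,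
        Complex.neg_re, Complex.neg_im, Complex.I_re, Complex.I_im, Complex.add_im]
      rw [← hj, ← hb] at this
      rw [this]; ring
    have e2 : (inner ℂ (w t) (V (w t)) : ℂ).im = 0 := by
      rw [← Complex.conj_eq_iff_im, inner_conj_symm, hV]
    have e3 : (inner ℂ (j (w t)) (j (V (w t))) : ℂ).im
        = (inner ℂ (j (j (w t) - w t) + (j (w t) - w t)) (V (w t)) : ℂ).im := by
      rw [hj, ← G.inner_smoothing, map_sub, sub_add_sub_cancel, inner_sub_left, Complex.sub_im,
        e2, sub_zero]
    have e4 : ‖V (w t)‖ ≤ ‖V‖ * B :=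
      (V.le_opNorm _).trans (mul_le_mul_of_nonneg_left (hB' t ht') (norm_nonneg _))
    have e5 : ‖j (j (w t) - w t) + (j (w t) - w t)‖ ≤ 2 * κ := by
      have := (hn' t ht').le.trans (min_le_left _ _)
      linarith [norm_add_le (j (j (w t) - w t)) (j (w t) - w t),
        G.norm_smoothing_le n (j (w t) - w t)]
    rw [e1, e3]
    refine add_le_add ?_ ?_
    · refine ((Complex.im_le_norm _).trans (norm_inner_le_norm _ _)).trans ?_
      calc _ ≤ (2 * κ) * (‖V‖ * B) := by gcongr
        _ = _ := by ring
    · refine ((Complex.re_le_norm _).trans (norm_inner_le_norm _ _)).trans ?_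
      gcongr
      exact (G.norm_smoothing_le n _).trans (hg t ht.1)
  -- the regularized norm `√(η² + ‖j w‖²)` has slope at most `M + η / T`
  have hpos : ∀ t, 0 < η ^ 2 + ‖j (w t)‖ ^ 2 := fun t => by positivity
  have hSd : ∀ t ∈ Ioo 0 T, HasDerivAt (fun s => √(η ^ 2 + ‖j (w s)‖ ^ 2))
      (2 * (inner ℂ (j (w t)) (F t) : ℂ).re / (2 * √(η ^ 2 + ‖j (w t)‖ ^ 2))) t := fun t ht =>
    ((hN t ht).const_add (η ^ 2)).sqrt (hpos t).ne'
  have hmv := (convex_Icc 0 T).image_sub_le_mul_sub_of_deriv_le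
    (f := fun s => √(η ^ 2 + ‖j (w s)‖ ^ 2)) (by fun_prop)
    (by rw [interior_Icc]; exact fun u hu => (hSd u hu).differentiableAt.differentiableWithinAt)
    (C := M + η / T) (by
      rw [interior_Icc]; intro u hu
      rw [(hSd u hu).deriv, mul_div_mul_left _ _ two_ne_zero, div_le_iff₀ (by
        have := hpos u; positivity)]
      have s1 : η ≤ √(η ^ 2 + ‖j (w u)‖ ^ 2) := by
        apply Real.le_sqrt_of_sq_le; nlinarith [sq_nonneg ‖j (w u)‖]
      have s2 : ‖j (w u)‖ ≤ √(η ^ 2 + ‖j (w u)‖ ^ 2) := by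
        apply Real.le_sqrt_of_sq_le; nlinarith
      have s3 : κ * (2 * ‖V‖ * B) ≤ η * (η / T) := by
        have : κ * (2 * ‖V‖ * B + 1) = η * (η / T) := by
          rw [hκ]; field_simp
        rw [← this]
        gcongr
        linarith
      refine (hre u hu).trans ?_
      have s4 : η * (η / T) ≤ (η / T) * √(η ^ 2 + ‖j (w u)‖ ^ 2) := by
        rw [mul_comm]; gcongr
      nlinarith)
    0 ⟨le_rfl, hT.le⟩ T ⟨hT.le, le_rfl⟩ hT.le
  have hS0 : √(η ^ 2 + ‖j (w 0)‖ ^ 2) ≤ η + ‖w 0‖ := by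
    rw [Real.sqrt_le_left (by positivity)]
    have := G.norm_smoothing_le n (w 0)
    nlinarith [norm_nonneg (w 0), norm_nonneg (j (w 0))]
  have hST : ‖j (w T)‖ ≤ √(η ^ 2 + ‖j (w T)‖ ^ 2) := by
    apply Real.le_sqrt_of_sq_le; nlinarith
  have hTn := (hn' T ⟨hT.le, le_rfl⟩).le.trans (min_le_right _ _)
  have h9 : ‖w T‖ ≤ ‖j (w T)‖ + η := by
    have : w T = j (w T) - (j (w T) - w T) := by abel
    calc ‖w T‖ = ‖j (w T) - (j (w T) - w T)‖ := by rw [← this]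
      _ ≤ _ := (norm_sub_le _ _).trans (by gcongr)
  have h10 : (M + η / T) * (T - 0) = M * T + η := by field_simp; ring
  rw [h10] at hmv
  linarith

lemma inner_add_symm {n : ℕ} {V : E →L[ℂ] E}
    (hV : ∀ x y, (inner ℂ (V x) y : ℂ) = inner ℂ x (V y)) (x : E) :
    (inner ℂ x (G.bddGenerator n x + V x) : ℂ).im = 0 := by
  rw [← Complex.conj_eq_iff_im, inner_conj_symm, inner_add_left, inner_add_right, hV,
    G.inner_bddGenerator]

/-- The unitary group generated by the bounded operator `A ∘ J n + V`. -/
noncomputable def approxFlow (V : E →L[ℂ] E) (n : ℕ) (t : ℝ) : E →L[ℂ] E :=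
  NormedSpace.exp (t • (-Complex.I • (G.bddGenerator n + V)))

lemma approxFlow_zero (V : E →L[ℂ] E) (n : ℕ) : G.approxFlow V n 0 = 1 := by
  simp [approxFlow]

lemma hasDerivAt_approxFlow (V : E →L[ℂ] E) (n : ℕ) (u : E) (t : ℝ) :
    HasDerivAt (fun s => G.approxFlow V n s u)
      (-Complex.I • (G.bddGenerator n + V) (G.approxFlow V n t u)) t := by
  have h := hasDerivAt_exp_smul_const' (𝕂 := ℝ) (-Complex.I • (G.bddGenerator n + V)) t
  have h2 := (ContinuousLinearMap.apply ℂ E u).restrictScalars ℝ |>.hasFDerivAt.comp_hasDerivAt t h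
  exact h2

lemma approxFlow_generator (V : E →L[ℂ] E) (n : ℕ) (u : E) (t : ℝ) :
    (G.bddGenerator n + V) (G.approxFlow V n t u)
      = G.approxFlow V n t ((G.bddGenerator n + V) u) := by
  have h : Commute (G.bddGenerator n + V)
      (NormedSpace.exp (t • (-Complex.I • (G.bddGenerator n + V)))) := by
    apply Commute.exp_right
    exact ((Commute.refl _).smul_right _).smul_right _
  exact congrArg (fun B : E →L[ℂ] E => B u) h

lemma norm_approxFlow {V : E →L[ℂ] E}
    (hV : ∀ x y, (inner ℂ (V x) y : ℂ) = inner ℂ x (V y)) (n : ℕ) (u : E) (t : ℝ) :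
    ‖G.approxFlow V n t u‖ = ‖u‖ := by
  have := norm_eq_of_hasDerivAt_symmetric (ψ := fun s => G.approxFlow V n s u)
    (H := fun x => (G.bddGenerator n + V) x) (fun x => G.inner_add_symm hV x)
    (fun s => G.hasDerivAt_approxFlow V n u s) t
  simpa [approxFlow_zero] using this

/-- On the domain the approximate flows have a graph norm bounded uniformly in `n` and `t`: they
commute with `A ∘ J n + V`, and `V` is bounded. -/
lemma norm_bddGenerator_approxFlow_le {V : E →L[ℂ] E}
    (hV : ∀ x y, (inner ℂ (V x) y : ℂ) = inner ℂ x (V y)) (n : ℕ) (φ : S) (t : ℝ) :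
    ‖G.bddGenerator n (G.approxFlow V n t (G.ι φ))‖
      ≤ ‖G.ι (G.A φ)‖ + 2 * (‖V‖ * ‖G.ι φ‖) := by
  set x := G.approxFlow V n t (G.ι φ) with hx
  have h1 : G.bddGenerator n x = (G.bddGenerator n + V) x - V x := by simp
  have h2 : ‖(G.bddGenerator n + V) x‖ ≤ ‖G.ι (G.A φ)‖ + ‖V‖ * ‖G.ι φ‖ := by
    rw [hx, approxFlow_generator, G.norm_approxFlow hV]
    exact (norm_add_le _ _).trans (add_le_add (G.norm_bddGenerator_ι_le n φ) (V.le_opNorm _))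
  have h3 : ‖V x‖ ≤ ‖V‖ * ‖G.ι φ‖ := by
    have := V.le_opNorm x
    rwa [hx, G.norm_approxFlow hV, ← hx] at this
  rw [h1]
  linarith [norm_sub_le ((G.bddGenerator n + V) x) (V x)]

/-- Two approximate flows separate slowly. In the derivative of the squared distance, `V` cancels
by symmetry; the rest would be real with `J n x - J m z` in place of `x - z`, and that replacement
costs `δ n + δ m` times the graph norms. -/
lemma norm_sq_approxFlow_sub_le {V : E →L[ℂ] E}
    (hV : ∀ x y, (inner ℂ (V x) y : ℂ) = inner ℂ x (V y)) (n m : ℕ) (φ : S) (t : ℝ) :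
    ‖G.approxFlow V n t (G.ι φ) - G.approxFlow V m t (G.ι φ)‖ ^ 2
      ≤ 4 * (‖G.ι (G.A φ)‖ + 2 * (‖V‖ * ‖G.ι φ‖)) ^ 2 * (G.δ n + G.δ m) * |t| := by
  set c := ‖G.ι (G.A φ)‖ + 2 * (‖V‖ * ‖G.ι φ‖) with hc
  have hc0 : 0 ≤ c := by positivity
  set x := fun s => G.approxFlow V n s (G.ι φ) with hx
  set z := fun s => G.approxFlow V m s (G.ι φ) with hz
  have hd : ∀ s, HasDerivAt (fun s => (inner ℂ (x s - z s) (x s - z s) : ℂ))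
      ((2 * (inner ℂ (x s - z s) (G.bddGenerator n (x s) - G.bddGenerator m (z s)) : ℂ).im : ℝ) :
        ℂ) s := by
    intro s
    have h1 := (G.hasDerivAt_approxFlow V n (G.ι φ) s).sub (G.hasDerivAt_approxFlow V m (G.ι φ) s)
    refine (h1.inner ℂ h1).congr_deriv ?_
    simp only [← smul_sub, add_apply, Pi.sub_apply, inner_smul_right,
      inner_smul_left]
    change -Complex.I * inner ℂ (x s - z s) (G.bddGenerator n (x s) + V (x s)
      - (G.bddGenerator m (z s) + V (z s))) + _ * inner ℂ (G.bddGenerator n (x s) + V (x s)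
      - (G.bddGenerator m (z s) + V (z s))) (x s - z s) = _
    have e1 : G.bddGenerator n (x s) + V (x s) - (G.bddGenerator m (z s) + V (z s))
      = (G.bddGenerator n (x s) - G.bddGenerator m (z s)) + V (x s - z s) := by
      rw [map_sub]; abel
    rw [e1, inner_add_right, inner_add_left, hV]
    set p : ℂ := inner ℂ (x s - z s) (G.bddGenerator n (x s) - G.bddGenerator m (z s)) with hp
    rw [← inner_conj_symm (G.bddGenerator n (x s) - G.bddGenerator m (z s)), ← hp]
    generalize (inner ℂ (x s - z s) (V (x s - z s)) : ℂ) = q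
    simp only [map_neg, Complex.conj_I]
    apply Complex.ext
    · simp; ring
    · simp
  have hre : ∀ s, HasDerivAt (fun s => ‖x s - z s‖ ^ 2)
      (2 * (inner ℂ (x s - z s) (G.bddGenerator n (x s) - G.bddGenerator m (z s)) : ℂ).im) s := by
    intro s
    have := Complex.reCLM.hasFDerivAt.comp_hasDerivAt s (hd s)
    refine (this.congr_of_eventuallyEq (Eventually.of_forall fun u => ?_)).congr_deriv ?_
    · have := inner_self_eq_norm_sq_to_K (𝕜 := ℂ) (x u - z u)
      simp only [Function.comp, this]
      simp [← Complex.ofReal_pow]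
    · exact Complex.ofReal_re _
  have hbound : ∀ s, ‖2 * (inner ℂ (x s - z s)
      (G.bddGenerator n (x s) - G.bddGenerator m (z s)) : ℂ).im‖
      ≤ 4 * c ^ 2 * (G.δ n + G.δ m) := by
    intro s
    have b1 : ‖G.bddGenerator n (x s)‖ ≤ c := G.norm_bddGenerator_approxFlow_le hV n φ s
    have b2 : ‖G.bddGenerator m (z s)‖ ≤ c := G.norm_bddGenerator_approxFlow_le hV m φ s
    have d1 : ‖x s - G.smoothing n (x s)‖ ≤ G.δ n * c :=
      (G.norm_sub_smoothing_le n _).trans (mul_le_mul_of_nonneg_left b1 (G.δ_nonneg n))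
    have d2 : ‖z s - G.smoothing m (z s)‖ ≤ G.δ m * c :=
      (G.norm_sub_smoothing_le m _).trans (mul_le_mul_of_nonneg_left b2 (G.δ_nonneg m))
    have e1 : x s - z s = ((x s - G.smoothing n (x s)) - (z s - G.smoothing m (z s)))
        + (G.smoothing n (x s) - G.smoothing m (z s)) := by abel
    rw [e1, inner_add_left, Complex.add_im, G.im_inner_smoothing_sub, add_zero, norm_mul,
      Real.norm_two]
    have h2 : ‖(inner ℂ ((x s - G.smoothing n (x s)) - (z s - G.smoothing m (z s)))
        (G.bddGenerator n (x s) - G.bddGenerator m (z s)) : ℂ)‖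
        ≤ (G.δ n * c + G.δ m * c) * (c + c) := by
      have d3 := (norm_sub_le _ _).trans (add_le_add d1 d2)
      exact (norm_inner_le_norm _ _).trans (mul_le_mul d3
        ((norm_sub_le _ _).trans (add_le_add b1 b2)) (norm_nonneg _) ((norm_nonneg _).trans d3))
    have h3 := (Complex.abs_im_le_norm _).trans h2
    rw [Real.norm_eq_abs]
    linarith
  have := convex_univ.norm_image_sub_le_of_norm_hasDerivWithin_le
    (fun s _ => (hre s).hasDerivWithinAt) (fun s _ => hbound s) (mem_univ 0) (mem_univ t)
  simp only [hx, hz, approxFlow_zero, sub_self, norm_zero, sub_zero] at this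
  simpa using this

/-- The approximate flows converge, locally uniformly in time. -/
lemma uniformCauchySeqOn_approxFlow {V : E →L[ℂ] E}
    (hV : ∀ x y, (inner ℂ (V x) y : ℂ) = inner ℂ x (V y)) (u : E) (T : ℝ) :
    UniformCauchySeqOn (fun n t => G.approxFlow V n t u) atTop (Icc (-T) T) := by
  rw [Metric.uniformCauchySeqOn_iff]
  intro e he
  obtain ⟨φ, hφ⟩ := G.dense.exists_dist_lt u (show 0 < e / 3 by positivity)
  set c := 4 * (‖G.ι (G.A φ)‖ + 2 * (‖V‖ * ‖G.ι φ‖)) ^ 2 with hc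
  have hc0 : 0 ≤ c := by positivity
  have h1 : Tendsto (fun n => c * (2 * G.δ n) * |T|) atTop (𝓝 0) := by
    simpa using ((G.tendsto_δ.const_mul 2).const_mul c).mul_const |T|
  obtain ⟨N, hN⟩ := eventually_atTop.1
    (h1.eventually_lt_const (show 0 < (e / 3) ^ 2 by positivity))
  refine ⟨N, fun m hm n hn t ht => ?_⟩
  have htT : |t| ≤ |T| := (abs_le.2 ht).trans (le_abs_self T)
  have h2 : ‖G.approxFlow V m t (G.ι φ) - G.approxFlow V n t (G.ι φ)‖ < e / 3 := by
    refine lt_of_pow_lt_pow_left₀ 2 (by positivity) ?_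
    refine (G.norm_sq_approxFlow_sub_le hV m n φ t).trans_lt ?_
    rw [← hc]
    have hδ : 0 ≤ G.δ m + G.δ n := add_nonneg (G.δ_nonneg m) (G.δ_nonneg n)
    calc c * (G.δ m + G.δ n) * |t| ≤ c * (G.δ m + G.δ n) * |T| := by gcongr
      _ < _ := by nlinarith [hN m hm, hN n hn]
  rw [dist_eq_norm] at hφ ⊢
  have h3 : G.approxFlow V m t u - G.approxFlow V n t u
      = G.approxFlow V m t (u - G.ι φ) - G.approxFlow V n t (u - G.ι φ)
        + (G.approxFlow V m t (G.ι φ) - G.approxFlow V n t (G.ι φ)) := by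
    simp only [map_sub]; abel
  rw [h3]
  have h4 := norm_add_le (G.approxFlow V m t (u - G.ι φ) - G.approxFlow V n t (u - G.ι φ))
    (G.approxFlow V m t (G.ι φ) - G.approxFlow V n t (G.ι φ))
  have h5 := norm_sub_le (G.approxFlow V m t (u - G.ι φ)) (G.approxFlow V n t (u - G.ι φ))
  rw [G.norm_approxFlow hV, G.norm_approxFlow hV] at h5
  linarith

/-- Weak solvability of `∂ₜ ψ = -i (A + V) ψ` for every initial value, as the limit of the
approximate flows. -/
theorem exists_weak_solution {V : E →L[ℂ] E}
    (hV : ∀ x y, (inner ℂ (V x) y : ℂ) = inner ℂ x (V y)) (u : E) :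
    ∃ ψ : ℝ → E, Continuous ψ ∧ ψ 0 = u ∧ ∀ φ t,
      HasDerivAt (fun s => (inner ℂ (G.ι φ) (ψ s) : ℂ))
        (-Complex.I * inner ℂ (G.ι (G.A φ) + V (G.ι φ)) (ψ t)) t := by
  have hcau := G.uniformCauchySeqOn_approxFlow hV u
  have hmem : ∀ t : ℝ, t ∈ Icc (-(|t| + 1)) (|t| + 1) := fun t =>
    abs_le.1 (by linarith)
  have hnhds : ∀ t : ℝ, Icc (-(|t| + 1)) (|t| + 1) ∈ 𝓝 t := fun t =>
    Icc_mem_nhds (by linarith [neg_abs_le t]) (by linarith [le_abs_self t])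
  have hlim : ∀ t, ∃ x, Tendsto (fun n => G.approxFlow V n t u) atTop (𝓝 x) := fun t =>
    cauchySeq_tendsto_of_complete ((hcau (|t| + 1)).cauchySeq (hmem t))
  choose ψ hψ using hlim
  have hunif : ∀ T, TendstoUniformlyOn (fun n t => G.approxFlow V n t u) ψ atTop (Icc (-T) T) :=
    fun T => (hcau T).tendstoUniformlyOn_of_tendsto fun t _ => hψ t
  have hloc : TendstoLocallyUniformlyOn (fun n t => G.approxFlow V n t u) ψ atTop univ := by
    intro U hU t _
    refine ⟨Icc (-(|t| + 1)) (|t| + 1), mem_nhdsWithin_of_mem_nhds (hnhds t), ?_⟩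
    exact hunif _ U hU
  refine ⟨ψ, ?_, ?_, fun φ t => ?_⟩
  · rw [← continuousOn_univ]
    refine hloc.continuousOn (Frequently.of_forall fun n => ?_)
    exact fun t _ => (G.hasDerivAt_approxFlow V n u t).continuousAt.continuousWithinAt
  · refine tendsto_nhds_unique (hψ 0) ?_
    simp [approxFlow_zero]
  · refine hasDerivAt_of_tendstoLocallyUniformlyOn (l := atTop) (s := univ) isOpen_univ
      (f := fun n s => (inner ℂ (G.ι φ) (G.approxFlow V n s u) : ℂ))
      (f' := fun n s => -Complex.I * inner ℂ (G.bddGenerator n (G.ι φ) + V (G.ι φ))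
        (G.approxFlow V n s u))
      (g := fun s => (inner ℂ (G.ι φ) (ψ s) : ℂ))
      (g' := fun s => -Complex.I * inner ℂ (G.ι (G.A φ) + V (G.ι φ)) (ψ s))
      ?_ ?_ ?_ (mem_univ t)
    · rw [Metric.tendstoLocallyUniformlyOn_iff]
      intro e he s _
      refine ⟨Icc (-(|s| + 1)) (|s| + 1), mem_nhdsWithin_of_mem_nhds (hnhds s), ?_⟩
      have h1 := tendsto_iff_norm_sub_tendsto_zero.1 (G.tendsto_bddGenerator φ)
      have h1' : Tendsto (fun n => ‖G.bddGenerator n (G.ι φ) - G.ι (G.A φ)‖ * ‖u‖) atTop (𝓝 0) := by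
        simpa using h1.mul_const ‖u‖
      have h2 := Metric.tendstoUniformlyOn_iff.1 (hunif (|s| + 1))
        (e / 2 / (‖G.ι (G.A φ) + V (G.ι φ)‖ + 1)) (by positivity)
      filter_upwards [h1'.eventually_lt_const (half_pos he), h2] with n hn1 hn2 r hr
      have hn3 := hn2 r hr
      rw [dist_eq_norm, lt_div_iff₀ (by positivity)] at hn3
      rw [dist_eq_norm, ← mul_sub, norm_mul, norm_neg, Complex.norm_I, one_mul]
      set x := G.approxFlow V n r u with hx
      set p := G.ι (G.A φ) + V (G.ι φ) with hp
      have e1 : (inner ℂ p (ψ r) - inner ℂ (G.bddGenerator n (G.ι φ) + V (G.ι φ)) x : ℂ)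
          = inner ℂ p (ψ r - x) - inner ℂ (G.bddGenerator n (G.ι φ) - G.ι (G.A φ)) x := by
        simp only [hp, inner_sub_right, inner_add_left, inner_sub_left]; ring
      rw [e1]
      have e2 := norm_inner_le_norm (𝕜 := ℂ) p (ψ r - x)
      have e3 := norm_inner_le_norm (𝕜 := ℂ) (G.bddGenerator n (G.ι φ) - G.ι (G.A φ)) x
      rw [hx, G.norm_approxFlow hV, ← hx] at e3
      have e4 : ‖p‖ * ‖ψ r - x‖ ≤ ‖ψ r - x‖ * (‖p‖ + 1) := by nlinarith [norm_nonneg (ψ r - x)]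
      linarith [norm_sub_le (inner ℂ p (ψ r - x) : ℂ)
        (inner ℂ (G.bddGenerator n (G.ι φ) - G.ι (G.A φ)) x)]
    · refine Eventually.of_forall fun n s _ => ?_
      have h := (hasDerivAt_const s (G.ι φ)).inner ℂ (G.hasDerivAt_approxFlow V n u s)
      refine h.congr_deriv ?_
      simp only [inner_zero_left, add_zero, inner_smul_right, add_apply,
        inner_add_right, inner_add_left, hV, G.inner_bddGenerator]
    · exact fun s _ => ((continuous_const.inner continuous_id).tendsto (ψ s)).comp (hψ s)

end SmoothedGenerator

/-! ### The Dirac operator on the plane -/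

open scoped FourierTransform LineDeriv

/-- The Pauli matrix `σ₁`. -/
noncomputable def pauliX : Spinor →L[ℂ] Spinor := Matrix.toEuclideanCLM (𝕜 := ℂ) !![0, 1; 1, 0]

/-- The Pauli matrix `σ₂`. -/
noncomputable def pauliY : Spinor →L[ℂ] Spinor :=
  Matrix.toEuclideanCLM (𝕜 := ℂ) !![0, -Complex.I; Complex.I, 0]

/-- The Pauli matrix `σ₃`. -/
noncomputable def pauliZ : Spinor →L[ℂ] Spinor := Matrix.toEuclideanCLM (𝕜 := ℂ) !![1, 0; 0, -1]

lemma pauliX_apply (v : Spinor) : pauliX v = !₂[v 1, v 0] := by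
  ext i
  fin_cases i <;> simp [pauliX, Matrix.ofLp_toEuclideanCLM, Matrix.mulVec, dotProduct]

lemma pauliY_apply (v : Spinor) : pauliY v = !₂[-Complex.I * v 1, Complex.I * v 0] := by
  ext i
  fin_cases i <;> simp [pauliY, Matrix.ofLp_toEuclideanCLM, Matrix.mulVec, dotProduct]

lemma pauliZ_apply (v : Spinor) : pauliZ v = !₂[v 0, -v 1] := by
  ext i
  fin_cases i <;> simp [pauliZ, Matrix.ofLp_toEuclideanCLM, Matrix.mulVec, dotProduct]

lemma inner_spinor (v w : Spinor) :
    (inner ℂ v w : ℂ) = (starRingEnd ℂ) (v 0) * w 0 + (starRingEnd ℂ) (v 1) * w 1 := by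
  simp [PiLp.inner_apply, Fin.sum_univ_two, mul_comm]

lemma norm_sq_spinor (v : Spinor) : ‖v‖ ^ 2 = ‖v 0‖ ^ 2 + ‖v 1‖ ^ 2 := by
  simp [EuclideanSpace.norm_sq_eq, Fin.sum_univ_two]

/-- The free Dirac operator `σ₁ D_{x₁} + σ₂ D_{x₂}` on Schwartz spinors. -/
noncomputable def freeDirac : 𝓢(Plane, Spinor) →L[ℂ] 𝓢(Plane, Spinor) :=
  (-Complex.I) • (SchwartzMap.postcompCLM pauliX ∘L
      LineDeriv.lineDerivOpCLM ℂ 𝓢(Plane, Spinor) (EuclideanSpace.single 0 (1 : ℝ) : Plane)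
    + SchwartzMap.postcompCLM pauliY ∘L
      LineDeriv.lineDerivOpCLM ℂ 𝓢(Plane, Spinor) (EuclideanSpace.single 1 (1 : ℝ) : Plane))

lemma freeDirac_apply (φ : 𝓢(Plane, Spinor)) (x : Plane) :
    freeDirac φ x = !₂[Dx 0 φ x 1 - Complex.I * Dx 1 φ x 1, Dx 0 φ x 0 + Complex.I * Dx 1 φ x 0] := by
  have h : freeDirac φ x = (-Complex.I) •
      (pauliX (fderiv ℝ φ x (EuclideanSpace.single 0 1))
        + pauliY (fderiv ℝ φ x (EuclideanSpace.single 1 1))) := by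
    simp [freeDirac, SchwartzMap.postcompCLM_apply, SchwartzMap.lineDerivOp_apply_eq_fderiv]
  rw [h, pauliX_apply, pauliY_apply]
  ext i
  fin_cases i <;> simp [Dx]

lemma diracH_eq (κ : Plane → ℝ) (ε : ℝ) (φ : 𝓢(Plane, Spinor)) (x : Plane) :
    diracH κ ε φ x = (ε : ℂ) • freeDirac φ x + (κ x : ℂ) • pauliZ (φ x) := by
  rw [freeDirac_apply, pauliZ_apply]
  ext i
  fin_cases i <;> simp [diracH] <;> ring

lemma fourier_postcompCLM (L : Spinor →L[ℂ] Spinor) (φ : 𝓢(Plane, Spinor)) (ξ : Plane) :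
    𝓕 (SchwartzMap.postcompCLM L φ) ξ = L (𝓕 φ ξ) := by
  rw [SchwartzMap.fourier_coe, SchwartzMap.fourier_coe, Real.fourier_eq, Real.fourier_eq,
    ← L.integral_comp_comm]
  · simp [SchwartzMap.postcompCLM_apply]
  · simpa using (Real.fourierIntegral_convergent_iff ξ).2 (φ.integrable (μ := volume))

lemma fourier_lineDeriv_single (i : Fin 2) (φ : 𝓢(Plane, Spinor)) (ξ : Plane) :
    𝓕 (∂_{(EuclideanSpace.single i (1 : ℝ) : Plane)} φ) ξ
      = (2 * Real.pi * Complex.I * ξ i) • 𝓕 φ ξ := by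
  rw [SchwartzMap.fourier_lineDerivOp_eq, smul_apply,
    SchwartzMap.smulLeftCLM_apply_apply (by fun_prop)]
  simp [mul_smul, EuclideanSpace.inner_single_right]

lemma fourier_freeDirac (φ : 𝓢(Plane, Spinor)) (ξ : Plane) :
    𝓕 (freeDirac φ) ξ = !₂[2 * Real.pi * (ξ 0 - Complex.I * ξ 1) * 𝓕 φ ξ 1,
      2 * Real.pi * (ξ 0 + Complex.I * ξ 1) * 𝓕 φ ξ 0] := by
  have h : 𝓕 (freeDirac φ) ξ = (-Complex.I) •
      (pauliX (𝓕 (∂_{(EuclideanSpace.single 0 (1 : ℝ) : Plane)} φ) ξ)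
        + pauliY (𝓕 (∂_{(EuclideanSpace.single 1 (1 : ℝ) : Plane)} φ) ξ)) := by
    simp only [← fourier_postcompCLM]
    simp [freeDirac, FourierTransform.fourier_smul, FourierTransform.fourier_add]
  rw [h, pauliX_apply, pauliY_apply, fourier_lineDeriv_single, fourier_lineDeriv_single]
  have hI := Complex.I_mul_I
  ext i
  fin_cases i
  · simp
    linear_combination (-2 * Real.pi * ξ 0 * 𝓕 φ ξ 1 + 2 * Complex.I * Real.pi * 𝓕 φ ξ 1 * ξ 1) * hI
  · simp
    linear_combination (-2 * Real.pi * ξ 0 * 𝓕 φ ξ 0 - 2 * Complex.I * Real.pi * 𝓕 φ ξ 0 * ξ 1) * hI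

/-- The symbol `(1 + |ξ|² / (n + 1)²)^{-1/2}`. It lies in `(0, 1]`, gains one derivative, and differs
from `1` by at most `|ξ| / (n + 1)` times itself. -/
noncomputable def besselSymbol (n : ℕ) (ξ : Plane) : ℝ :=
  (1 + ‖((n : ℝ) + 1)⁻¹ • ξ‖ ^ 2) ^ (-(1 / 2) : ℝ)

lemma hasTemperateGrowth_besselSymbol (n : ℕ) :
    (fun ξ => ((besselSymbol n ξ : ℝ) : ℂ)).HasTemperateGrowth := by
  have h1 := (Function.hasTemperateGrowth_one_add_norm_sq_rpow Plane (-(1 / 2) : ℝ)).comp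
    ((((n : ℝ) + 1)⁻¹ • ContinuousLinearMap.id ℝ Plane).hasTemperateGrowth)
  exact Function.HasTemperateGrowth.comp (g := Complex.ofReal) (by fun_prop) h1

lemma besselSymbol_eq (n : ℕ) (ξ : Plane) :
    besselSymbol n ξ = (√(1 + (‖ξ‖ / (n + 1)) ^ 2))⁻¹ := by
  have hn : (0 : ℝ) < n + 1 := by positivity
  rw [besselSymbol, Real.rpow_neg (by positivity), ← Real.sqrt_eq_rpow, norm_smul, norm_inv,
    Real.norm_of_nonneg hn.le, inv_mul_eq_div]

lemma besselSymbol_pos (n : ℕ) (ξ : Plane) : 0 < besselSymbol n ξ := by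
  rw [besselSymbol_eq]; positivity

lemma besselSymbol_le_one (n : ℕ) (ξ : Plane) : besselSymbol n ξ ≤ 1 := by
  rw [besselSymbol_eq]
  refine inv_le_one_of_one_le₀ (Real.one_le_sqrt.2 ?_)
  nlinarith [sq_nonneg (‖ξ‖ / (n + 1))]

lemma norm_mul_besselSymbol_le (n : ℕ) (ξ : Plane) : ‖ξ‖ * besselSymbol n ξ ≤ n + 1 := by
  have hn : (0 : ℝ) < n + 1 := by positivity
  rw [besselSymbol_eq, ← div_eq_mul_inv, div_le_iff₀ (by positivity)]
  have h : ‖ξ‖ / (n + 1) ≤ √(1 + (‖ξ‖ / (n + 1)) ^ 2) := by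
    apply Real.le_sqrt_of_sq_le; linarith
  rwa [div_le_iff₀ hn, mul_comm] at h

lemma one_sub_besselSymbol_le (n : ℕ) (ξ : Plane) :
    1 - besselSymbol n ξ ≤ ((n : ℝ) + 1)⁻¹ * (‖ξ‖ * besselSymbol n ξ) := by
  have hn : (0 : ℝ) < n + 1 := by positivity
  have hq : 0 ≤ ‖ξ‖ / (n + 1) := by positivity
  have h : √(1 + (‖ξ‖ / (n + 1)) ^ 2) ≤ 1 + ‖ξ‖ / (n + 1) := by
    rw [Real.sqrt_le_left (by positivity)]; nlinarith
  have hm := besselSymbol_pos n ξ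
  have h2 : besselSymbol n ξ * √(1 + (‖ξ‖ / (n + 1)) ^ 2) = 1 := by
    rw [besselSymbol_eq]; exact inv_mul_cancel₀ (by positivity)
  have h3 : ((n : ℝ) + 1)⁻¹ * (‖ξ‖ * besselSymbol n ξ) = besselSymbol n ξ * (‖ξ‖ / (n + 1)) := by
    ring
  rw [h3]
  nlinarith [mul_le_mul_of_nonneg_left h hm.le]

/-- The Fourier multiplier with symbol `besselSymbol n`; being scalar it commutes with `freeDirac`. -/
noncomputable def besselSmoothing (n : ℕ) : 𝓢(Plane, Spinor) →L[ℂ] 𝓢(Plane, Spinor) :=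
  SchwartzMap.fourierMultiplierCLM Spinor fun ξ => ((besselSymbol n ξ : ℝ) : ℂ)

lemma fourier_besselSmoothing (n : ℕ) (φ : 𝓢(Plane, Spinor)) (ξ : Plane) :
    𝓕 (besselSmoothing n φ) ξ = (besselSymbol n ξ : ℂ) • 𝓕 φ ξ := by
  rw [besselSmoothing, SchwartzMap.fourierMultiplierCLM_apply, FourierTransform.fourier_fourierInv_eq,
    SchwartzMap.smulLeftCLM_apply_apply (hasTemperateGrowth_besselSymbol n)]

lemma norm_fourier_freeDirac (φ : 𝓢(Plane, Spinor)) (ξ : Plane) :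
    ‖𝓕 (freeDirac φ) ξ‖ = 2 * Real.pi * ‖ξ‖ * ‖𝓕 φ ξ‖ := by
  have hπ := Real.pi_pos
  refine (sq_eq_sq₀ (norm_nonneg _) (by positivity)).1 ?_
  have h1 : ‖(ξ 0 - Complex.I * ξ 1 : ℂ)‖ ^ 2 = ‖ξ‖ ^ 2 := by
    rw [← Complex.normSq_eq_norm_sq, Complex.normSq_apply, EuclideanSpace.norm_sq_eq]
    simp [Fin.sum_univ_two]; ring
  have h2 : ‖(ξ 0 + Complex.I * ξ 1 : ℂ)‖ ^ 2 = ‖ξ‖ ^ 2 := by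
    rw [← Complex.normSq_eq_norm_sq, Complex.normSq_apply, EuclideanSpace.norm_sq_eq]
    simp [Fin.sum_univ_two]; ring
  rw [fourier_freeDirac, norm_sq_spinor, mul_pow _ ‖𝓕 φ ξ‖, norm_sq_spinor (𝓕 φ ξ)]
  simp only [Matrix.cons_val_zero, Matrix.cons_val_one, norm_mul, mul_pow, h1, h2,
    Complex.norm_real, Complex.norm_ofNat, Real.norm_of_nonneg hπ.le]
  ring

lemma norm_toLp_le_of_fourier {φ χ : 𝓢(Plane, Spinor)} {C : ℝ}
    (h : ∀ ξ, ‖𝓕 φ ξ‖ ≤ C * ‖𝓕 χ ξ‖) : ‖φ.toLp 2‖ ≤ C * ‖χ.toLp 2‖ := by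
  rw [← SchwartzMap.norm_fourier_toL2_eq φ, ← SchwartzMap.norm_fourier_toL2_eq χ]
  refine Lp.norm_le_mul_norm_of_ae_le_mul ?_
  filter_upwards [(𝓕 φ).coeFn_toLp 2 volume, (𝓕 χ).coeFn_toLp 2 volume] with ξ h1 h2
  rw [h1, h2]
  exact h ξ

lemma inner_toLp_eq_of_fourier {φ χ φ' χ' : 𝓢(Plane, Spinor)}
    (h : ∀ ξ, (inner ℂ (𝓕 φ ξ) (𝓕 χ ξ) : ℂ) = inner ℂ (𝓕 φ' ξ) (𝓕 χ' ξ)) :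
    (inner ℂ (φ.toLp 2) (χ.toLp 2) : ℂ) = inner ℂ (φ'.toLp 2) (χ'.toLp 2) := by
  have key : ∀ f g : 𝓢(Plane, Spinor), (inner ℂ (f.toLp 2) (g.toLp 2) : ℂ)
      = ∫ ξ, inner ℂ (𝓕 f ξ) (𝓕 g ξ) := fun f g =>
    (SchwartzMap.inner_fourier_toL2_eq f g).symm.trans
      (SchwartzMap.inner_toL2_toL2_eq (𝓕 f) (𝓕 g) volume)
  rw [key, key]
  simp only [h]

lemma SchwartzMap.ext_fourier {φ χ : 𝓢(Plane, Spinor)} (h : ∀ ξ, 𝓕 φ ξ = 𝓕 χ ξ) : φ = χ := by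
  have : 𝓕 φ = 𝓕 χ := SchwartzMap.ext h
  have h2 := congrArg (fun g : 𝓢(Plane, Spinor) => (𝓕⁻ g : 𝓢(Plane, Spinor))) this
  simpa using h2

/-- The free Dirac operator on `L²(ℝ², ℂ²)` with domain the Schwartz spinors, smoothed by the Bessel
multipliers. All properties are read off on the Fourier side by Plancherel. -/
noncomputable def diracGenerator : SmoothedGenerator 𝓢(Plane, Spinor) SpinorL2 where
  ι := (SchwartzMap.toLpCLM ℂ Spinor 2 (volume : Measure Plane)).toLinearMap
  A := freeDirac.toLinearMap
  J n := (besselSmoothing n).toLinearMap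
  δ n := ((n : ℝ) + 1)⁻¹
  dense := SchwartzMap.denseRange_toLpCLM (by simp)
  symm_A φ χ := by
    refine inner_toLp_eq_of_fourier fun ξ => ?_
    simp only [ContinuousLinearMap.coe_coe, fourier_freeDirac, inner_spinor]
    simp only [Matrix.cons_val_zero, Matrix.cons_val_one, map_mul, map_add, map_sub, map_ofNat,
      Complex.conj_ofReal, Complex.conj_I]
    ring
  symm_J n φ χ := by
    refine inner_toLp_eq_of_fourier fun ξ => ?_
    simp only [ContinuousLinearMap.coe_coe, fourier_besselSmoothing, inner_smul_left,
      inner_smul_right, Complex.conj_ofReal]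
  comm n φ := by
    refine SchwartzMap.ext_fourier fun ξ => ?_
    simp only [ContinuousLinearMap.coe_coe, fourier_besselSmoothing, fourier_freeDirac]
    ext i
    fin_cases i <;> simp <;> ring
  norm_J_le n φ := by
    have := norm_toLp_le_of_fourier (φ := besselSmoothing n φ) (χ := φ) (C := 1) fun ξ => ?_
    · simpa using this
    · rw [fourier_besselSmoothing, norm_smul, Complex.norm_real,
        Real.norm_of_nonneg (besselSymbol_pos n ξ).le]
      exact mul_le_mul_of_nonneg_right (besselSymbol_le_one n ξ) (norm_nonneg _)
  norm_AJ_le n := by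
    refine ⟨2 * Real.pi * (n + 1), fun φ => norm_toLp_le_of_fourier fun ξ => ?_⟩
    have hπ := Real.pi_pos
    rw [ContinuousLinearMap.coe_coe, ContinuousLinearMap.coe_coe, norm_fourier_freeDirac,
      fourier_besselSmoothing, norm_smul, Complex.norm_real,
      Real.norm_of_nonneg (besselSymbol_pos n ξ).le]
    calc _ = 2 * Real.pi * (‖ξ‖ * besselSymbol n ξ) * ‖𝓕 φ ξ‖ := by ring
      _ ≤ _ := by gcongr; exact norm_mul_besselSymbol_le n ξ
  norm_sub_J_le n φ := by
    have hπ := Real.pi_gt_three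
    rw [← map_sub]
    refine norm_toLp_le_of_fourier fun ξ => ?_
    have h0 : 𝓕 (φ - besselSmoothing n φ) ξ = 𝓕 φ ξ - 𝓕 (besselSmoothing n φ) ξ :=
      congrArg (fun g : 𝓢(Plane, Spinor) => g ξ)
        (map_sub (FourierTransform.fourierCLM ℂ 𝓢(Plane, Spinor)) φ (besselSmoothing n φ))
    rw [ContinuousLinearMap.coe_coe, ContinuousLinearMap.coe_coe, norm_fourier_freeDirac,
      h0, fourier_besselSmoothing,
      norm_smul, Complex.norm_real, Real.norm_of_nonneg (besselSymbol_pos n ξ).le]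
    have h1 : 𝓕 φ ξ - (besselSymbol n ξ : ℂ) • 𝓕 φ ξ
        = ((1 - besselSymbol n ξ : ℝ) : ℂ) • 𝓕 φ ξ := by
      push_cast; rw [sub_smul, one_smul]
    rw [h1, norm_smul, Complex.norm_real,
      Real.norm_of_nonneg (sub_nonneg.2 (besselSymbol_le_one n ξ))]
    have h2 := one_sub_besselSymbol_le n ξ
    have h3 : 0 ≤ ((n : ℝ) + 1)⁻¹ * (‖ξ‖ * besselSymbol n ξ) :=
      mul_nonneg (by positivity) (mul_nonneg (norm_nonneg _) (besselSymbol_pos n ξ).le)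
    calc _ ≤ (2 * Real.pi * (((n : ℝ) + 1)⁻¹ * (‖ξ‖ * besselSymbol n ξ))) * ‖𝓕 φ ξ‖ := by
          gcongr; nlinarith
      _ = _ := by ring
  δ_nonneg n := by positivity
  tendsto_δ := by simpa using tendsto_one_div_add_atTop_nhds_zero_nat (𝕜 := ℝ)

lemma norm_pauliZ (v : Spinor) : ‖pauliZ v‖ = ‖v‖ := by
  refine (sq_eq_sq₀ (norm_nonneg _) (norm_nonneg _)).1 ?_
  rw [norm_sq_spinor, norm_sq_spinor, pauliZ_apply]; simp

lemma memLp_smul_pauliZ {c : Plane → ℝ} {M : ℝ} (hc : Continuous c) (hM : ∀ x, |c x| ≤ M)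
    {u : Plane → Spinor} (hu : MemLp u 2 volume) :
    MemLp (fun x => (c x : ℂ) • pauliZ (u x)) 2 volume := by
  refine hu.of_le_mul (c := M) ?_ (Filter.Eventually.of_forall fun x => ?_)
  · exact (Complex.continuous_ofReal.comp hc).aestronglyMeasurable.smul
      (pauliZ.continuous.comp_aestronglyMeasurable hu.1)
  · rw [norm_smul, Complex.norm_real, Real.norm_eq_abs, norm_pauliZ]
    gcongr
    exact hM x

/-- Multiplication by `c σ₃`, with `c` real, bounded and continuous, is bounded and symmetric on `L²`. -/
theorem exists_mul_pauliZ {c : Plane → ℝ} {M : ℝ} (hc : Continuous c) (hM : ∀ x, |c x| ≤ M) :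
    ∃ V : SpinorL2 →L[ℂ] SpinorL2,
      (∀ u, V u =ᵐ[volume] fun x => (c x : ℂ) • pauliZ (u x)) ∧
      ∀ u v, (inner ℂ (V u) v : ℂ) = inner ℂ u (V v) := by
  have hm := fun u : SpinorL2 => memLp_smul_pauliZ hc hM (Lp.memLp u)
  let V₀ : SpinorL2 →ₗ[ℂ] SpinorL2 :=
    { toFun := fun u => (hm u).toLp _
      map_add' := fun u v => by
        refine Lp.ext ?_
        filter_upwards [(hm (u + v)).coeFn_toLp,
          Lp.coeFn_add ((hm u).toLp _) ((hm v).toLp _),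
          (hm u).coeFn_toLp, (hm v).coeFn_toLp,
          Lp.coeFn_add u v] with x h1 h2 h3 h4 h5
        rw [h1, h2, Pi.add_apply, h3, h4, h5, Pi.add_apply, map_add, smul_add]
      map_smul' := fun a u => by
        refine Lp.ext ?_
        filter_upwards [(hm (a • u)).coeFn_toLp,
          Lp.coeFn_smul a ((hm u).toLp _),
          (hm u).coeFn_toLp, Lp.coeFn_smul a u] with x h1 h2 h3 h5
        rw [h1, RingHom.id_apply, h2, Pi.smul_apply, h3, h5, Pi.smul_apply, map_smul, smul_comm] }
  have hae : ∀ u, V₀ u =ᵐ[volume] fun x => (c x : ℂ) • pauliZ (u x) := fun u =>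
    (hm u).coeFn_toLp
  have hb : ∀ u, ‖V₀ u‖ ≤ M * ‖u‖ := fun u => by
    refine Lp.norm_le_mul_norm_of_ae_le_mul ?_
    filter_upwards [hae u] with x hx
    rw [hx, norm_smul, Complex.norm_real, Real.norm_eq_abs, norm_pauliZ]
    gcongr
    exact hM x
  refine ⟨V₀.mkContinuous M hb, hae, fun u v => ?_⟩
  rw [L2.inner_def, L2.inner_def]
  refine integral_congr_ae ?_
  filter_upwards [hae u, hae v] with x h1 h2
  change (inner ℂ (V₀ u x) (v x) : ℂ) = inner ℂ (u x) (V₀ v x)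
  rw [h1, h2, inner_smul_left, inner_smul_right, Complex.conj_ofReal, inner_spinor, inner_spinor,
    pauliZ_apply, pauliZ_apply]
  simp

lemma integral_inner_schwartz (φ : 𝓢(Plane, Spinor)) (u : SpinorL2) :
    ∫ x, (inner ℂ (φ x) (u x) : ℂ) = inner ℂ (diracGenerator.ι φ) u := by
  rw [L2.inner_def]
  refine integral_congr_ae ?_
  filter_upwards [φ.coeFn_toLp 2 volume] with x hx
  change _ = (inner ℂ (φ.toLp 2 volume x) (u x) : ℂ)
  rw [hx]

/-- The right-hand side of the weak Dirac equation in the form used for abstract generators, with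
`V` the multiplication by `(κ / ε) σ₃`. -/
lemma integral_inner_diracH {κ : Plane → ℝ} {ε : ℝ} (hε : ε ≠ 0) {V : SpinorL2 →L[ℂ] SpinorL2}
    (hV : ∀ u : SpinorL2, V u =ᵐ[volume] fun x => ((κ x / ε : ℝ) : ℂ) • pauliZ (u x))
    (φ : 𝓢(Plane, Spinor)) (u : SpinorL2) :
    -(Complex.I / (ε : ℂ)) * ∫ x, (inner ℂ (diracH κ ε φ x) (u x) : ℂ)
      = -Complex.I * inner ℂ (diracGenerator.ι (diracGenerator.A φ) + V (diracGenerator.ι φ)) u := by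
  have hε' : (ε : ℂ) ≠ 0 := by exact_mod_cast hε
  have h : ∫ x, (inner ℂ (diracH κ ε φ x) (u x) : ℂ)
      = ε * inner ℂ (diracGenerator.ι (diracGenerator.A φ) + V (diracGenerator.ι φ)) u := by
    rw [L2.inner_def, ← integral_const_mul]
    refine integral_congr_ae ?_
    filter_upwards [φ.coeFn_toLp 2 volume, (freeDirac φ).coeFn_toLp 2 volume,
      hV (diracGenerator.ι φ),
      Lp.coeFn_add (diracGenerator.ι (diracGenerator.A φ)) (V (diracGenerator.ι φ))]
      with x h1 h2 h3 h4
    rw [h4, Pi.add_apply, h3]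
    change _ = (ε : ℂ) * inner ℂ ((freeDirac φ).toLp 2 volume x
      + _ • pauliZ (φ.toLp 2 volume x)) (u x)
    rw [h1, h2, diracH_eq, inner_add_left, inner_add_left, inner_smul_left, inner_smul_left,
      inner_smul_left, Complex.conj_ofReal, Complex.conj_ofReal, Complex.conj_ofReal]
    push_cast
    field_simp
  rw [h]
  field_simp

theorem exists_isDiracSolution {κ : Plane → ℝ} {M ε : ℝ} (hc : Continuous κ)
    (hM : ∀ x, |κ x| ≤ M) (hε : 0 < ε) {ψ₀ : Plane → Spinor} (hψ₀ : MemLp ψ₀ 2 volume) :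
    ∃ ψ : ℝ → SpinorL2, IsDiracSolution κ ε ψ₀ ψ := by
  obtain ⟨V, hV, hVs⟩ := exists_mul_pauliZ (c := fun x => κ x / ε) (M := M / ε)
    (hc.div_const ε) (fun x => by
      rw [abs_div, abs_of_pos hε]; gcongr; exact hM x)
  obtain ⟨ψ, h1, h2, h3⟩ := diracGenerator.exists_weak_solution hVs (hψ₀.toLp ψ₀)
  refine ⟨ψ, h1.continuousOn, ?_, fun φ t _ => ?_⟩
  · rw [h2]; exact hψ₀.coeFn_toLp
  · rw [integral_inner_diracH hε.ne' hV]
    simp only [integral_inner_schwartz]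
    exact (h3 φ t).hasDerivWithinAt

/-- The energy estimate for the Dirac equation with a residual: the `L²` norm grows at most at the
rate of the residual, uniformly in `ε`. -/
theorem norm_le_of_dirac_residual {κ : Plane → ℝ} {B ε M : ℝ} (hc : Continuous κ)
    (hB : ∀ x, |κ x| ≤ B) (hε : 0 < ε) {w g : ℝ → SpinorL2}
    (hcont : ContinuousOn w (Ici 0)) (hg : ∀ t, 0 < t → ‖g t‖ ≤ M)
    (hw : ∀ φ : 𝓢(Plane, Spinor), ∀ t, 0 < t →
      HasDerivAt (fun s => ∫ x, (inner ℂ (φ x) (w s x) : ℂ))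
        (-(Complex.I / (ε : ℂ)) * (∫ x, (inner ℂ (diracH κ ε φ x) (w t x) : ℂ))
          + ∫ x, (inner ℂ (φ x) (g t x) : ℂ)) t)
    {T : ℝ} (hT : 0 ≤ T) : ‖w T‖ ≤ ‖w 0‖ + M * T := by
  obtain ⟨V, hV, hVs⟩ := exists_mul_pauliZ (c := fun x => κ x / ε) (M := B / ε)
    (hc.div_const ε) (fun x => by
      rw [abs_div, abs_of_pos hε]; gcongr; exact hB x)
  refine diracGenerator.norm_le_of_weak_solution hVs hcont hg (fun φ t ht => ?_) hT
  have := hw φ t ht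
  rw [integral_inner_diracH hε.ne' hV] at this
  simpa only [integral_inner_schwartz] using this

/-- Uniqueness: the energy estimate applied to the difference, with zero residual. -/
theorem IsDiracSolution.eqOn {κ : Plane → ℝ} {M ε : ℝ} (hc : Continuous κ)
    (hM : ∀ x, |κ x| ≤ M) (hε : 0 < ε) {ψ₀ : Plane → Spinor} {ψ ψ' : ℝ → SpinorL2}
    (h : IsDiracSolution κ ε ψ₀ ψ) (h' : IsDiracSolution κ ε ψ₀ ψ') : EqOn ψ' ψ (Ici 0) := by
  intro T hT
  obtain ⟨V, hV, hVs⟩ := exists_mul_pauliZ (c := fun x => κ x / ε) (M := M / ε)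
    (hc.div_const ε) (fun x => by
      rw [abs_div, abs_of_pos hε]; gcongr; exact hM x)
  have h0 : ψ' 0 - ψ 0 = 0 := sub_eq_zero.2 (Lp.ext (h'.initial.trans h.initial.symm))
  have := diracGenerator.norm_le_of_weak_solution hVs (w := fun t => ψ' t - ψ t) (g := 0) (M := 0)
    (h'.continuous.sub h.continuous) (fun t _ => by simp) (fun φ t ht => ?_) hT
  · rw [h0] at this
    simpa [sub_eq_zero] using this
  · have e1 := (h.equation φ t ht.le).hasDerivAt (Ici_mem_nhds ht)
    have e2 := (h'.equation φ t ht.le).hasDerivAt (Ici_mem_nhds ht)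
    rw [integral_inner_diracH hε.ne' hV] at e1 e2
    simp only [integral_inner_schwartz] at e1 e2
    have e3 := e2.sub e1
    simp only [inner_sub_right, Pi.zero_apply, inner_zero_right, add_zero, mul_sub]
    exact e3

/-! ### Taylor expansion with uniform remainder -/

section Taylor

variable {X Y : Type*} [NormedAddCommGroup X] [NormedSpace ℝ X]
  [NormedAddCommGroup Y] [NormedSpace ℝ Y]

lemma norm_sub_sub_fderiv_le {F : X → Y} {M : ℝ} (hF : Differentiable ℝ F)
    (hF' : Differentiable ℝ (fderiv ℝ F)) (hM : ∀ x, ‖fderiv ℝ (fderiv ℝ F) x‖ ≤ M) (x h : X) :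
    ‖F (x + h) - F x - fderiv ℝ F x h‖ ≤ M * ‖h‖ ^ 2 := by
  have hM0 : 0 ≤ M := (norm_nonneg _).trans (hM 0)
  have h1 : ∀ z ∈ Metric.closedBall x ‖h‖, ‖fderiv ℝ F z - fderiv ℝ F x‖ ≤ M * ‖h‖ := by
    intro z hz
    refine (convex_univ.norm_image_sub_le_of_norm_fderiv_le (fun z _ => hF' z)
      (fun z _ => hM z) (mem_univ x) (mem_univ z)).trans ?_
    gcongr
    rwa [← dist_eq_norm]
  have h2 := (convex_closedBall x ‖h‖).norm_image_sub_le_of_norm_hasFDerivWithin_le'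
    (f := F) (φ := fderiv ℝ F x) (fun z _ => (hF z).hasFDerivAt.hasFDerivWithinAt) h1
    (Metric.mem_closedBall_self (norm_nonneg _)) (y := x + h) (by simp)
  simp only [add_sub_cancel_left] at h2
  rw [sq, ← mul_assoc]
  exact h2

/-- Second order Taylor expansion with remainder bounded through the third derivative. The factor
`1/6` is given up: the bound follows from the first order expansion of the gradient along the
segment. -/
lemma norm_sub_taylor_two_le {κ : X → ℝ} {M : ℝ} (h1 : Differentiable ℝ κ)
    (h2 : Differentiable ℝ (fderiv ℝ κ)) (h3 : Differentiable ℝ (fderiv ℝ (fderiv ℝ κ)))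
    (hM : ∀ x, ‖fderiv ℝ (fderiv ℝ (fderiv ℝ κ)) x‖ ≤ M) (x h : X) :
    |κ (x + h) - κ x - fderiv ℝ κ x h - fderiv ℝ (fderiv ℝ κ) x h h / 2| ≤ M * ‖h‖ ^ 3 := by
  have hM0 : 0 ≤ M := (norm_nonneg _).trans (hM 0)
  set k : ℝ → ℝ := fun s =>
    κ (x + s • h) - s * fderiv ℝ κ x h - s ^ 2 / 2 * fderiv ℝ (fderiv ℝ κ) x h h with hk
  have hd : ∀ s, HasDerivAt k
      ((fderiv ℝ κ (x + s • h) - fderiv ℝ κ x - fderiv ℝ (fderiv ℝ κ) x (s • h)) h) s := by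
    intro s
    have e1 : HasDerivAt (fun s : ℝ => x + s • h) h s := by
      simpa using ((hasDerivAt_id s).smul_const h).const_add x
    have e2 := (h1 (x + s • h)).hasFDerivAt.comp_hasDerivAt s e1
    have e3 := (e2.sub ((hasDerivAt_id s).mul_const (fderiv ℝ κ x h))).sub
      ((((hasDerivAt_id s).pow 2).div_const 2).mul_const (fderiv ℝ (fderiv ℝ κ) x h h))
    refine e3.congr_deriv ?_
    simp
  have hb : ∀ s ∈ Icc (0 : ℝ) 1,
      ‖(fderiv ℝ κ (x + s • h) - fderiv ℝ κ x - fderiv ℝ (fderiv ℝ κ) x (s • h)) h‖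
        ≤ M * ‖h‖ ^ 3 := by
    intro s hs
    refine (ContinuousLinearMap.le_opNorm _ _).trans ?_
    have e1 := norm_sub_sub_fderiv_le h2 h3 hM x (s • h)
    have e2 : ‖s • h‖ ≤ ‖h‖ := by
      rw [norm_smul, Real.norm_of_nonneg hs.1]
      exact mul_le_of_le_one_left (norm_nonneg _) hs.2
    calc _ ≤ M * ‖s • h‖ ^ 2 * ‖h‖ := by gcongr
      _ ≤ M * ‖h‖ ^ 2 * ‖h‖ := by gcongr
      _ = _ := by ring
  have := (convex_Icc (0 : ℝ) 1).norm_image_sub_le_of_norm_hasDerivWithin_le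
    (fun s _ => (hd s).hasDerivWithinAt) hb ⟨le_rfl, zero_le_one⟩ ⟨zero_le_one, le_rfl⟩
  rw [Real.norm_eq_abs] at this
  simp only [hk] at this
  refine le_trans (le_of_eq ?_) (this.trans (by simp))
  congr 1
  simp
  ring

end Taylor

/-! ### Bounded curves with bounded derivative -/

/-- The curve `c` is bounded and differentiable with bounded derivative on `[0, ∞)`, one-sidedly at
`0`. Continuity of the derivative is not required. -/
def BddC1 {X : Type*} [NormedAddCommGroup X] [NormedSpace ℝ X] (c : ℝ → X) : Prop :=
  ∃ (c' : ℝ → X) (M : ℝ), ∀ t ∈ Ici (0 : ℝ),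
    HasDerivWithinAt c (c' t) (Ici 0) t ∧ ‖c t‖ ≤ M ∧ ‖c' t‖ ≤ M

namespace BddC1

variable {X Y : Type*} [NormedAddCommGroup X] [NormedSpace ℝ X]
  [NormedAddCommGroup Y] [NormedSpace ℝ Y]

lemma const (x : X) : BddC1 fun _ => x :=
  ⟨fun _ => 0, ‖x‖, fun t _ => ⟨hasDerivWithinAt_const _ _ _, le_rfl, by simp⟩⟩

lemma add {c d : ℝ → X} (hc : BddC1 c) (hd : BddC1 d) : BddC1 fun t => c t + d t := by
  obtain ⟨c', M, h⟩ := hc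
  obtain ⟨d', N, k⟩ := hd
  refine ⟨fun t => c' t + d' t, M + N, fun t ht => ?_⟩
  obtain ⟨h1, h2, h3⟩ := h t ht
  obtain ⟨k1, k2, k3⟩ := k t ht
  exact ⟨h1.add k1, (norm_add_le _ _).trans (add_le_add h2 k2),
    (norm_add_le _ _).trans (add_le_add h3 k3)⟩

lemma clm_apply {c : ℝ → X →L[ℝ] Y} {d : ℝ → X} (hc : BddC1 c) (hd : BddC1 d) :
    BddC1 fun t => c t (d t) := by
  obtain ⟨c', M, h⟩ := hc
  obtain ⟨d', N, k⟩ := hd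
  have hM : 0 ≤ M := (norm_nonneg _).trans (h 0 self_mem_Ici).2.1
  have hN : 0 ≤ N := (norm_nonneg _).trans (k 0 self_mem_Ici).2.1
  refine ⟨fun t => c' t (d t) + c t (d' t), M * N + M * N, fun t ht => ?_⟩
  obtain ⟨h1, h2, h3⟩ := h t ht
  obtain ⟨k1, k2, k3⟩ := k t ht
  refine ⟨h1.clm_apply k1, ?_, (norm_add_le _ _).trans (add_le_add ?_ ?_)⟩
  · exact ((c t).le_opNorm _).trans (by gcongr) |>.trans (le_add_of_nonneg_right (by positivity))
  · exact ((c' t).le_opNorm _).trans (by gcongr)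
  · exact ((c t).le_opNorm _).trans (by gcongr)

lemma comp_clm {c : ℝ → X} (hc : BddC1 c) (L : X →L[ℝ] Y) : BddC1 fun t => L (c t) :=
  (const L).clm_apply hc

lemma mul {c d : ℝ → ℝ} (hc : BddC1 c) (hd : BddC1 d) : BddC1 fun t => c t * d t :=
  (hc.comp_clm (ContinuousLinearMap.mul ℝ ℝ)).clm_apply hd

lemma smul_const {c : ℝ → ℝ} (hc : BddC1 c) (x : X) : BddC1 fun t => c t • x :=
  hc.comp_clm ((ContinuousLinearMap.id ℝ ℝ).smulRight x)

lemma neg {c : ℝ → X} (hc : BddC1 c) : BddC1 fun t => -c t :=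
  hc.comp_clm (-ContinuousLinearMap.id ℝ X)

lemma comp_of_mem_Icc {c : ℝ → ℝ} (hc : BddC1 c) {a b : ℝ} (hab : ∀ t ∈ Ici (0 : ℝ), c t ∈ Icc a b)
    {g g' : ℝ → ℝ} (hg : ∀ x ∈ Icc a b, HasDerivAt g (g' x) x) (hg' : ContinuousOn g' (Icc a b)) :
    BddC1 fun t => g (c t) := by
  obtain ⟨c', M, h⟩ := hc
  have hM : 0 ≤ M := (norm_nonneg _).trans (h 0 self_mem_Ici).2.1
  obtain ⟨K, hK⟩ := isCompact_Icc.exists_bound_of_continuousOn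
    (f := g) (fun x hx => (hg x hx).continuousAt.continuousWithinAt)
  obtain ⟨L, hL⟩ := isCompact_Icc.exists_bound_of_continuousOn hg'
  have hL0 : 0 ≤ L := (norm_nonneg _).trans (hL _ (hab 0 self_mem_Ici))
  refine ⟨fun t => g' (c t) * c' t, max K (L * M), fun t ht => ⟨?_, ?_, ?_⟩⟩
  · exact (hg _ (hab t ht)).comp_hasDerivWithinAt t (h t ht).1
  · exact (hK _ (hab t ht)).trans (le_max_left _ _)
  · rw [norm_mul]
    refine le_trans ?_ (le_max_right _ _)
    have := hL _ (hab t ht)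
    have := (h t ht).2.2
    gcongr

end BddC1

/-! ### Geometry of the interface in the moving frame -/

/-- The tangent `τ = (cos θ, sin θ)` to the interface, opposite to the velocity of the flow. -/
noncomputable def tangentVec (θ : ℝ) : Plane := !₂[Real.cos θ, Real.sin θ]

/-- The unit normal `ν = (-sin θ, cos θ)` to the interface, in the direction of `∇κ`. -/
noncomputable def normalVec (θ : ℝ) : Plane := !₂[-Real.sin θ, Real.cos θ]

/-- All that the construction of the wave packet uses about the interface. In the frame
`τ = tangentVec θ`, `ν = normalVec θ`: the centre moves with velocity `-τ`; `α = θ'`, `ρ = r'` and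
`q = ∂²κ(ν, ν)`; and `κ` has Taylor expansions about the curve with remainders uniform in time,
whose quadratic part uses `∂²κ(τ, τ) = r α` and `∂²κ(τ, ν) = -ρ`. -/
structure InterfaceGeometry (κ : Plane → ℝ) (y : ℝ → Plane) (θ r α ρ q : ℝ → ℝ) : Prop where
  hasDeriv_y : ∀ t ∈ Ici (0 : ℝ), HasDerivWithinAt y (-tangentVec (θ t)) (Ici 0) t
  hasDeriv_θ : ∀ t ∈ Ici (0 : ℝ), HasDerivWithinAt θ (α t) (Ici 0) t
  hasDeriv_r : ∀ t ∈ Ici (0 : ℝ), HasDerivWithinAt r (ρ t) (Ici 0) t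
  le_r : ∃ m, 0 < m ∧ ∀ t ∈ Ici (0 : ℝ), m ≤ r t
  bdd_r : BddC1 r
  bdd_α : BddC1 α
  bdd_ρ : BddC1 ρ
  bdd_q : BddC1 q
  taylor_one : ∃ M, ∀ t ∈ Ici (0 : ℝ), ∀ a b : ℝ,
    |κ (y t + (a • tangentVec (θ t) + b • normalVec (θ t))) - r t * b| ≤ M * (|a| + |b|) ^ 2
  taylor_two : ∃ M, ∀ t ∈ Ici (0 : ℝ), ∀ a b : ℝ,
    |κ (y t + (a • tangentVec (θ t) + b • normalVec (θ t))) - r t * b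
      - (r t * α t * a ^ 2 - 2 * ρ t * a * b + q t * b ^ 2) / 2| ≤ M * (|a| + |b|) ^ 3

lemma norm_tangentVec (θ : ℝ) : ‖tangentVec θ‖ = 1 := by
  rw [EuclideanSpace.norm_eq]; simp [tangentVec, Fin.sum_univ_two]

lemma norm_normalVec (θ : ℝ) : ‖normalVec θ‖ = 1 := by
  rw [EuclideanSpace.norm_eq]; simp [normalVec, Fin.sum_univ_two]

lemma tangentVec_eq (θ : ℝ) : tangentVec θ = Real.cos θ • (EuclideanSpace.single 0 1 : Plane)
    + Real.sin θ • (EuclideanSpace.single 1 1 : Plane) := by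
  ext i; fin_cases i <;> simp [tangentVec]

lemma normalVec_eq (θ : ℝ) : normalVec θ = -Real.sin θ • (EuclideanSpace.single 0 1 : Plane)
    + Real.cos θ • (EuclideanSpace.single 1 1 : Plane) := by
  ext i; fin_cases i <;> simp [normalVec]

namespace SmoothBounded

variable {κ : Plane → ℝ} (h : SmoothBounded κ)
include h

lemma differentiable : Differentiable ℝ κ := h.1.differentiable (by simp)

lemma contDiff_fderiv : ContDiff ℝ ∞ (fderiv ℝ κ) := h.1.fderiv_right (by simp)

lemma differentiable_fderiv : Differentiable ℝ (fderiv ℝ κ) :=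
  h.contDiff_fderiv.differentiable (by simp)

lemma differentiable_fderiv_fderiv : Differentiable ℝ (fderiv ℝ (fderiv ℝ κ)) :=
  (h.contDiff_fderiv.fderiv_right (m := ∞) (by simp)).differentiable (by simp)

lemma exists_bound : ∃ M, ∀ x, |κ x| ≤ M := by
  obtain ⟨M, hM⟩ := h.2 0
  exact ⟨M, fun x => by simpa using hM x⟩

lemma exists_bound_fderiv : ∃ M, ∀ x, ‖fderiv ℝ κ x‖ ≤ M := by
  obtain ⟨M, hM⟩ := h.2 1
  exact ⟨M, fun x => by simpa [norm_iteratedFDeriv_one] using hM x⟩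

lemma exists_bound_fderiv_fderiv : ∃ M, ∀ x, ‖fderiv ℝ (fderiv ℝ κ) x‖ ≤ M := by
  obtain ⟨M, hM⟩ := h.2 2
  refine ⟨M, fun x => ?_⟩
  have := hM x
  rwa [← norm_iteratedFDeriv_fderiv, norm_iteratedFDeriv_one] at this

lemma exists_bound_fderiv_fderiv_fderiv :
    ∃ M, ∀ x, ‖fderiv ℝ (fderiv ℝ (fderiv ℝ κ)) x‖ ≤ M := by
  obtain ⟨M, hM⟩ := h.2 3
  refine ⟨M, fun x => ?_⟩
  have := hM x
  rwa [← norm_iteratedFDeriv_fderiv, ← norm_iteratedFDeriv_fderiv, norm_iteratedFDeriv_one] at this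

end SmoothBounded

open Filter Topology in
/-- A continuous angle is differentiable as soon as its sine and cosine are. -/
lemma hasDerivWithinAt_angle {θ : ℝ → ℝ} {s : Set ℝ} {t s' c' : ℝ}
    (hθ : ContinuousWithinAt θ s t)
    (hs : HasDerivWithinAt (fun u => Real.sin (θ u)) s' s t)
    (hc : HasDerivWithinAt (fun u => Real.cos (θ u)) c' s t) :
    HasDerivWithinAt θ (s' * Real.cos (θ t) - c' * Real.sin (θ t)) s t := by
  have h1 : HasDerivWithinAt (fun u => Real.sin (θ u - θ t))
      (s' * Real.cos (θ t) - c' * Real.sin (θ t)) s t := by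
    simp only [Real.sin_sub]
    exact (hs.mul_const _).sub (hc.mul_const _)
  have h2 : HasDerivWithinAt (fun u => θ t + Real.arcsin (Real.sin (θ u - θ t)))
      (s' * Real.cos (θ t) - c' * Real.sin (θ t)) s t := by
    have h3 : HasDerivAt Real.arcsin (1 / √(1 - Real.sin (θ t - θ t) ^ 2))
        (Real.sin (θ t - θ t)) := Real.hasDerivAt_arcsin (by simp) (by simp)
    have h4 := (h3.comp_hasDerivWithinAt t h1).const_add (θ t)
    simpa using h4
  have hev : ∀ᶠ u in 𝓝[s] t, |θ u - θ t| < Real.pi / 2 := by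
    have h5 : Tendsto (fun u => |θ u - θ t|) (𝓝[s] t) (𝓝 |θ t - θ t|) :=
      (hθ.sub_const (θ t)).abs
    exact h5.eventually_lt_const (by simpa using Real.pi_pos)
  refine h2.congr_of_eventuallyEq ?_ (by simp)
  filter_upwards [hev] with u hu
  rw [abs_lt] at hu
  rw [Real.arcsin_sin hu.1.le hu.2.le]
  ring

lemma BddC1.of_bound {X : Type*} [NormedAddCommGroup X] [NormedSpace ℝ X] {c c' : ℝ → X} {M N : ℝ}
    (h : ∀ t ∈ Ici (0 : ℝ), HasDerivWithinAt c (c' t) (Ici 0) t)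
    (hM : ∀ t ∈ Ici (0 : ℝ), ‖c t‖ ≤ M) (hN : ∀ t ∈ Ici (0 : ℝ), ‖c' t‖ ≤ N) : BddC1 c :=
  ⟨c', max M N, fun t ht => ⟨h t ht, (hM t ht).trans (le_max_left _ _),
    (hN t ht).trans (le_max_right _ _)⟩⟩

namespace IsInterfaceFlow

variable {κ : Plane → ℝ} {y : ℝ → Plane} {θ r : ℝ → ℝ} (hf : IsInterfaceFlow κ y θ r)
  (hκ : SmoothBounded κ)
include hf

lemma gradient_eq {t : ℝ} (ht : t ∈ Ici (0 : ℝ)) : gradient κ (y t) = r t • normalVec (θ t) :=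
  hf.angle t ht

lemma fderiv_apply {t : ℝ} (ht : t ∈ Ici (0 : ℝ)) (v : Plane) :
    fderiv ℝ κ (y t) v = r t * (-Real.sin (θ t) * v 0 + Real.cos (θ t) * v 1) := by
  rw [← inner_gradient_left, hf.gradient_eq ht]
  simp [normalVec, PiLp.inner_apply, Fin.sum_univ_two]
  ring

include hκ

lemma kappa_eq_zero {t : ℝ} (ht : t ∈ Ici (0 : ℝ)) : κ (y t) = 0 := by
  have hd : ∀ s ∈ Ici (0 : ℝ), HasDerivWithinAt (fun s => κ (y s)) 0 (Ici 0) s := by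
    intro s hs
    refine ((hκ.differentiable (y s)).hasFDerivAt.comp_hasDerivWithinAt s
      (hf.ode s hs)).congr_deriv ?_
    rw [hf.fderiv_apply hs, tangentField, hf.gradient_eq hs]
    simp only [perp, normalVec, PiLp.smul_apply, smul_eq_mul, Matrix.cons_val_zero,
      Matrix.cons_val_one]
    ring
  have := (convex_Ici (0 : ℝ)).norm_image_sub_le_of_norm_hasDerivWithin_le hd
    (C := 0) (fun s _ => by simp) self_mem_Ici ht
  simp only [zero_mul, norm_le_zero_iff, hf.start, sub_zero] at this
  exact this

lemma exists_le_r (htr : Transversal κ) : ∃ m, 0 < m ∧ ∀ t ∈ Ici (0 : ℝ), m ≤ r t := by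
  set I : ℝ≥0∞ := ⨅ y ∈ {y : Plane | κ y = 0}, ‖gradient κ y‖ₑ with hI
  refine ⟨(min I 1).toReal, ENNReal.toReal_pos (lt_min htr one_pos).ne'
    (min_lt_of_right_lt ENNReal.one_lt_top).ne, fun t ht => ?_⟩
  have h1 : I ≤ ‖gradient κ (y t)‖ₑ := iInf₂_le (y t) (hf.kappa_eq_zero hκ ht)
  have h2 := ENNReal.toReal_mono enorm_ne_top ((min_le_left I 1).trans h1)
  rwa [toReal_enorm, ← hf.modulus t ht] at h2

/-- Differentiating `∇κ(y_t) = r ν` along the curve expresses `θ'` and `r'` through the Hessian of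
`κ`. Since `κ` has bounded derivatives and `r` is bounded below by transversality, all the bounds
are uniform in time. -/
theorem interfaceGeometry (htr : Transversal κ) :
    ∃ α ρ q : ℝ → ℝ, InterfaceGeometry κ y θ r α ρ q := by
  obtain ⟨m, hm0, hm⟩ := hf.exists_le_r hκ htr
  have hr0 : ∀ t ∈ Ici (0 : ℝ), 0 < r t := fun t ht => hm0.trans_le (hm t ht)
  obtain ⟨M₁, hM₁⟩ := hκ.exists_bound_fderiv
  obtain ⟨M₂, hM₂⟩ := hκ.exists_bound_fderiv_fderiv
  obtain ⟨M₃, hM₃⟩ := hκ.exists_bound_fderiv_fderiv_fderiv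
  have hM₂0 : 0 ≤ M₂ := (norm_nonneg _).trans (hM₂ 0)
  have hM₃0 : 0 ≤ M₃ := (norm_nonneg _).trans (hM₃ 0)
  set D := fderiv ℝ (fderiv ℝ κ) with hD
  have hsymm : ∀ x v w, D x v w = D x w v := fun x =>
    (hκ.1.contDiffAt (x := x)).isSymmSndFDerivAt
      (by rw [minSmoothness_of_isRCLikeNormedField]; exact WithTop.coe_le_coe.2 le_top)
  -- the velocity of the curve
  have hy : ∀ t ∈ Ici (0 : ℝ), HasDerivWithinAt y (-tangentVec (θ t)) (Ici 0) t := by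
    intro t ht
    convert hf.ode t ht using 1
    rw [tangentField, ← hf.modulus t ht, hf.gradient_eq ht]
    have := (hr0 t ht).ne'
    ext i
    fin_cases i <;> simp [tangentVec, normalVec, perp] <;> field_simp
  have hr_le : ∀ t ∈ Ici (0 : ℝ), r t ≤ M₁ := by
    intro t ht
    rw [hf.modulus t ht, ← LinearIsometryEquiv.norm_map (InnerProductSpace.toDual ℝ Plane),
      toDual_gradient]
    exact hM₁ _
  -- derivative of the gradient along the curve
  have hg : ∀ v, ∀ t ∈ Ici (0 : ℝ), HasDerivWithinAt (fun s => fderiv ℝ κ (y s) v)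
      (-D (y t) (tangentVec (θ t)) v) (Ici 0) t := by
    intro v t ht
    have h1 := (hκ.differentiable_fderiv (y t)).hasFDerivAt.comp_hasDerivWithinAt t (hy t ht)
    have h2 := h1.clm_apply (hasDerivWithinAt_const t (Ici 0) v)
    refine h2.congr_deriv ?_
    simp [hD]
  set e₀ : Plane := EuclideanSpace.single 0 1 with he₀
  set e₁ : Plane := EuclideanSpace.single 1 1 with he₁
  have hDt : ∀ t v, D (y t) v (tangentVec (θ t)) = Real.cos (θ t) * D (y t) v e₀
      + Real.sin (θ t) * D (y t) v e₁ := fun t v => by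
    rw [tangentVec_eq, map_add, map_smul, map_smul, smul_eq_mul, smul_eq_mul]
  have hDn : ∀ t v, D (y t) v (normalVec (θ t)) = -Real.sin (θ t) * D (y t) v e₀
      + Real.cos (θ t) * D (y t) v e₁ := fun t v => by
    rw [normalVec_eq, map_add, map_smul, map_smul, smul_eq_mul, smul_eq_mul]
  have hg₀ : ∀ t ∈ Ici (0 : ℝ), fderiv ℝ κ (y t) e₀ = -(r t * Real.sin (θ t)) := fun t ht => by
    rw [hf.fderiv_apply ht]; simp [he₀]
  have hg₁ : ∀ t ∈ Ici (0 : ℝ), fderiv ℝ κ (y t) e₁ = r t * Real.cos (θ t) := fun t ht => by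
    rw [hf.fderiv_apply ht]; simp [he₁]
  set ρ : ℝ → ℝ := fun t => -D (y t) (tangentVec (θ t)) (normalVec (θ t)) with hρ
  set α : ℝ → ℝ := fun t => D (y t) (tangentVec (θ t)) (tangentVec (θ t)) * (r t)⁻¹ with hα
  set q : ℝ → ℝ := fun t => D (y t) (normalVec (θ t)) (normalVec (θ t)) with hq
  have hr : ∀ t ∈ Ici (0 : ℝ), HasDerivWithinAt r (ρ t) (Ici 0) t := by
    intro t ht
    have hrt := hr0 t ht
    have hsq : ∀ s ∈ Ici (0 : ℝ),
        (fderiv ℝ κ (y s) e₀) ^ 2 + (fderiv ℝ κ (y s) e₁) ^ 2 = r s ^ 2 := by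
      intro s hs
      rw [hg₀ s hs, hg₁ s hs]
      linear_combination r s ^ 2 * Real.sin_sq_add_cos_sq (θ s)
    have h1 := (((hg e₀ t ht).pow 2).add ((hg e₁ t ht).pow 2)).sqrt (by
      simp only [Pi.add_apply, Pi.pow_apply]
      rw [hsq t ht]; positivity)
    have h2 : ∀ s ∈ Ici (0 : ℝ), r s
        = √((fderiv ℝ κ (y s) e₀) ^ 2 + (fderiv ℝ κ (y s) e₁) ^ 2) := fun s hs => by
      rw [hsq s hs, Real.sqrt_sq (hr0 s hs).le]
    refine (h1.congr h2 (h2 t ht)).congr_deriv ?_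
    simp only [Pi.add_apply, Pi.pow_apply]
    rw [← h2 t ht, hg₀ t ht, hg₁ t ht, hρ]
    simp only [hDn]
    field_simp
    simp
    ring
  have hsin : ∀ t ∈ Ici (0 : ℝ), HasDerivWithinAt (fun s => Real.sin (θ s))
      (D (y t) (tangentVec (θ t)) e₀ / r t - Real.sin (θ t) * ρ t / r t) (Ici 0) t := by
    intro t ht
    have hrt := (hr0 t ht).ne'
    have h1 := ((hg e₀ t ht).neg).div (hr t ht) hrt
    refine (h1.congr (fun s hs => ?_) ?_).congr_deriv ?_
    · simp only [Pi.div_apply, Pi.neg_apply]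
      rw [hg₀ s hs]; field_simp [(hr0 s hs).ne']
    · simp only [Pi.div_apply, Pi.neg_apply]
      rw [hg₀ t ht]; field_simp
    · simp only [Pi.neg_apply]
      rw [hg₀ t ht]; field_simp
  have hcos : ∀ t ∈ Ici (0 : ℝ), HasDerivWithinAt (fun s => Real.cos (θ s))
      (-D (y t) (tangentVec (θ t)) e₁ / r t - Real.cos (θ t) * ρ t / r t) (Ici 0) t := by
    intro t ht
    have hrt := (hr0 t ht).ne'
    have h1 := (hg e₁ t ht).div (hr t ht) hrt
    refine (h1.congr (fun s hs => ?_) ?_).congr_deriv ?_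
    · simp only [Pi.div_apply]
      rw [hg₁ s hs]; field_simp [(hr0 s hs).ne']
    · simp only [Pi.div_apply]
      rw [hg₁ t ht]; field_simp
    · rw [hg₁ t ht]; field_simp
  have hθ : ∀ t ∈ Ici (0 : ℝ), HasDerivWithinAt θ (α t) (Ici 0) t := by
    intro t ht
    have hrt := (hr0 t ht).ne'
    refine (hasDerivWithinAt_angle (hf.angle_continuous t ht) (hsin t ht)
      (hcos t ht)).congr_deriv ?_
    simp only [hα, hDt]
    field_simp
    ring
  -- bounds
  have hDb : ∀ t v w, ‖v‖ = 1 → ‖w‖ = 1 → |D (y t) v w| ≤ M₂ := by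
    intro t v w hv hw
    have h1 := ((D (y t) v).le_opNorm w).trans
      (mul_le_mul_of_nonneg_right ((D (y t)).le_opNorm v) (norm_nonneg w))
    rw [hv, hw, mul_one, mul_one] at h1
    exact h1.trans (hM₂ _)
  have hρb : ∀ t, |ρ t| ≤ M₂ := fun t => by
    rw [hρ, abs_neg]; exact hDb t _ _ (norm_tangentVec _) (norm_normalVec _)
  have hαb : ∀ t ∈ Ici (0 : ℝ), |α t| ≤ M₂ * m⁻¹ := fun t ht => by
    rw [hα, abs_mul, abs_of_pos (inv_pos.2 (hr0 t ht))]
    have := hDb t _ _ (norm_tangentVec (θ t)) (norm_tangentVec (θ t))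
    have := hm t ht
    have := hr0 t ht
    gcongr
  have hbr : BddC1 r := BddC1.of_bound hr
    (fun t ht => (Real.norm_of_nonneg (hr0 t ht).le).le.trans (hr_le t ht)) (fun t _ => hρb t)
  have hbsin : BddC1 fun t => Real.sin (θ t) := BddC1.of_bound (M := 1)
    (fun t ht => (hθ t ht).sin) (fun t _ => Real.abs_sin_le_one _) (N := M₂ * m⁻¹)
    (fun t ht => by
      rw [norm_mul]
      exact (mul_le_of_le_one_left (norm_nonneg _) (Real.abs_cos_le_one _)).trans (hαb t ht))
  have hbcos : BddC1 fun t => Real.cos (θ t) := BddC1.of_bound (M := 1)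
    (fun t ht => (hθ t ht).cos) (fun t _ => Real.abs_cos_le_one _) (N := M₂ * m⁻¹)
    (fun t ht => by
      rw [norm_mul, norm_neg]
      exact (mul_le_of_le_one_left (norm_nonneg _) (Real.abs_sin_le_one _)).trans (hαb t ht))
  have hbt : BddC1 fun t => tangentVec (θ t) := by
    simp only [tangentVec_eq]; exact (hbcos.smul_const _).add (hbsin.smul_const _)
  have hbn : BddC1 fun t => normalVec (θ t) := by
    simp only [normalVec_eq]; exact (hbsin.neg.smul_const _).add (hbcos.smul_const _)
  have hbD : BddC1 fun t => D (y t) := BddC1.of_bound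
    (fun t ht => (hκ.differentiable_fderiv_fderiv (y t)).hasFDerivAt.comp_hasDerivWithinAt t
      (hy t ht)) (fun t _ => hM₂ _) (N := M₃) (fun t _ => by
      refine (ContinuousLinearMap.le_opNorm _ _).trans ?_
      rw [norm_neg, norm_tangentVec, mul_one]; exact hM₃ _)
  have hbrinv : BddC1 fun t => (r t)⁻¹ := hbr.comp_of_mem_Icc (a := m) (b := M₁)
    (fun t ht => ⟨hm t ht, hr_le t ht⟩)
    (fun x hx => hasDerivAt_inv (hm0.trans_le hx.1).ne')
    (by
      refine ContinuousOn.neg (ContinuousOn.inv₀ (by fun_prop) fun x hx => ?_)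
      exact pow_ne_zero 2 (hm0.trans_le hx.1).ne')
  -- the Taylor expansion in the moving frame
  have hnorm : ∀ t (a b : ℝ), ‖a • tangentVec (θ t) + b • normalVec (θ t)‖ ≤ |a| + |b| := by
    intro t a b
    refine (norm_add_le _ _).trans ?_
    rw [norm_smul, norm_smul, norm_tangentVec, norm_normalVec, mul_one, mul_one, Real.norm_eq_abs,
      Real.norm_eq_abs]
  have hfirst : ∀ t ∈ Ici (0 : ℝ), ∀ a b : ℝ,
      fderiv ℝ κ (y t) (a • tangentVec (θ t) + b • normalVec (θ t)) = r t * b := by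
    intro t ht a b
    rw [hf.fderiv_apply ht]
    simp only [tangentVec, normalVec, PiLp.add_apply, PiLp.smul_apply, smul_eq_mul,
      Matrix.cons_val_zero, Matrix.cons_val_one]
    linear_combination r t * b * Real.sin_sq_add_cos_sq (θ t)
  have hsecond : ∀ t ∈ Ici (0 : ℝ), ∀ a b : ℝ,
      D (y t) (a • tangentVec (θ t) + b • normalVec (θ t))
        (a • tangentVec (θ t) + b • normalVec (θ t))
      = r t * α t * a ^ 2 - 2 * ρ t * a * b + q t * b ^ 2 := by
    intro t ht a b
    have hrt := (hr0 t ht).ne'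
    simp only [map_add, map_smul, add_apply, smul_apply,
      smul_eq_mul, hα, hρ, hq]
    rw [hsymm (y t) (normalVec (θ t)) (tangentVec (θ t))]
    field_simp
    ring
  refine ⟨α, ρ, q, hy, hθ, hr, ⟨m, hm0, hm⟩, hbr, ((hbD.clm_apply hbt).clm_apply hbt).mul hbrinv,
    ((hbD.clm_apply hbt).clm_apply hbn).neg, (hbD.clm_apply hbn).clm_apply hbn,
    ⟨M₂, fun t ht a b => ?_⟩, ⟨M₃, fun t ht a b => ?_⟩⟩
  · have h1 := norm_sub_sub_fderiv_le hκ.differentiable hκ.differentiable_fderiv hM₂ (y t)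
      (a • tangentVec (θ t) + b • normalVec (θ t))
    rw [hfirst t ht, hf.kappa_eq_zero hκ ht, sub_zero, Real.norm_eq_abs] at h1
    have := hnorm t a b
    exact h1.trans (by gcongr)
  · have h1 := norm_sub_taylor_two_le hκ.differentiable hκ.differentiable_fderiv
      hκ.differentiable_fderiv_fderiv hM₃ (y t)
      (a • tangentVec (θ t) + b • normalVec (θ t))
    rw [hfirst t ht, hf.kappa_eq_zero hκ ht, sub_zero, ← hD, hsecond t ht] at h1
    have := hnorm t a b
    exact h1.trans (by gcongr)

end IsInterfaceFlow

/-! ### Classes of profiles in the moving coordinates -/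

/-- The points `(t, a, b)` with `t ≥ 0`: time, tangential and normal coordinate. -/
def forwardTimes : Set (ℝ × ℝ × ℝ) := Ici 0 ×ˢ univ

/-- The function `u` is differentiable on `forwardTimes`, and both `u` and its derivative are
bounded by `φ`. The derivative is taken within this set, one-sidedly at `t = 0`. -/
def C1Bound (u : ℝ × ℝ × ℝ → ℂ) (φ : ℝ × ℝ × ℝ → ℝ) : Prop :=
  ∀ p ∈ forwardTimes, ‖u p‖ ≤ φ p ∧
    ∃ u' : ℝ × ℝ × ℝ →L[ℝ] ℂ, HasFDerivWithinAt u u' forwardTimes p ∧ ‖u'‖ ≤ φ p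

namespace C1Bound

variable {u v : ℝ × ℝ × ℝ → ℂ} {φ ψ : ℝ × ℝ × ℝ → ℝ}

lemma mono (h : C1Bound u φ) (hφ : ∀ p ∈ forwardTimes, φ p ≤ ψ p) : C1Bound u ψ := by
  intro p hp
  obtain ⟨h1, u', h2, h3⟩ := h p hp
  exact ⟨h1.trans (hφ p hp), u', h2, h3.trans (hφ p hp)⟩

lemma add (hu : C1Bound u φ) (hv : C1Bound v ψ) :
    C1Bound (fun p => u p + v p) (fun p => φ p + ψ p) := by
  intro p hp
  obtain ⟨h1, u', h2, h3⟩ := hu p hp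
  obtain ⟨k1, v', k2, k3⟩ := hv p hp
  exact ⟨(norm_add_le _ _).trans (add_le_add h1 k1), u' + v', h2.add k2,
    (norm_add_le _ _).trans (add_le_add h3 k3)⟩

lemma mul (hu : C1Bound u φ) (hv : C1Bound v ψ) :
    C1Bound (fun p => u p * v p) (fun p => 2 * (φ p * ψ p)) := by
  intro p hp
  obtain ⟨h1, u', h2, h3⟩ := hu p hp
  obtain ⟨k1, v', k2, k3⟩ := hv p hp
  have hφ : 0 ≤ φ p := (norm_nonneg _).trans h1
  have hψ : 0 ≤ ψ p := (norm_nonneg _).trans k1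
  refine ⟨?_, u p • v' + v p • u', h2.mul k2, ?_⟩
  · rw [norm_mul]
    nlinarith [mul_le_mul h1 k1 (norm_nonneg _) hφ, mul_nonneg hφ hψ]
  · refine (norm_add_le _ _).trans ?_
    rw [norm_smul, norm_smul]
    nlinarith [mul_le_mul h1 k3 (norm_nonneg _) hφ, mul_le_mul k1 h3 (norm_nonneg _) hψ]

lemma of_comp_fst {c : ℝ → ℝ} (hc : BddC1 c) : ∃ C, C1Bound (fun p => (c p.1 : ℂ)) (fun _ => C) := by
  obtain ⟨c', M, h⟩ := hc
  refine ⟨M, fun p hp => ?_⟩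
  obtain ⟨h1, h2, h3⟩ := h p.1 hp.1
  have hd : HasFDerivWithinAt (fun p : ℝ × ℝ × ℝ => c p.1)
      ((ContinuousLinearMap.toSpanSingleton ℝ (c' p.1)) ∘L ContinuousLinearMap.fst ℝ ℝ (ℝ × ℝ))
      forwardTimes p :=
    h1.hasFDerivWithinAt.comp p hasFDerivWithinAt_fst (fun z hz => hz.1)
  refine ⟨by simpa using h2, _, Complex.ofRealCLM.hasFDerivAt.comp_hasFDerivWithinAt p hd, ?_⟩
  refine ContinuousLinearMap.opNorm_le_bound _ ((norm_nonneg _).trans h3) fun z => ?_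
  simp only [ContinuousLinearMap.comp_apply, ContinuousLinearMap.toSpanSingleton_apply,
    ContinuousLinearMap.coe_fst', Complex.ofRealCLM_apply, Complex.norm_real, norm_smul]
  rw [mul_comm]
  exact mul_le_mul h3 (norm_fst_le z) (norm_nonneg _) ((norm_nonneg _).trans h3)

end C1Bound

/-- The weight `1 + |a| + |b|`. -/
def transverseWeight (p : ℝ × ℝ × ℝ) : ℝ := 1 + |p.2.1| + |p.2.2|

lemma one_le_transverseWeight (p : ℝ × ℝ × ℝ) : 1 ≤ transverseWeight p := by
  unfold transverseWeight; linarith [abs_nonneg p.2.1, abs_nonneg p.2.2]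

lemma transverseWeight_pos (p : ℝ × ℝ × ℝ) : 0 < transverseWeight p :=
  zero_lt_one.trans_le (one_le_transverseWeight p)

/-- The function and its derivative grow at most polynomially in `(a, b)`, uniformly in `t ≥ 0`. -/
def IsTame (u : ℝ × ℝ × ℝ → ℂ) : Prop :=
  ∃ (C : ℝ) (N : ℕ), C1Bound u fun p => C * transverseWeight p ^ N

/-- The function and its derivative decay faster than any power of `(a, b)`, uniformly in
`t ≥ 0`. -/
def IsProfile (u : ℝ × ℝ × ℝ → ℂ) : Prop :=
  ∀ N : ℕ, ∃ C : ℝ, C1Bound u fun p => C / transverseWeight p ^ N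

namespace IsTame

variable {u v : ℝ × ℝ × ℝ → ℂ}

lemma of_bddC1 {c : ℝ → ℝ} (hc : BddC1 c) : IsTame fun p => (c p.1 : ℂ) := by
  obtain ⟨C, hC⟩ := C1Bound.of_comp_fst hc
  exact ⟨C, 0, by simpa using hC⟩

lemma const (z : ℂ) : IsTame fun _ => z :=
  ⟨‖z‖, 0, fun p _ => ⟨by simp, 0, hasFDerivWithinAt_const _ _ _, by simp⟩⟩

/-- Linear coordinates are tame; the hypothesis says that the time coordinate, which is unbounded
on `forwardTimes`, does not occur. -/
lemma clm (L : ℝ × ℝ × ℝ →L[ℝ] ℝ) (hL : ∀ p, |L p| ≤ |p.2.1| + |p.2.2|) :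
    IsTame fun p => (L p : ℂ) := by
  refine ⟨1 + ‖L‖, 1, fun p _ => ⟨?_, Complex.ofRealCLM ∘L L,
    (Complex.ofRealCLM ∘L L).hasFDerivWithinAt, ?_⟩⟩
  · simp only [Complex.norm_real, Real.norm_eq_abs, pow_one]
    have := one_le_transverseWeight p
    have h2 : |L p| ≤ transverseWeight p := (hL p).trans (by unfold transverseWeight; linarith)
    nlinarith [norm_nonneg L]
  · have h1 : ‖Complex.ofRealCLM ∘L L‖ ≤ ‖L‖ :=
      ContinuousLinearMap.opNorm_le_bound _ (norm_nonneg _) fun z => by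
        simpa using L.le_opNorm z
    have := one_le_transverseWeight p
    simp only [pow_one]
    nlinarith [norm_nonneg L]

lemma tangential : IsTame fun p => (p.2.1 : ℂ) :=
  clm (ContinuousLinearMap.fst ℝ ℝ ℝ ∘L ContinuousLinearMap.snd ℝ ℝ (ℝ × ℝ))
    fun p => by simp

lemma normal : IsTame fun p => (p.2.2 : ℂ) :=
  clm (ContinuousLinearMap.snd ℝ ℝ ℝ ∘L ContinuousLinearMap.snd ℝ ℝ (ℝ × ℝ))
    fun p => by simp

lemma add (hu : IsTame u) (hv : IsTame v) : IsTame fun p => u p + v p := by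
  obtain ⟨C, N, h⟩ := hu
  obtain ⟨D, K, k⟩ := hv
  refine ⟨|C| + |D|, max N K, (h.add k).mono fun p _ => ?_⟩
  have h1 := one_le_transverseWeight p
  have h0 := transverseWeight_pos p
  rw [add_mul]
  refine add_le_add ?_ ?_
  · exact mul_le_mul (le_abs_self _) (pow_le_pow_right₀ h1 (le_max_left _ _)) (by positivity)
      (abs_nonneg _)
  · exact mul_le_mul (le_abs_self _) (pow_le_pow_right₀ h1 (le_max_right _ _)) (by positivity)
      (abs_nonneg _)

lemma mul (hu : IsTame u) (hv : IsTame v) : IsTame fun p => u p * v p := by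
  obtain ⟨C, N, h⟩ := hu
  obtain ⟨D, K, k⟩ := hv
  refine ⟨2 * (C * D), N + K, (h.mul k).mono fun p _ => le_of_eq ?_⟩
  rw [pow_add]; ring

end IsTame

namespace IsProfile

variable {u v : ℝ × ℝ × ℝ → ℂ}

lemma add (hu : IsProfile u) (hv : IsProfile v) : IsProfile fun p => u p + v p := by
  intro N
  obtain ⟨C, h⟩ := hu N
  obtain ⟨D, k⟩ := hv N
  exact ⟨C + D, (h.add k).mono fun p _ => by rw [add_div]⟩

lemma tame_mul (hu : IsTame u) (hv : IsProfile v) : IsProfile fun p => u p * v p := by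
  obtain ⟨C, K, h⟩ := hu
  intro N
  obtain ⟨D, k⟩ := hv (N + K)
  refine ⟨2 * (C * D), (h.mul k).mono fun p _ => le_of_eq ?_⟩
  have h0 := transverseWeight_pos p
  rw [pow_add]
  field_simp

end IsProfile

lemma exists_exp_neg_sq_le {m : ℝ} (hm : 0 < m) (N : ℕ) :
    ∃ C, 0 ≤ C ∧ ∀ b : ℝ, (1 + |b|) ^ N * Real.exp (-(m / 2) * b ^ 2) ≤ C := by
  have h1 : ∀ x : ℝ, 0 ≤ x → x ^ N * Real.exp (-x) ≤ N.factorial := by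
    intro x hx
    rw [Real.exp_neg, ← div_eq_mul_inv, div_le_iff₀ (Real.exp_pos _), mul_comm,
      ← div_le_iff₀ (by positivity)]
    exact Real.pow_div_factorial_le_exp x hx N
  refine ⟨N.factorial * Real.exp (1 + 1 / (2 * m)), by positivity, fun b => ?_⟩
  have h2 := h1 (1 + |b|) (by positivity)
  have h3 : -(m / 2) * b ^ 2 ≤ -(1 + |b|) + (1 + 1 / (2 * m)) := by
    have : 0 ≤ (m * |b| - 1) ^ 2 / (2 * m) := by positivity
    have e : (m * |b| - 1) ^ 2 / (2 * m) = m / 2 * |b| ^ 2 - |b| + 1 / (2 * m) := by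
      field_simp; ring
    rw [e, sq_abs] at this
    linarith
  calc _ ≤ (1 + |b|) ^ N * Real.exp (-(1 + |b|) + (1 + 1 / (2 * m))) := by gcongr
    _ = ((1 + |b|) ^ N * Real.exp (-(1 + |b|))) * Real.exp (1 + 1 / (2 * m)) := by
      rw [Real.exp_add]; ring
    _ ≤ _ := by gcongr

lemma exists_schwartz_le (h : 𝓢(ℝ, ℂ)) (N : ℕ) : ∃ C, ∀ a : ℝ, (1 + |a|) ^ N * ‖h a‖ ≤ C := by
  refine ⟨2 ^ N * ((Finset.Iic (N, 0)).sup fun m => SchwartzMap.seminorm ℝ m.1 m.2) h,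
    fun a => ?_⟩
  have := SchwartzMap.one_add_le_sup_seminorm_apply (𝕜 := ℝ) (m := (N, 0)) (k := N) (n := 0)
    le_rfl le_rfl h a
  simpa using this

/-- The product `h(a) exp(-r(t) b² / 2)`. Every profile of the construction is a combination of such
blocks with tame coefficients. -/
noncomputable def profileBlock (r : ℝ → ℝ) (h : ℝ → ℂ) (p : ℝ × ℝ × ℝ) : ℂ :=
  h p.2.1 * (Real.exp (-(r p.1 / 2) * p.2.2 ^ 2) : ℝ)

lemma c1Bound_schwartz (h : 𝓢(ℝ, ℂ)) (N : ℕ) :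
    ∃ C, C1Bound (fun p => h p.2.1) fun p => C / (1 + |p.2.1|) ^ N := by
  obtain ⟨C, hC⟩ := exists_schwartz_le h N
  obtain ⟨D, hD⟩ := exists_schwartz_le (SchwartzMap.derivCLM ℝ ℂ h) N
  refine ⟨max C D, fun p _ => ⟨?_, ?_⟩⟩
  · rw [le_div_iff₀ (by positivity), mul_comm]
    exact (hC _).trans (le_max_left _ _)
  · refine ⟨_, (h.hasDerivAt p.2.1).hasFDerivAt.comp_hasFDerivWithinAt p
      ((ContinuousLinearMap.fst ℝ ℝ ℝ ∘L ContinuousLinearMap.snd ℝ ℝ (ℝ × ℝ)).hasFDerivWithinAt),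
      ?_⟩
    have h1 : ‖deriv h p.2.1‖ ≤ max C D / (1 + |p.2.1|) ^ N := by
      rw [le_div_iff₀ (by positivity), mul_comm]
      exact (hD p.2.1).trans (le_max_right _ _)
    refine le_trans (ContinuousLinearMap.opNorm_le_bound _ (norm_nonneg _) fun z => ?_) h1
    simp only [ContinuousLinearMap.comp_apply, ContinuousLinearMap.toSpanSingleton_apply,
      ContinuousLinearMap.coe_fst', ContinuousLinearMap.coe_snd', norm_smul]
    rw [mul_comm]
    gcongr
    exact (norm_fst_le z.2).trans (norm_snd_le z)

lemma c1Bound_gaussian {r ρ : ℝ → ℝ} {m M : ℝ} (hm : 0 < m) (hr : ∀ t ∈ Ici (0 : ℝ), m ≤ r t)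
    (hr' : ∀ t ∈ Ici (0 : ℝ), HasDerivWithinAt r (ρ t) (Ici 0) t)
    (hM : ∀ t ∈ Ici (0 : ℝ), |r t| ≤ M) (hρ : ∀ t ∈ Ici (0 : ℝ), |ρ t| ≤ M) (N : ℕ) :
    ∃ C, C1Bound (fun p => ((Real.exp (-(r p.1 / 2) * p.2.2 ^ 2) : ℝ) : ℂ))
      fun p => C / (1 + |p.2.2|) ^ N := by
  obtain ⟨C, hC0, hC⟩ := exists_exp_neg_sq_le hm (N + 2)
  have hM0 : 0 ≤ M := (abs_nonneg _).trans (hM 0 self_mem_Ici)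
  have hexp : ∀ p ∈ forwardTimes, (1 + |p.2.2|) ^ (N + 2) * Real.exp (-(r p.1 / 2) * p.2.2 ^ 2) ≤ C := by
    intro p hp
    refine le_trans ?_ (hC p.2.2)
    have := hr p.1 hp.1
    have := sq_nonneg p.2.2
    gcongr (1 + |p.2.2|) ^ (N + 2) * Real.exp ?_
    nlinarith
  refine ⟨C * (1 + 2 * M), fun p hp => ⟨?_, ?_⟩⟩
  · have h1 := hexp p hp
    rw [Complex.norm_real, Real.norm_of_nonneg (Real.exp_pos _).le, le_div_iff₀ (by positivity),
      mul_comm]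
    have h2 : (1 : ℝ) ≤ (1 + |p.2.2|) ^ 2 := one_le_pow₀ (by linarith [abs_nonneg p.2.2])
    have h3 : 0 ≤ (1 + |p.2.2|) ^ N * Real.exp (-(r p.1 / 2) * p.2.2 ^ 2) := by positivity
    rw [pow_add] at h1
    nlinarith
  · have d1 : HasFDerivWithinAt (fun p : ℝ × ℝ × ℝ => r p.1)
        ((ContinuousLinearMap.toSpanSingleton ℝ (ρ p.1)) ∘L ContinuousLinearMap.fst ℝ ℝ (ℝ × ℝ))
        forwardTimes p :=
      (hr' p.1 hp.1).hasFDerivWithinAt.comp p hasFDerivWithinAt_fst (fun z hz => hz.1)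
    have d2 := (ContinuousLinearMap.snd ℝ ℝ ℝ ∘L ContinuousLinearMap.snd ℝ ℝ (ℝ × ℝ)).hasFDerivWithinAt
      (s := forwardTimes) (x := p)
    have d3 := ((d1.mul_const (-(1 / 2) : ℝ)).mul (d2.pow 2)).exp
    set E := Real.exp (-(r p.1 / 2) * p.2.2 ^ 2) with hE
    set L : ℝ × ℝ × ℝ →L[ℝ] ℝ := (-(ρ p.1 * p.2.2 ^ 2 / 2) * E) • ContinuousLinearMap.fst ℝ ℝ (ℝ × ℝ)
      + (-(r p.1 * p.2.2) * E) •
        (ContinuousLinearMap.snd ℝ ℝ ℝ ∘L ContinuousLinearMap.snd ℝ ℝ (ℝ × ℝ)) with hL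
    have hd : HasFDerivWithinAt (fun p => Real.exp (-(r p.1 / 2) * p.2.2 ^ 2)) L forwardTimes p := by
      have hfun : ∀ z : ℝ × ℝ × ℝ, Real.exp (-(r z.1 / 2) * z.2.2 ^ 2)
          = Real.exp (r z.1 * -(1 / 2) * z.2.2 ^ 2) := fun z => by congr 1; ring
      refine (d3.congr (fun z _ => hfun z) (hfun p)).congr_fderiv ?_
      refine ContinuousLinearMap.ext fun z => ?_
      have := hfun p
      simp only [hL, hE, this]
      simp
      ring
    refine ⟨_, Complex.ofRealCLM.hasFDerivAt.comp_hasFDerivWithinAt p hd, ?_⟩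
    have hE0 : 0 ≤ E := (Real.exp_pos _).le
    have h1 : E * (1 + |p.2.2|) ^ 2 ≤ C / (1 + |p.2.2|) ^ N := by
      rw [le_div_iff₀ (by positivity)]
      have := hexp p hp
      rw [pow_add] at this
      linarith
    have hr1 := hM p.1 hp.1
    have hρ1 := hρ p.1 hp.1
    refine ContinuousLinearMap.opNorm_le_bound _ (by positivity) fun z => ?_
    have hz1 : |z.1| ≤ ‖z‖ := norm_fst_le z
    have hz2 : |z.2.2| ≤ ‖z‖ := (norm_snd_le z.2).trans (norm_snd_le z)
    have e1 : ‖(Complex.ofRealCLM ∘L L) z‖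
        = |-(ρ p.1 * p.2.2 ^ 2 / 2) * E * z.1 + -(r p.1 * p.2.2) * E * z.2.2| := by
      rw [ContinuousLinearMap.comp_apply, Complex.ofRealCLM_apply, Complex.norm_real]
      rfl
    rw [e1]
    refine (abs_add_le _ _).trans ?_
    simp only [abs_mul, abs_neg, abs_div, abs_pow, abs_of_nonneg hE0]
    have b0 := abs_nonneg p.2.2
    calc |ρ p.1| * |p.2.2| ^ 2 / |2| * E * |z.1| + |r p.1| * |p.2.2| * E * |z.2.2|
        ≤ M * |p.2.2| ^ 2 / |2| * E * ‖z‖ + M * |p.2.2| * E * ‖z‖ := by gcongr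
      _ = (|p.2.2| ^ 2 / 2 + |p.2.2|) * (M * E * ‖z‖) := by
        rw [abs_of_pos (zero_lt_two' ℝ)]; ring
      _ ≤ (1 + |p.2.2|) ^ 2 * (M * E * ‖z‖) := by gcongr; nlinarith
      _ = M * ‖z‖ * (E * (1 + |p.2.2|) ^ 2) := by ring
      _ ≤ M * ‖z‖ * (C / (1 + |p.2.2|) ^ N) := by gcongr
      _ = M * (C / (1 + |p.2.2|) ^ N) * ‖z‖ := by ring
      _ ≤ C * (1 + 2 * M) / (1 + |p.2.2|) ^ N * ‖z‖ := by
        refine mul_le_mul_of_nonneg_right ?_ (norm_nonneg z)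
        rw [← mul_div_assoc]
        exact div_le_div_of_nonneg_right (by nlinarith [mul_nonneg hC0 hM0]) (by positivity)

lemma isProfile_block {κ : Plane → ℝ} {y : ℝ → Plane} {θ r α ρ q : ℝ → ℝ}
    (hG : InterfaceGeometry κ y θ r α ρ q) (h : 𝓢(ℝ, ℂ)) : IsProfile (profileBlock r h) := by
  obtain ⟨m, hm, hmr⟩ := hG.le_r
  obtain ⟨_, M₁, hM₁⟩ := hG.bdd_r
  obtain ⟨_, M₂, hM₂⟩ := hG.bdd_ρ
  intro N
  obtain ⟨C, hC⟩ := c1Bound_schwartz h N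
  obtain ⟨D, hD⟩ := c1Bound_gaussian (M := max M₁ M₂) hm hmr hG.hasDeriv_r
    (fun t ht => (hM₁ t ht).2.1.trans (le_max_left _ _))
    (fun t ht => (hM₂ t ht).2.1.trans (le_max_right _ _)) N
  refine ⟨2 * (|C| * |D|), (hC.mul hD).mono fun p _ => ?_⟩
  have h1 : transverseWeight p ≤ (1 + |p.2.1|) * (1 + |p.2.2|) := by
    unfold transverseWeight
    nlinarith [mul_nonneg (abs_nonneg p.2.1) (abs_nonneg p.2.2)]
  have h0 := transverseWeight_pos p
  calc 2 * (C / (1 + |p.2.1|) ^ N * (D / (1 + |p.2.2|) ^ N))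
      = 2 * (C * D) / ((1 + |p.2.1|) * (1 + |p.2.2|)) ^ N := by
        rw [mul_pow]; field_simp
    _ ≤ 2 * (|C| * |D|) / ((1 + |p.2.1|) * (1 + |p.2.2|)) ^ N := by
        gcongr ?_ / _
        rw [← abs_mul]
        exact mul_le_mul_of_nonneg_left (le_abs_self _) zero_le_two
    _ ≤ _ := by gcongr

/-! ### The profiles and their differential equations -/

/-- The leading amplitude `u₀ = r^{1/4} f(a) exp(-r b² / 2)` of the edge spinor. -/
noncomputable def leadingProfile (r : ℝ → ℝ) (f : 𝓢(ℝ, ℂ)) (p : ℝ × ℝ × ℝ) : ℂ :=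
  ((r p.1 ^ (1 / 4 : ℝ) : ℝ) : ℂ) * profileBlock r f p

/-- The amplitude `w` of the opposite spinor, of relative order `√ε`. It is the decaying solution of
`transport_equation`. -/
noncomputable def oppositeProfile (r α ρ : ℝ → ℝ) (f : 𝓢(ℝ, ℂ)) (p : ℝ × ℝ × ℝ) : ℂ :=
  ((r p.1 ^ (1 / 4 : ℝ) : ℝ) : ℂ) * Complex.I *
    ((α p.1 * p.2.1 / 2 - ρ p.1 * p.2.2 / (4 * r p.1)) * profileBlock r f p
      + α p.1 / (2 * r p.1) * profileBlock r (SchwartzMap.derivCLM ℝ ℂ f) p)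

/-- The correction `u₁` to the amplitude of the edge spinor, of relative order `√ε`. It is a solution
of `corrector_equation`, obtained by integrating in `b`. -/
noncomputable def parallelProfile (r α ρ q : ℝ → ℝ) (f : 𝓢(ℝ, ℂ)) (p : ℝ × ℝ × ℝ) : ℂ :=
  ((r p.1 ^ (1 / 4 : ℝ) : ℝ) : ℂ) *
    (-(α p.1 * p.2.2 + r p.1 * α p.1 * p.2.1 ^ 2 * p.2.2 - ρ p.1 * p.2.1 * p.2.2 ^ 2
        + q p.1 * p.2.2 ^ 3 / 3) / 2 * profileBlock r f p
      + (ρ p.1 * p.2.2 ^ 2 / (4 * r p.1) - α p.1 * p.2.1 * p.2.2)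
        * profileBlock r (SchwartzMap.derivCLM ℝ ℂ f) p
      - α p.1 * p.2.2 / r p.1
        * profileBlock r (SchwartzMap.derivCLM ℝ ℂ (SchwartzMap.derivCLM ℝ ℂ f)) p)

section blocks

variable (r : ℝ → ℝ) (h : 𝓢(ℝ, ℂ)) (t a b : ℝ)

lemma hasDerivAt_ofReal (x : ℝ) : HasDerivAt (fun s : ℝ => (s : ℂ)) 1 x := by
  simpa using (hasDerivAt_id x).ofReal_comp

lemma hasDerivAt_profileBlock_tangential :
    HasDerivAt (fun s => profileBlock r h (t, s, b))
      (profileBlock r (SchwartzMap.derivCLM ℝ ℂ h) (t, a, b)) a :=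
  (h.hasDerivAt a).mul_const ((Real.exp (-(r t / 2) * b ^ 2) : ℝ) : ℂ)

lemma hasDerivAt_profileBlock_normal :
    HasDerivAt (fun s => profileBlock r h (t, a, s))
      (-(r t * b) * profileBlock r h (t, a, b)) b := by
  have h1 : HasDerivAt (fun s : ℝ => Real.exp (-(r t / 2) * s ^ 2)) _ b :=
    (((hasDerivAt_id b).pow 2).const_mul (-(r t / 2))).exp
  refine (h1.ofReal_comp.const_mul (h a)).congr_deriv ?_
  simp [profileBlock]
  ring

lemma hasDerivWithinAt_profileBlock_time {ρ : ℝ} (hr : HasDerivWithinAt r ρ (Ici 0) t) :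
    HasDerivWithinAt (fun s => profileBlock r h (s, a, b))
      (-(ρ * b ^ 2 / 2) * profileBlock r h (t, a, b)) (Ici 0) t := by
  have h1 := (((hr.div_const 2).neg.mul_const (b ^ 2)).exp).ofReal_comp.const_mul (h a)
  refine h1.congr_deriv ?_
  simp [profileBlock]
  ring

end blocks

section directional

variable {u : ℝ × ℝ × ℝ → ℂ} {u' : ℝ × ℝ × ℝ →L[ℝ] ℂ} {t a b : ℝ} {d : ℂ}

lemma apply_time_eq (h : HasFDerivWithinAt u u' forwardTimes (t, a, b)) (ht : t ∈ Ici (0 : ℝ))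
    (hd : HasDerivWithinAt (fun s => u (s, a, b)) d (Ici 0) t) : u' (1, 0, 0) = d := by
  have h1 : HasDerivWithinAt (fun s : ℝ => (s, a, b)) (1, 0, 0) (Ici 0) t :=
    (hasDerivWithinAt_id t _).prodMk (hasDerivWithinAt_const _ _ _)
  exact (uniqueDiffOn_Ici (0 : ℝ) t ht).eq_deriv _
    (h.comp_hasDerivWithinAt t h1 (show MapsTo _ (Ici 0) forwardTimes from
      fun s hs => ⟨hs, mem_univ _⟩)) hd

lemma apply_tangential_eq (h : HasFDerivWithinAt u u' forwardTimes (t, a, b))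
    (ht : t ∈ Ici (0 : ℝ)) (hd : HasDerivAt (fun s => u (t, s, b)) d a) : u' (0, 1, 0) = d := by
  have h1 : HasDerivWithinAt (fun s : ℝ => (t, s, b)) (0, 1, 0) univ a :=
    (hasDerivWithinAt_const _ _ _).prodMk
      ((hasDerivWithinAt_id a _).prodMk (hasDerivWithinAt_const _ _ _))
  exact (hasDerivWithinAt_univ.1
    (h.comp_hasDerivWithinAt a h1 (show MapsTo _ univ forwardTimes from
      fun s _ => ⟨ht, mem_univ _⟩))).unique hd

lemma apply_normal_eq (h : HasFDerivWithinAt u u' forwardTimes (t, a, b))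
    (ht : t ∈ Ici (0 : ℝ)) (hd : HasDerivAt (fun s => u (t, a, s)) d b) : u' (0, 0, 1) = d := by
  have h1 : HasDerivWithinAt (fun s : ℝ => (t, a, s)) (0, 0, 1) univ b :=
    (hasDerivWithinAt_const _ _ _).prodMk
      ((hasDerivWithinAt_const _ _ _).prodMk (hasDerivWithinAt_id b _))
  exact (hasDerivWithinAt_univ.1
    (h.comp_hasDerivWithinAt b h1 (show MapsTo _ univ forwardTimes from
      fun s _ => ⟨ht, mem_univ _⟩))).unique hd

lemma apply_eq_combination (L : ℝ × ℝ × ℝ →L[ℝ] ℂ) (x y z : ℝ) :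
    L (x, y, z) = x * L (1, 0, 0) + y * L (0, 1, 0) + z * L (0, 0, 1) := by
  have : ((x, y, z) : ℝ × ℝ × ℝ) = x • (1, 0, 0) + y • (0, 1, 0) + z • (0, 0, 1) := by
    simp
  rw [this]
  simp only [map_add, map_smul, Complex.real_smul]

end directional

namespace InterfaceGeometry

variable {κ : Plane → ℝ} {y : ℝ → Plane} {θ r α ρ q : ℝ → ℝ}
  (hG : InterfaceGeometry κ y θ r α ρ q) (f : 𝓢(ℝ, ℂ))
include hG

lemma exists_mem_Icc : ∃ m M, 0 < m ∧ ∀ t ∈ Ici (0 : ℝ), r t ∈ Icc m M := by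
  obtain ⟨m, hm, hmr⟩ := hG.le_r
  obtain ⟨_, M, hM⟩ := hG.bdd_r
  exact ⟨m, M, hm, fun t ht => ⟨hmr t ht, (le_abs_self _).trans (hM t ht).2.1⟩⟩

lemma r_pos {t : ℝ} (ht : t ∈ Ici (0 : ℝ)) : 0 < r t := by
  obtain ⟨m, hm, hmr⟩ := hG.le_r
  exact hm.trans_le (hmr t ht)

lemma bddC1_inv : BddC1 fun t => (r t)⁻¹ := by
  obtain ⟨m, M, hm, h⟩ := hG.exists_mem_Icc
  refine hG.bdd_r.comp_of_mem_Icc h (fun x hx => hasDerivAt_inv (hm.trans_le hx.1).ne') ?_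
  refine ContinuousOn.neg (ContinuousOn.inv₀ (by fun_prop) fun x hx => ?_)
  exact pow_ne_zero 2 (hm.trans_le hx.1).ne'

lemma bddC1_rpow (s : ℝ) : BddC1 fun t => r t ^ s := by
  obtain ⟨m, M, hm, h⟩ := hG.exists_mem_Icc
  refine hG.bdd_r.comp_of_mem_Icc h
    (fun x hx => Real.hasDerivAt_rpow_const (Or.inl (hm.trans_le hx.1).ne')) ?_
  exact continuousOn_const.mul
    (continuousOn_id.rpow_const fun x hx => Or.inl (hm.trans_le hx.1).ne')

lemma isProfile_leading : IsProfile (leadingProfile r f) :=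
  IsProfile.tame_mul (IsTame.of_bddC1 (hG.bddC1_rpow _)) (isProfile_block hG f)

lemma isProfile_opposite : IsProfile (oppositeProfile r α ρ f) := by
  have tR := IsTame.of_bddC1 (hG.bddC1_rpow (1 / 4))
  have ti := IsTame.of_bddC1 hG.bddC1_inv
  have tα := IsTame.of_bddC1 hG.bdd_α
  have tρ := IsTame.of_bddC1 hG.bdd_ρ
  have ta := IsTame.tangential
  have tb := IsTame.normal
  have h0 := ((((IsTame.const (1 / 2)).mul tα).mul ta).add
    ((((IsTame.const (-1 / 4)).mul tρ).mul tb).mul ti))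
  have h1 := ((IsTame.const (1 / 2)).mul tα).mul ti
  have := IsProfile.tame_mul (tR.mul (IsTame.const Complex.I))
    ((IsProfile.tame_mul h0 (isProfile_block hG f)).add
      (IsProfile.tame_mul h1 (isProfile_block hG (SchwartzMap.derivCLM ℝ ℂ f))))
  convert this using 2 with p
  simp only [oppositeProfile, Complex.ofReal_inv]
  ring

lemma isProfile_parallel : IsProfile (parallelProfile r α ρ q f) := by
  have tR := IsTame.of_bddC1 (hG.bddC1_rpow (1 / 4))
  have tr := IsTame.of_bddC1 hG.bdd_r
  have ti := IsTame.of_bddC1 hG.bddC1_inv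
  have tα := IsTame.of_bddC1 hG.bdd_α
  have tρ := IsTame.of_bddC1 hG.bdd_ρ
  have tq := IsTame.of_bddC1 hG.bdd_q
  have ta := IsTame.tangential
  have tb := IsTame.normal
  have h0 := ((((IsTame.const (-1 / 2)).mul (tα.mul tb)).add
    ((IsTame.const (-1 / 2)).mul ((tr.mul tα).mul ((ta.mul ta).mul tb)))).add
    ((IsTame.const (1 / 2)).mul ((tρ.mul ta).mul (tb.mul tb)))).add
    ((IsTame.const (-1 / 6)).mul (tq.mul (tb.mul (tb.mul tb))))
  have h1 := ((IsTame.const (1 / 4)).mul ((tρ.mul ti).mul (tb.mul tb))).add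
    ((IsTame.const (-1)).mul ((tα.mul ta).mul tb))
  have h2 := (IsTame.const (-1)).mul ((tα.mul tb).mul ti)
  have := IsProfile.tame_mul tR
    (((IsProfile.tame_mul h0 (isProfile_block hG f)).add
      (IsProfile.tame_mul h1 (isProfile_block hG (SchwartzMap.derivCLM ℝ ℂ f)))).add
      (IsProfile.tame_mul h2 (isProfile_block hG
        (SchwartzMap.derivCLM ℝ ℂ (SchwartzMap.derivCLM ℝ ℂ f)))))
  convert this using 2 with p
  simp only [parallelProfile, Complex.ofReal_inv]
  ring

variable {f} {t a b : ℝ} (ht : t ∈ Ici (0 : ℝ)) {u' w' v' : ℝ × ℝ × ℝ →L[ℝ] ℂ}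
include ht

omit hG in
/-- The leading order: the Gaussian spans the kernel of `∂_b + r b`. -/
lemma leading_normal (hu : HasFDerivWithinAt (leadingProfile r f) u' forwardTimes (t, a, b)) :
    u' (0, 0, 1) = -(r t * b) * leadingProfile r f (t, a, b) := by
  rw [apply_normal_eq hu ht ((hasDerivAt_profileBlock_normal r f t a b).const_mul
    ((r t ^ (1 / 4 : ℝ) : ℝ) : ℂ))]
  simp only [leadingProfile]
  ring

omit hG in
lemma leading_tangential
    (hu : HasFDerivWithinAt (leadingProfile r f) u' forwardTimes (t, a, b)) :
    u' (0, 1, 0) = leadingProfile r (SchwartzMap.derivCLM ℝ ℂ f) (t, a, b) :=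
  apply_tangential_eq hu ht ((hasDerivAt_profileBlock_tangential r f t a b).const_mul
    ((r t ^ (1 / 4 : ℝ) : ℝ) : ℂ))

lemma leading_time (hu : HasFDerivWithinAt (leadingProfile r f) u' forwardTimes (t, a, b)) :
    u' (1, 0, 0) = (ρ t / (4 * r t) - ρ t * b ^ 2 / 2) * leadingProfile r f (t, a, b) := by
  have hr := hG.r_pos ht
  have h1 := ((hG.hasDeriv_r t ht).rpow_const (p := 1 / 4) (Or.inl hr.ne')).ofReal_comp
  rw [apply_time_eq hu ht (h1.mul (hasDerivWithinAt_profileBlock_time r f t a b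
    (hG.hasDeriv_r t ht)))]
  have hrc : (r t : ℂ) ≠ 0 := by exact_mod_cast hr.ne'
  rw [Real.rpow_sub_one hr.ne']
  simp only [leadingProfile]
  push_cast
  field_simp
  ring

lemma opposite_normal
    (hw : HasFDerivWithinAt (oppositeProfile r α ρ f) w' forwardTimes (t, a, b)) :
    w' (0, 0, 1) = -(r t * b) * oppositeProfile r α ρ f (t, a, b)
      - Complex.I * (ρ t / (4 * r t)) * leadingProfile r f (t, a, b) := by
  have hrc : (r t : ℂ) ≠ 0 := by exact_mod_cast (hG.r_pos ht).ne'
  have hB := hasDerivAt_profileBlock_normal r f t a b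
  have hB1 := hasDerivAt_profileBlock_normal r (SchwartzMap.derivCLM ℝ ℂ f) t a b
  have h1 := ((((((hasDerivAt_ofReal b).const_mul (ρ t : ℂ)).div_const (4 * r t : ℂ)).const_sub
    (α t * a / 2 : ℂ)).mul hB).add (hB1.const_mul (α t / (2 * r t) : ℂ))).const_mul
      (((r t ^ (1 / 4 : ℝ) : ℝ) : ℂ) * Complex.I)
  rw [apply_normal_eq hw ht h1]
  simp only [oppositeProfile, leadingProfile]
  field_simp
  ring

lemma opposite_tangential
    (hw : HasFDerivWithinAt (oppositeProfile r α ρ f) w' forwardTimes (t, a, b)) :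
    w' (0, 1, 0) = oppositeProfile r α ρ (SchwartzMap.derivCLM ℝ ℂ f) (t, a, b)
      + Complex.I * (α t / 2) * leadingProfile r f (t, a, b) := by
  have hrc : (r t : ℂ) ≠ 0 := by exact_mod_cast (hG.r_pos ht).ne'
  have hB := hasDerivAt_profileBlock_tangential r f t a b
  have hB1 := hasDerivAt_profileBlock_tangential r (SchwartzMap.derivCLM ℝ ℂ f) t a b
  have h1 := ((((((hasDerivAt_ofReal a).const_mul (α t : ℂ)).div_const (2 : ℂ)).sub_const
    (ρ t * b / (4 * r t) : ℂ)).mul hB).add (hB1.const_mul (α t / (2 * r t) : ℂ))).const_mul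
      (((r t ^ (1 / 4 : ℝ) : ℝ) : ℂ) * Complex.I)
  rw [apply_tangential_eq hw ht h1]
  simp only [oppositeProfile, leadingProfile]
  field_simp
  ring

lemma parallel_normal
    (hv : HasFDerivWithinAt (parallelProfile r α ρ q f) v' forwardTimes (t, a, b)) :
    v' (0, 0, 1) = -(r t * b) * parallelProfile r α ρ q f (t, a, b)
      + ((r t ^ (1 / 4 : ℝ) : ℝ) : ℂ) *
        (-(α t + r t * α t * a ^ 2 - 2 * ρ t * a * b + q t * b ^ 2) / 2 * profileBlock r f (t, a, b)
          + (ρ t * b / (2 * r t) - α t * a)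
            * profileBlock r (SchwartzMap.derivCLM ℝ ℂ f) (t, a, b)
          - α t / r t
            * profileBlock r (SchwartzMap.derivCLM ℝ ℂ (SchwartzMap.derivCLM ℝ ℂ f)) (t, a, b)) := by
  have hrc : (r t : ℂ) ≠ 0 := by exact_mod_cast (hG.r_pos ht).ne'
  have hb := hasDerivAt_ofReal b
  have hB := hasDerivAt_profileBlock_normal r f t a b
  have hB1 := hasDerivAt_profileBlock_normal r (SchwartzMap.derivCLM ℝ ℂ f) t a b
  have hB2 := hasDerivAt_profileBlock_normal r
    (SchwartzMap.derivCLM ℝ ℂ (SchwartzMap.derivCLM ℝ ℂ f)) t a b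
  have p0 := (((((hb.const_mul (α t : ℂ)).add (hb.const_mul (r t * α t * a ^ 2 : ℂ))).sub
    ((hb.pow 2).const_mul (ρ t * a : ℂ))).add
    (((hb.pow 3).const_mul (q t : ℂ)).div_const 3)).neg.div_const 2).mul hB
  have p1 := (((((hb.pow 2).const_mul (ρ t : ℂ)).div_const (4 * r t : ℂ)).sub
    (hb.const_mul (α t * a : ℂ)))).mul hB1
  have p2 := ((hb.const_mul (α t : ℂ)).div_const (r t : ℂ)).mul hB2
  have h1 := ((p0.add p1).sub p2).const_mul ((r t ^ (1 / 4 : ℝ) : ℝ) : ℂ)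
  rw [apply_normal_eq hv ht h1]
  simp only [parallelProfile, Pi.add_apply, Pi.sub_apply, Pi.neg_apply, Pi.pow_apply]
  field_simp
  ring

/-- The edge component of the Dirac equation at order `√ε`. As an equation
`(-∂_b + r b) w = i (∂ₜ + α (b ∂ₐ - a ∂_b)) u₀` in `b` it has a decaying solution `w` only if the
right-hand side is orthogonal to the Gaussian `exp(-r b² / 2)`; this is what forces the factor
`r^{1/4}` and the rigid transport of `f`. -/
theorem transport_equation
    (hu : HasFDerivWithinAt (leadingProfile r f) u' forwardTimes (t, a, b))
    (hw : HasFDerivWithinAt (oppositeProfile r α ρ f) w' forwardTimes (t, a, b)) :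
    -Complex.I * u' (1, α t * b, -(α t * a)) - w' (0, 0, 1)
      + r t * b * oppositeProfile r α ρ f (t, a, b) = 0 := by
  have hrc : (r t : ℂ) ≠ 0 := by exact_mod_cast (hG.r_pos ht).ne'
  rw [apply_eq_combination, hG.opposite_normal ht hw, hG.leading_time ht hu,
    leading_tangential ht hu, leading_normal ht hu]
  simp only [oppositeProfile, leadingProfile]
  push_cast
  field_simp
  ring

/-- The opposite component of the Dirac equation at order `√ε`, with the quadratic part of `κ` as a
source. The operator `∂_b + r b` is onto the rapidly decaying functions, so that this equation
imposes no condition. -/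
theorem corrector_equation
    (hw : HasFDerivWithinAt (oppositeProfile r α ρ f) w' forwardTimes (t, a, b))
    (hv : HasFDerivWithinAt (parallelProfile r α ρ q f) v' forwardTimes (t, a, b)) :
    -2 * Complex.I * w' (0, 1, 0) - α t / 2 * leadingProfile r f (t, a, b) + v' (0, 0, 1)
      + r t * b * parallelProfile r α ρ q f (t, a, b)
      + (r t * α t * a ^ 2 - 2 * ρ t * a * b + q t * b ^ 2) / 2 * leadingProfile r f (t, a, b)
        = 0 := by
  have hrc : (r t : ℂ) ≠ 0 := by exact_mod_cast (hG.r_pos ht).ne'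
  have hI := Complex.I_sq
  rw [hG.opposite_tangential ht hw, hG.parallel_normal ht hv]
  simp only [oppositeProfile, leadingProfile]
  field_simp
  ring_nf
  simp only [Complex.I_sq]
  ring

end InterfaceGeometry

/-! ### Weak formulation for smooth spinors -/

/-- The Hermitian product of `ℂ²` as a continuous `ℝ`-bilinear map. -/
noncomputable def spinorInner : Spinor →L[ℝ] Spinor →L[ℝ] ℂ :=
  LinearMap.mkContinuous₂
    (LinearMap.mk₂ ℝ (fun v w : Spinor => (inner ℂ v w : ℂ)) inner_add_left
      (fun c v w => inner_smul_left_eq_smul v w c) inner_add_right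
      (fun c v w => inner_smul_right_eq_smul v w c)) 1
    (fun v w => by simpa using norm_inner_le_norm v w)

lemma inner_pauliX (v w : Spinor) : (inner ℂ (pauliX v) w : ℂ) = inner ℂ v (pauliX w) := by
  simp [inner_spinor, pauliX_apply]; ring

lemma inner_pauliY (v w : Spinor) : (inner ℂ (pauliY v) w : ℂ) = inner ℂ v (pauliY w) := by
  simp [inner_spinor, pauliY_apply]; ring

lemma inner_pauliZ (v w : Spinor) : (inner ℂ (pauliZ v) w : ℂ) = inner ℂ v (pauliZ w) := by
  simp [inner_spinor, pauliZ_apply]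

lemma diracH_eq_pauli (κ : Plane → ℝ) (ε : ℝ) (u : Plane → Spinor) (x : Plane) :
    diracH κ ε u x = (-Complex.I * ε) •
        (pauliX (fderiv ℝ u x (EuclideanSpace.single 0 1))
          + pauliY (fderiv ℝ u x (EuclideanSpace.single 1 1)))
      + (κ x : ℂ) • pauliZ (u x) := by
  rw [pauliX_apply, pauliY_apply, pauliZ_apply]
  ext i
  fin_cases i
  · simp [diracH, Dx]; ring
  · simp [diracH, Dx]; ring_nf

lemma integrable_inner_schwartz (φ : 𝓢(Plane, Spinor)) {v : Plane → Spinor} {B : ℝ}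
    (hv : AEStronglyMeasurable v volume) (hB : ∀ x, ‖v x‖ ≤ B) :
    Integrable fun x => (inner ℂ (φ x) (v x) : ℂ) := by
  refine ((φ.integrable (μ := volume)).norm.mul_const B).mono'
    (φ.continuous.aestronglyMeasurable.inner hv) (.of_forall fun x => ?_)
  exact (norm_inner_le_norm _ _).trans (by gcongr; exact hB x)

lemma integral_inner_fderiv (φ : 𝓢(Plane, Spinor)) {u : Plane → Spinor} {B : ℝ}
    (hu : Differentiable ℝ u) (hB : ∀ x, ‖u x‖ ≤ B) (hB' : ∀ x, ‖fderiv ℝ u x‖ ≤ B)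
    (v : Plane) :
    ∫ x, (inner ℂ (φ x) (fderiv ℝ u x v) : ℂ) = -∫ x, (inner ℂ (fderiv ℝ φ x v) (u x) : ℂ) := by
  have h0 : ∀ x, fderiv ℝ φ x v = LineDeriv.lineDerivOp v φ x := fun x => by
    rw [SchwartzMap.lineDerivOp_apply_eq_fderiv]
  refine integral_bilinear_fderiv_right_eq_neg_left_of_integrable (B := spinorInner) ?_ ?_ ?_
    (fun x _ => φ.differentiable.differentiableAt) (fun x _ => hu x)
  · simp only [h0]
    exact integrable_inner_schwartz _ hu.continuous.aestronglyMeasurable hB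
  · refine integrable_inner_schwartz φ (B := B * ‖v‖)
      (measurable_fderiv_apply_const ℝ u v).aestronglyMeasurable fun x => ?_
    exact ((fderiv ℝ u x).le_opNorm v).trans (by gcongr; exact hB' x)
  · exact integrable_inner_schwartz _ hu.continuous.aestronglyMeasurable hB

lemma differentiable_clm_comp (L : Spinor →L[ℂ] Spinor) {u : Plane → Spinor}
    (hu : Differentiable ℝ u) :
    Differentiable ℝ (fun x => L (u x)) ∧
      ∀ x v, fderiv ℝ (fun x => L (u x)) x v = L (fderiv ℝ u x v) := by
  have h := fun x => ((L.restrictScalars ℝ).hasFDerivAt (x := u x)).comp x (hu x).hasFDerivAt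
  refine ⟨fun x => (h x).differentiableAt, fun x v => ?_⟩
  have := (h x).fderiv
  simp only [Function.comp_def, ContinuousLinearMap.coe_restrictScalars'] at this
  rw [this]; rfl

lemma norm_pauli_le (L : Spinor →L[ℂ] Spinor) {u : Plane → Spinor} {B : ℝ}
    (hB : ∀ x, ‖u x‖ ≤ B) (x : Plane) : ‖L (u x)‖ ≤ ‖L‖ * B :=
  (L.le_opNorm _).trans (by gcongr; exact hB x)

lemma integral_inner_pauli_fderiv {L : Spinor →L[ℂ] Spinor}
    (hL : ∀ v w : Spinor, (inner ℂ (L v) w : ℂ) = inner ℂ v (L w))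
    (φ : 𝓢(Plane, Spinor)) {u : Plane → Spinor} {B : ℝ}
    (hu : Differentiable ℝ u) (hB : ∀ x, ‖u x‖ ≤ B) (hB' : ∀ x, ‖fderiv ℝ u x‖ ≤ B)
    (v : Plane) :
    Integrable (fun x => (inner ℂ (φ x) (L (fderiv ℝ u x v)) : ℂ)) ∧
    Integrable (fun x => (inner ℂ (L (fderiv ℝ φ x v)) (u x) : ℂ)) ∧
    ∫ x, (inner ℂ (L (fderiv ℝ φ x v)) (u x) : ℂ)
      = -∫ x, (inner ℂ (φ x) (L (fderiv ℝ u x v)) : ℂ) := by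
  have h0 : ∀ x, fderiv ℝ φ x v = LineDeriv.lineDerivOp v φ x := fun x => by
    rw [SchwartzMap.lineDerivOp_apply_eq_fderiv]
  have hB0 : 0 ≤ B := (norm_nonneg _).trans (hB 0)
  obtain ⟨h1, h2⟩ := differentiable_clm_comp L hu
  have h3 : ∀ x, ‖L (fderiv ℝ u x v)‖ ≤ ‖L‖ * (B * ‖v‖) := fun x =>
    (L.le_opNorm _).trans (by gcongr; exact ((fderiv ℝ u x).le_opNorm v).trans (by gcongr; exact hB' x))
  refine ⟨integrable_inner_schwartz φ ?_ h3, ?_, ?_⟩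
  · exact L.continuous.comp_aestronglyMeasurable
      (measurable_fderiv_apply_const ℝ u v).aestronglyMeasurable
  · simp only [hL, h0]
    exact integrable_inner_schwartz _ h1.continuous.aestronglyMeasurable (norm_pauli_le L hB)
  · have := integral_inner_fderiv φ h1 (B := ‖L‖ * B) (norm_pauli_le L hB) (fun x => ?_) v
    · simp only [h2] at this
      simp only [hL, this, neg_neg]
    · refine ContinuousLinearMap.opNorm_le_bound _ (by positivity) fun w => ?_
      rw [h2, mul_assoc]
      exact (L.le_opNorm _).trans (by
        gcongr; exact ((fderiv ℝ u x).le_opNorm w).trans (by gcongr; exact hB' x))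

/-- Symmetry of the Dirac operator, between a Schwartz function and a bounded function with bounded
derivative. No decay of `u` is needed. -/
theorem integral_inner_diracH_comm {κ : Plane → ℝ} {B : ℝ} (hc : Continuous κ)
    (hκ : ∀ x, |κ x| ≤ B) (ε : ℝ) (φ : 𝓢(Plane, Spinor)) {u : Plane → Spinor}
    (hu : Differentiable ℝ u) (hB : ∀ x, ‖u x‖ ≤ B) (hB' : ∀ x, ‖fderiv ℝ u x‖ ≤ B) :
    ∫ x, (inner ℂ (diracH κ ε φ x) (u x) : ℂ) = ∫ x, (inner ℂ (φ x) (diracH κ ε u x) : ℂ) := by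
  obtain ⟨x1, x2, x3⟩ := integral_inner_pauli_fderiv inner_pauliX φ hu hB hB'
    (EuclideanSpace.single 0 1)
  obtain ⟨y1, y2, y3⟩ := integral_inner_pauli_fderiv inner_pauliY φ hu hB hB'
    (EuclideanSpace.single 1 1)
  have hB0 : 0 ≤ B := (norm_nonneg _).trans (hB 0)
  have hz : Integrable fun x => (inner ℂ (φ x) ((κ x : ℂ) • pauliZ (u x)) : ℂ) := by
    refine integrable_inner_schwartz φ (B := B * (‖pauliZ‖ * B)) ?_ fun x => ?_
    · exact ((Complex.continuous_ofReal.comp hc).smul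
        (pauliZ.continuous.comp hu.continuous)).aestronglyMeasurable
    · rw [norm_smul, Complex.norm_real]
      exact mul_le_mul (hκ x) (norm_pauli_le _ hB x) (norm_nonneg _) hB0
  have e1 : ∀ x, (inner ℂ (diracH κ ε φ x) (u x) : ℂ) = Complex.I * ε *
      (inner ℂ (pauliX (fderiv ℝ φ x (EuclideanSpace.single 0 1))) (u x)
        + inner ℂ (pauliY (fderiv ℝ φ x (EuclideanSpace.single 1 1))) (u x))
      + inner ℂ (φ x) ((κ x : ℂ) • pauliZ (u x)) := fun x => by
    rw [diracH_eq_pauli, inner_add_left, inner_smul_left, inner_smul_left, inner_add_left,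
      inner_pauliZ, inner_smul_right]
    simp
  have e2 : ∀ x, (inner ℂ (φ x) (diracH κ ε u x) : ℂ) = -Complex.I * ε *
      (inner ℂ (φ x) (pauliX (fderiv ℝ u x (EuclideanSpace.single 0 1)))
        + inner ℂ (φ x) (pauliY (fderiv ℝ u x (EuclideanSpace.single 1 1))))
      + inner ℂ (φ x) ((κ x : ℂ) • pauliZ (u x)) := fun x => by
    rw [diracH_eq_pauli, inner_add_right, inner_smul_right, inner_add_right]
  have key : ∀ (c : ℂ) {F G : Plane → ℂ}, Integrable F → Integrable G →
      ∫ x, (c * (F x + G x) + inner ℂ (φ x) ((κ x : ℂ) • pauliZ (u x)))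
        = c * ((∫ x, F x) + ∫ x, G x) + ∫ x, inner ℂ (φ x) ((κ x : ℂ) • pauliZ (u x)) := by
    intro c F G hF hG
    rw [integral_add (f := fun x => c * (F x + G x)) ((hF.add hG).const_mul _) hz,
      integral_const_mul, integral_add hF hG]
  simp only [e1, e2]
  rw [key _ x1 y1, key _ x2 y2, x3, y3]
  ring

lemma aestronglyMeasurable_diracH {κ : Plane → ℝ} (hc : Continuous κ) (ε : ℝ) {u : Plane → Spinor}
    (hu : Continuous u) : AEStronglyMeasurable (diracH κ ε u) volume := by
  have e : diracH κ ε u = fun x => _ := funext fun x => diracH_eq_pauli κ ε u x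
  rw [e]
  have h0 := pauliX.continuous.comp_aestronglyMeasurable (μ := (volume : Measure Plane))
    (measurable_fderiv_apply_const ℝ u (EuclideanSpace.single 0 1)).aestronglyMeasurable
  have h1 := pauliY.continuous.comp_aestronglyMeasurable (μ := (volume : Measure Plane))
    (measurable_fderiv_apply_const ℝ u (EuclideanSpace.single 1 1)).aestronglyMeasurable
  have h2 := ((Complex.continuous_ofReal.comp hc).smul
    (pauliZ.continuous.comp hu)).aestronglyMeasurable (μ := (volume : Measure Plane))
  exact ((h0.add h1).const_smul (-Complex.I * ε)).add h2

/-- A pointwise time derivative is measurable in space, as a limit of difference quotients. -/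
lemma aestronglyMeasurable_of_hasDerivAt {Φ : ℝ → Plane → Spinor} {d : Plane → Spinor} {t : ℝ}
    (ht : 0 < t) (hΦ : ∀ s, 0 < s → Continuous (Φ s))
    (hd : ∀ x, HasDerivAt (fun s => Φ s x) (d x) t) : AEStronglyMeasurable d volume := by
  have hn : ∀ n : ℕ, (0 : ℝ) < 1 / (n + 1) := fun n => by positivity
  refine aestronglyMeasurable_of_tendsto_ae Filter.atTop
    (f := fun (n : ℕ) x => (1 / (n + 1 : ℝ))⁻¹ • (Φ (t + 1 / (n + 1)) x - Φ t x)) (fun n => ?_)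
    (.of_forall fun x => ?_)
  · exact (((hΦ (t + 1 / (n + 1)) (add_pos ht (hn n))).sub (hΦ t ht)).const_smul
      (1 / (n + 1 : ℝ))⁻¹).aestronglyMeasurable
  · have h := (hasDerivAt_iff_tendsto_slope_zero.1 (hd x))
    refine h.comp (tendsto_nhdsWithin_iff.2 ⟨?_, .of_forall fun n => (hn n).ne'⟩)
    exact tendsto_one_div_add_atTop_nhds_zero_nat

theorem hasDerivAt_integral_inner_schwartz {Φ Φ' : ℝ → Plane → Spinor} {B : ℝ}
    (hΦ : ∀ t, 0 < t → Continuous (Φ t)) (hB : ∀ t, 0 < t → ∀ x, ‖Φ t x‖ ≤ B)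
    (hd : ∀ t, 0 < t → ∀ x, HasDerivAt (fun s => Φ s x) (Φ' t x) t)
    (hB' : ∀ t, 0 < t → ∀ x, ‖Φ' t x‖ ≤ B) (φ : 𝓢(Plane, Spinor)) {t : ℝ} (ht : 0 < t) :
    HasDerivAt (fun s => ∫ x, (inner ℂ (φ x) (Φ s x) : ℂ))
      (∫ x, (inner ℂ (φ x) (Φ' t x) : ℂ)) t := by
  have hI := Ioi_mem_nhds ht
  refine (hasDerivAt_integral_of_dominated_loc_of_deriv_le (s := Ioi 0) hI
    (bound := fun x => ‖φ x‖ * B) (F' := fun s x => inner ℂ (φ x) (Φ' s x)) ?_ ?_ ?_ ?_ ?_ ?_).2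
  · filter_upwards [hI] with s hs
    exact φ.continuous.aestronglyMeasurable.inner (hΦ s hs).aestronglyMeasurable
  · exact integrable_inner_schwartz φ (hΦ t ht).aestronglyMeasurable (hB t ht)
  · exact φ.continuous.aestronglyMeasurable.inner
      (aestronglyMeasurable_of_hasDerivAt ht hΦ (hd t ht))
  · exact .of_forall fun x s hs => (norm_inner_le_norm _ _).trans (by gcongr; exact hB' s hs x)
  · exact (φ.integrable (μ := volume)).norm.mul_const B
  · refine .of_forall fun x s hs => ?_
    exact (spinorInner (φ x)).hasFDerivAt.comp_hasDerivAt s (hd s hs x)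

/-! ### The moving frame and the residual of the ansatz -/

/-- The eigenvector `(e^{-iθ/2}, -e^{iθ/2})` of `σ · τ` with eigenvalue `-1`, which moves along `-τ`. -/
noncomputable def edgeSpinor (θ : ℝ) : Spinor :=
  !₂[Complex.exp (-Complex.I * θ / 2), -Complex.exp (Complex.I * θ / 2)]

/-- The eigenvector `(e^{-iθ/2}, e^{iθ/2})` of `σ · τ` with eigenvalue `1`. -/
noncomputable def oppositeSpinor (θ : ℝ) : Spinor :=
  !₂[Complex.exp (-Complex.I * θ / 2), Complex.exp (Complex.I * θ / 2)]

lemma norm_edgeSpinor (θ : ℝ) : ‖edgeSpinor θ‖ ≤ 2 := by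
  have h : ‖edgeSpinor θ‖ ^ 2 = 2 := by
    have h1 : -Complex.I * θ / 2 = ((-θ / 2 : ℝ) : ℂ) * Complex.I := by push_cast; ring
    have h2 : Complex.I * θ / 2 = ((θ / 2 : ℝ) : ℂ) * Complex.I := by push_cast; ring
    rw [norm_sq_spinor]
    simp only [edgeSpinor, h1, h2]
    simp [Complex.norm_exp]
    norm_num
  nlinarith [norm_nonneg (edgeSpinor θ)]

lemma norm_oppositeSpinor (θ : ℝ) : ‖oppositeSpinor θ‖ ≤ 2 := by
  have h : ‖oppositeSpinor θ‖ ^ 2 = 2 := by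
    have h1 : -Complex.I * θ / 2 = ((-θ / 2 : ℝ) : ℂ) * Complex.I := by push_cast; ring
    have h2 : Complex.I * θ / 2 = ((θ / 2 : ℝ) : ℂ) * Complex.I := by push_cast; ring
    rw [norm_sq_spinor]
    simp only [oppositeSpinor, h1, h2]
    simp [Complex.norm_exp]
    norm_num
  nlinarith [norm_nonneg (oppositeSpinor θ)]

lemma hasDerivWithinAt_spinor {u v : ℝ → ℂ} {u' v' : ℂ} {s : Set ℝ} {t : ℝ}
    (hu : HasDerivWithinAt u u' s t) (hv : HasDerivWithinAt v v' s t) :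
    HasDerivWithinAt (fun t => (!₂[u t, v t] : Spinor)) !₂[u', v'] s t := by
  have h : HasFDerivWithinAt (fun t => (!₂[u t, v t] : Spinor))
      (ContinuousLinearMap.toSpanSingleton ℝ (!₂[u', v'] : Spinor)) s t := by
    rw [hasFDerivWithinAt_piLp]
    intro i
    fin_cases i
    · refine hu.hasFDerivWithinAt.congr_fderiv ?_
      ext; simp
    · refine hv.hasFDerivWithinAt.congr_fderiv ?_
      ext; simp
  exact h

section spinors

variable {θ : ℝ → ℝ} {α : ℝ} {s : Set ℝ} {t : ℝ} (h : HasDerivWithinAt θ α s t)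
include h

lemma hasDerivWithinAt_edgeSpinor :
    HasDerivWithinAt (fun t => edgeSpinor (θ t)) ((-(Complex.I * α / 2)) • oppositeSpinor (θ t))
      s t := by
  have h1 := ((h.ofReal_comp.const_mul (-Complex.I)).div_const 2).cexp
  have h2 := (((h.ofReal_comp.const_mul Complex.I).div_const 2).cexp).neg
  refine (hasDerivWithinAt_spinor h1 h2).congr_deriv ?_
  ext i
  fin_cases i <;> simp [oppositeSpinor] <;> ring

lemma hasDerivWithinAt_oppositeSpinor :
    HasDerivWithinAt (fun t => oppositeSpinor (θ t)) ((-(Complex.I * α / 2)) • edgeSpinor (θ t))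
      s t := by
  have h1 := ((h.ofReal_comp.const_mul (-Complex.I)).div_const 2).cexp
  have h2 := ((h.ofReal_comp.const_mul Complex.I).div_const 2).cexp
  refine (hasDerivWithinAt_spinor h1 h2).congr_deriv ?_
  ext i
  fin_cases i <;> simp [edgeSpinor] <;> ring

end spinors

lemma exp_mul_exp_half (θ : ℝ) :
    (Real.cos θ + Real.sin θ * Complex.I : ℂ) * Complex.exp (-Complex.I * θ / 2)
      = Complex.exp (Complex.I * θ / 2) ∧
    (Real.cos θ - Real.sin θ * Complex.I : ℂ) * Complex.exp (Complex.I * θ / 2)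
      = Complex.exp (-Complex.I * θ / 2) := by
  have h1 : (Real.cos θ + Real.sin θ * Complex.I : ℂ) = Complex.exp (θ * Complex.I) := by
    rw [Complex.exp_mul_I]; simp
  have h2 : (Real.cos θ - Real.sin θ * Complex.I : ℂ) = Complex.exp (-θ * Complex.I) := by
    rw [Complex.exp_mul_I]; simp [sub_eq_add_neg]
  rw [h1, h2, ← Complex.exp_add, ← Complex.exp_add]
  constructor <;> congr 1 <;> ring

/-- With `s` the edge spinor and `o` the opposite one, `(σ · τ) s = -s` and `(σ · ν) s = i o`, written
for the gradient `a τ + b ν` of an amplitude. -/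
lemma pauli_edgeSpinor (θ : ℝ) (a b : ℂ) :
    pauliX ((Real.cos θ * a - Real.sin θ * b) • edgeSpinor θ)
      + pauliY ((Real.sin θ * a + Real.cos θ * b) • edgeSpinor θ)
      = (-a) • edgeSpinor θ + (Complex.I * b) • oppositeSpinor θ := by
  obtain ⟨h1, h2⟩ := exp_mul_exp_half θ
  have hI := Complex.I_sq
  rw [pauliX_apply, pauliY_apply]
  simp only [edgeSpinor, oppositeSpinor]
  generalize Complex.exp (-Complex.I * θ / 2) = P at *
  generalize Complex.exp (Complex.I * θ / 2) = Q at *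
  generalize (Real.cos θ : ℂ) = c at *
  generalize (Real.sin θ : ℂ) = s at *
  ext i
  fin_cases i
  · simp
    linear_combination (-a + Complex.I * b) * h2 + Q * b * s * hI
  · simp
    linear_combination (a + Complex.I * b) * h1 - P * b * s * hI

/-- The companion of `pauli_edgeSpinor`: `(σ · τ) o = o` and `(σ · ν) o = -i s`. -/
lemma pauli_oppositeSpinor (θ : ℝ) (a b : ℂ) :
    pauliX ((Real.cos θ * a - Real.sin θ * b) • oppositeSpinor θ)
      + pauliY ((Real.sin θ * a + Real.cos θ * b) • oppositeSpinor θ)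
      = a • oppositeSpinor θ + (-(Complex.I * b)) • edgeSpinor θ := by
  obtain ⟨h1, h2⟩ := exp_mul_exp_half θ
  have hI := Complex.I_sq
  rw [pauliX_apply, pauliY_apply]
  simp only [edgeSpinor, oppositeSpinor]
  generalize Complex.exp (-Complex.I * θ / 2) = P at *
  generalize Complex.exp (Complex.I * θ / 2) = Q at *
  generalize (Real.cos θ : ℂ) = c at *
  generalize (Real.sin θ : ℂ) = s at *
  ext i
  fin_cases i
  · simp
    linear_combination (a - Complex.I * b) * h2 - Q * b * s * hI
  · simp
    linear_combination (a + Complex.I * b) * h1 - P * b * s * hI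

lemma pauliZ_edgeSpinor (θ : ℝ) : pauliZ (edgeSpinor θ) = oppositeSpinor θ := by
  rw [pauliZ_apply]; ext i; fin_cases i <;> simp [edgeSpinor, oppositeSpinor]

lemma pauliZ_oppositeSpinor (θ : ℝ) : pauliZ (oppositeSpinor θ) = edgeSpinor θ := by
  rw [pauliZ_apply]; ext i; fin_cases i <;> simp [edgeSpinor, oppositeSpinor]

/-- The coordinates `(t, a, b)` of the point `x` at time `t`, centred at `y t`, rotated into the frame
`τ`, `ν` and scaled by `δ = √ε`. -/
noncomputable def movingCoord (δ : ℝ) (y : ℝ → Plane) (θ : ℝ → ℝ) (t : ℝ) (x : Plane) : ℝ × ℝ × ℝ :=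
  (t, rotate (θ t) (δ⁻¹ • (x - y t)) 0, rotate (θ t) (δ⁻¹ • (x - y t)) 1)

lemma movingCoord_mem {δ : ℝ} {y : ℝ → Plane} {θ : ℝ → ℝ} {t : ℝ} (ht : t ∈ Ici (0 : ℝ))
    (x : Plane) : movingCoord δ y θ t x ∈ forwardTimes := ⟨ht, mem_univ _⟩

lemma movingCoord_eq (δ : ℝ) (y : ℝ → Plane) (θ : ℝ → ℝ) (t : ℝ) (x : Plane) :
    movingCoord δ y θ t x =
      (t, δ⁻¹ * (Real.cos (θ t) * (x 0 - y t 0) + Real.sin (θ t) * (x 1 - y t 1)),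
        δ⁻¹ * (-Real.sin (θ t) * (x 0 - y t 0) + Real.cos (θ t) * (x 1 - y t 1))) := by
  simp [movingCoord, rotate]
  constructor <;> ring

lemma eq_add_movingCoord {δ : ℝ} (hδ : δ ≠ 0) (y : ℝ → Plane) (θ : ℝ → ℝ) (t : ℝ) (x : Plane) :
    x = y t + ((δ * (movingCoord δ y θ t x).2.1) • tangentVec (θ t)
      + (δ * (movingCoord δ y θ t x).2.2) • normalVec (θ t)) := by
  have h := Real.sin_sq_add_cos_sq (θ t)
  rw [movingCoord_eq]
  simp only [mul_inv_cancel_left₀ hδ]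
  ext i
  fin_cases i
  · simp [tangentVec, normalVec]
    linear_combination (-(x 0 - y t 0)) * h
  · simp [tangentVec, normalVec]
    linear_combination (-(x 1 - y t 1)) * h

lemma one_add_norm_le_transverseWeight (δ : ℝ) (y : ℝ → Plane) (θ : ℝ → ℝ) (t : ℝ) (x : Plane) :
    1 + ‖δ⁻¹ • (x - y t)‖ ≤ transverseWeight (movingCoord δ y θ t x) := by
  set z := δ⁻¹ • (x - y t) with hz
  have h := Real.sin_sq_add_cos_sq (θ t)
  have h1 : ‖z‖ ^ 2 = rotate (θ t) z 0 ^ 2 + rotate (θ t) z 1 ^ 2 := by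
    rw [EuclideanSpace.norm_sq_eq]
    simp [rotate, Fin.sum_univ_two]
    linear_combination (-(z 0 ^ 2 + z 1 ^ 2)) * h
  have h2 : ‖z‖ ≤ |rotate (θ t) z 0| + |rotate (θ t) z 1| := by
    refine abs_le_of_sq_le_sq' ?_ (by positivity) |>.2
    rw [h1, ← sq_abs, ← sq_abs (rotate (θ t) z 1)]
    nlinarith [mul_nonneg (abs_nonneg (rotate (θ t) z 0)) (abs_nonneg (rotate (θ t) z 1))]
  simp only [transverseWeight, movingCoord, ← hz]
  linarith

/-- The spinor `δ⁻¹ (U s + W o)` with amplitudes `U`, `W` in the moving coordinates; the factor `δ⁻¹`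
makes the `L²` norm independent of `δ`. -/
noncomputable def spinorAnsatz (δ : ℝ) (y : ℝ → Plane) (θ : ℝ → ℝ) (U W : ℝ × ℝ × ℝ → ℂ) (t : ℝ)
    (x : Plane) : Spinor :=
  δ⁻¹ • (U (movingCoord δ y θ t x) • edgeSpinor (θ t)
    + W (movingCoord δ y θ t x) • oppositeSpinor (θ t))

section ansatz

variable {δ : ℝ} {y : ℝ → Plane} {θ : ℝ → ℝ} {α t : ℝ} {x : Plane}

lemma hasDerivWithinAt_movingCoord
    (hy : HasDerivWithinAt y (-tangentVec (θ t)) (Ici 0) t)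
    (hθ : HasDerivWithinAt θ α (Ici 0) t) :
    HasDerivWithinAt (fun s => movingCoord δ y θ s x)
      (1, α * (movingCoord δ y θ t x).2.2 + δ⁻¹, -(α * (movingCoord δ y θ t x).2.1)) (Ici 0) t := by
  have h := Real.sin_sq_add_cos_sq (θ t)
  have hi : ∀ i, HasDerivWithinAt (fun s => y s i) (-tangentVec (θ t) i) (Ici 0) t := fun i =>
    (hasFDerivWithinAt_euclidean.1 hy.hasFDerivWithinAt i).hasDerivWithinAt.congr_deriv (by simp)
  have h0 := (hi 0).const_sub (x 0)
  have h1 := (hi 1).const_sub (x 1)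
  have hc := hθ.cos
  have hs := hθ.sin
  simp only [movingCoord_eq]
  refine (hasDerivWithinAt_id t _).prodMk (HasDerivWithinAt.prodMk ?_ ?_)
  · refine (((hc.mul h0).add (hs.mul h1)).const_mul δ⁻¹).congr_deriv ?_
    simp [tangentVec]
    linear_combination δ⁻¹ * h
  · refine (((hs.neg.mul h0).add (hc.mul h1)).const_mul δ⁻¹).congr_deriv ?_
    simp [tangentVec]
    ring

/-- The spatial derivative of `movingCoord`. -/
noncomputable def frameCLM (δ θ : ℝ) : Plane →L[ℝ] ℝ × ℝ × ℝ :=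
  ContinuousLinearMap.prod 0 (ContinuousLinearMap.prod
    (δ⁻¹ • (Real.cos θ • EuclideanSpace.proj 0 + Real.sin θ • EuclideanSpace.proj 1))
    (δ⁻¹ • (-Real.sin θ • EuclideanSpace.proj 0 + Real.cos θ • EuclideanSpace.proj 1)))

lemma hasFDerivAt_movingCoord :
    HasFDerivAt (movingCoord δ y θ t) (frameCLM δ (θ t)) x := by
  have e : movingCoord δ y θ t = fun x => frameCLM δ (θ t) (x - y t) + (t, 0, 0) := by
    funext x
    rw [movingCoord_eq]
    simp [frameCLM]
    constructor <;> ring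
  rw [e]
  exact ((frameCLM δ (θ t)).hasFDerivAt.comp x ((hasFDerivAt_id x).sub_const _)).add_const _

variable {U W : ℝ × ℝ × ℝ → ℂ} {U' W' : ℝ × ℝ × ℝ →L[ℝ] ℂ}
  (hU : HasFDerivWithinAt U U' forwardTimes (movingCoord δ y θ t x))
  (hW : HasFDerivWithinAt W W' forwardTimes (movingCoord δ y θ t x))
include hU hW

lemma hasDerivWithinAt_spinorAnsatz
    (hy : HasDerivWithinAt y (-tangentVec (θ t)) (Ici 0) t)
    (hθ : HasDerivWithinAt θ α (Ici 0) t) :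
    HasDerivWithinAt (fun s => spinorAnsatz δ y θ U W s x)
      (δ⁻¹ • ((U' (1, α * (movingCoord δ y θ t x).2.2 + δ⁻¹, -(α * (movingCoord δ y θ t x).2.1))
          - Complex.I * α / 2 * W (movingCoord δ y θ t x)) • edgeSpinor (θ t)
        + (W' (1, α * (movingCoord δ y θ t x).2.2 + δ⁻¹, -(α * (movingCoord δ y θ t x).2.1))
          - Complex.I * α / 2 * U (movingCoord δ y θ t x)) • oppositeSpinor (θ t))) (Ici 0) t := by
  have hp := hasDerivWithinAt_movingCoord (δ := δ) (x := x) hy hθ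
  have hm : MapsTo (fun s => movingCoord δ y θ s x) (Ici 0) forwardTimes :=
    fun s hs => movingCoord_mem hs x
  have h1 := (hU.comp_hasDerivWithinAt t hp hm).smul (hasDerivWithinAt_edgeSpinor hθ)
  have h2 := (hW.comp_hasDerivWithinAt t hp hm).smul (hasDerivWithinAt_oppositeSpinor hθ)
  refine ((h1.add h2).const_smul δ⁻¹).congr_deriv ?_
  congr 1
  simp only [Function.comp_apply]
  module

lemma hasFDerivAt_spinorAnsatz (ht : t ∈ Ici (0 : ℝ)) :
    ∃ L : Plane →L[ℝ] Spinor, HasFDerivAt (spinorAnsatz δ y θ U W t) L x ∧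
      ∀ v, L v = δ⁻¹ • (U' (frameCLM δ (θ t) v) • edgeSpinor (θ t)
        + W' (frameCLM δ (θ t) v) • oppositeSpinor (θ t)) := by
  have hm : MapsTo (movingCoord δ y θ t) univ forwardTimes := fun z _ => movingCoord_mem ht z
  have hp := (hasFDerivAt_movingCoord (δ := δ) (y := y) (θ := θ) (t := t) (x := x))
  have h1 := (hasFDerivWithinAt_univ.1 (hU.comp x hp.hasFDerivWithinAt hm)).smul_const
    (edgeSpinor (θ t))
  have h2 := (hasFDerivWithinAt_univ.1 (hW.comp x hp.hasFDerivWithinAt hm)).smul_const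
    (oppositeSpinor (θ t))
  exact ⟨_, (h1.add h2).const_smul δ⁻¹, fun v => rfl⟩

lemma diracH_spinorAnsatz (κ : Plane → ℝ) (hδ : δ ≠ 0) (ht : t ∈ Ici (0 : ℝ)) :
    diracH κ (δ ^ 2) (spinorAnsatz δ y θ U W t) x =
      (Complex.I * U' (0, 1, 0) - W' (0, 0, 1) + (κ x / δ : ℝ) * W (movingCoord δ y θ t x))
          • edgeSpinor (θ t)
        + (-Complex.I * W' (0, 1, 0) + U' (0, 0, 1) + (κ x / δ : ℝ) * U (movingCoord δ y θ t x))
          • oppositeSpinor (θ t) := by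
  obtain ⟨L, hL, hv⟩ := hasFDerivAt_spinorAnsatz hU hW ht
  have hδc : (δ : ℂ) ≠ 0 := by exact_mod_cast hδ
  have f0 : frameCLM δ (θ t) (EuclideanSpace.single 0 1)
      = (0, δ⁻¹ * Real.cos (θ t), -(δ⁻¹ * Real.sin (θ t))) := by
    simp [frameCLM]
  have f1 : frameCLM δ (θ t) (EuclideanSpace.single 1 1)
      = (0, δ⁻¹ * Real.sin (θ t), δ⁻¹ * Real.cos (θ t)) := by
    simp [frameCLM]
  have hsm : ∀ (V : ℝ × ℝ × ℝ →L[ℝ] ℂ) (a b : ℝ), V (0, δ⁻¹ * a, b)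
      = δ⁻¹ * a * V (0, 1, 0) + b * V (0, 0, 1) := fun V a b => by
    rw [apply_eq_combination]; push_cast; ring
  rw [diracH_eq_pauli, hL.fderiv, hv, hv, f0, f1]
  simp only [hsm]
  set s := edgeSpinor (θ t) with hs
  set o := oppositeSpinor (θ t) with ho
  have e1 := pauli_edgeSpinor (θ t) (U' (0, 1, 0)) (U' (0, 0, 1))
  have e2 := pauli_oppositeSpinor (θ t) (W' (0, 1, 0)) (W' (0, 0, 1))
  have e3 := pauliZ_edgeSpinor (θ t)
  have e4 := pauliZ_oppositeSpinor (θ t)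
  rw [← hs, ← ho] at e1 e2 e3 e4
  have hreal : ∀ (c : ℝ) (v : Spinor), c • v = (c : ℂ) • v := fun c v => by
    rw [← Complex.coe_smul]
  simp only [map_smul] at e1 e2
  simp only [spinorAnsatz, ← hs, ← ho, hreal, map_add, map_smul, e3, e4]
  set p := movingCoord δ y θ t x
  trans (-Complex.I) • ((-U' (0, 1, 0) • s + (Complex.I * U' (0, 0, 1)) • o)
      + (W' (0, 1, 0) • o + -(Complex.I * W' (0, 0, 1)) • s))
    + ((κ x / δ : ℝ) : ℂ) • (U p • o + W p • s)
  · rw [← e1, ← e2]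
    match_scalars <;> field_simp <;> ring
  · have hI := Complex.I_sq
    match_scalars
    · linear_combination W' (0, 0, 1) * hI
    · linear_combination -U' (0, 0, 1) * hI

/-- The expression `(ε D_t + H)` applied to the ansatz, with `ε = δ²`, resolved into the edge and the
opposite spinor. The translation `δ⁻¹ ∂ₐ` coming from the motion of the centre cancels the
tangential part of `H` on the edge spinor and doubles it on the opposite one. -/
lemma residual_spinorAnsatz (κ : Plane → ℝ) (hδ : δ ≠ 0) (ht : t ∈ Ici (0 : ℝ)) {a b : ℝ}
    (hp : movingCoord δ y θ t x = (t, a, b)) :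
    -(Complex.I * (δ : ℂ) ^ 2) •
        (δ⁻¹ • ((U' (1, α * b + δ⁻¹, -(α * a)) - Complex.I * α / 2 * W (t, a, b)) • edgeSpinor (θ t)
          + (W' (1, α * b + δ⁻¹, -(α * a)) - Complex.I * α / 2 * U (t, a, b))
            • oppositeSpinor (θ t)))
      + diracH κ (δ ^ 2) (spinorAnsatz δ y θ U W t) x =
    (-(Complex.I * δ) * U' (1, α * b, -(α * a)) - δ * α / 2 * W (t, a, b) - W' (0, 0, 1)
        + κ x / δ * W (t, a, b)) • edgeSpinor (θ t)
      + (-(Complex.I * δ) * W' (1, α * b, -(α * a)) - 2 * Complex.I * W' (0, 1, 0)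
        - δ * α / 2 * U (t, a, b) + U' (0, 0, 1) + κ x / δ * U (t, a, b))
          • oppositeSpinor (θ t) := by
  have hδc : (δ : ℂ) ≠ 0 := by exact_mod_cast hδ
  have hI := Complex.I_sq
  have hsm : ∀ V : ℝ × ℝ × ℝ →L[ℝ] ℂ, V (1, α * b + δ⁻¹, -(α * a))
      = V (1, α * b, -(α * a)) + (δ : ℂ)⁻¹ * V (0, 1, 0) := fun V => by
    rw [apply_eq_combination, apply_eq_combination V 1 (α * b)]; push_cast; ring
  have hreal : ∀ (c : ℝ) (v : Spinor), c • v = (c : ℂ) • v := fun c v => by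
    rw [← Complex.coe_smul]
  rw [diracH_spinorAnsatz hU hW κ hδ ht, hp, hreal, hsm, hsm]
  match_scalars
  · field_simp
    linear_combination δ ^ 2 * α * W (t, a, b) * hI
  · field_simp
    linear_combination δ ^ 2 * α * U (t, a, b) * hI

end ansatz

/-! ### Uniform bounds for the ansatz -/

lemma IsProfile.exists_nonneg_bound {u : ℝ × ℝ × ℝ → ℂ} (hu : IsProfile u) (N : ℕ) :
    ∃ K, 0 ≤ K ∧ C1Bound u fun p => K / transverseWeight p ^ N := by
  obtain ⟨C, h⟩ := hu N
  refine ⟨|C|, abs_nonneg _, h.mono fun p _ => ?_⟩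
  have := transverseWeight_pos p
  gcongr
  exact le_abs_self C

lemma norm_apply_transport_le (L : ℝ × ℝ × ℝ →L[ℝ] ℂ) {α A t a b : ℝ} (hα : |α| ≤ A) :
    ‖L (1, α * b, -(α * a))‖ ≤ (1 + A) * transverseWeight (t, a, b) * ‖L‖ := by
  have hA : 0 ≤ A := (abs_nonneg _).trans hα
  have ha := abs_nonneg a
  have hb := abs_nonneg b
  rw [mul_comm _ ‖L‖]
  refine (L.le_opNorm _).trans (mul_le_mul_of_nonneg_left ?_ (norm_nonneg _))
  have h1 : |α| * |b| ≤ A * |b| := by gcongr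
  have h2 : |α| * |a| ≤ A * |a| := by gcongr
  simp only [transverseWeight, norm_prod_le_iff, Real.norm_eq_abs, abs_mul, abs_neg, abs_one]
  refine ⟨?_, ?_, ?_⟩ <;> nlinarith [mul_nonneg hA ha, mul_nonneg hA hb]

namespace InterfaceGeometry

variable {κ : Plane → ℝ} {y : ℝ → Plane} {θ r α ρ q : ℝ → ℝ}
  (hG : InterfaceGeometry κ y θ r α ρ q) {f : 𝓢(ℝ, ℂ)}
  {t a b : ℝ} (ht : t ∈ Ici (0 : ℝ)) {u' w' v' : ℝ × ℝ × ℝ →L[ℝ] ℂ}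
  (hu : HasFDerivWithinAt (leadingProfile r f) u' forwardTimes (t, a, b))
  (hw : HasFDerivWithinAt (oppositeProfile r α ρ f) w' forwardTimes (t, a, b))
include hG ht hu hw

/-- The edge component of the residual: by `transport_equation` only terms of order `δ²` remain.
Here `k` is the value of `κ`. -/
lemma edge_coefficient {δ : ℝ} (hδ : δ ≠ 0) (k : ℝ) :
    -(Complex.I * δ) * (u' + (δ : ℂ) • v') (1, α t * b, -(α t * a))
        - δ * α t / 2 * (δ * oppositeProfile r α ρ f (t, a, b)) - ((δ : ℂ) • w') (0, 0, 1)
        + k / δ * (δ * oppositeProfile r α ρ f (t, a, b))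
      = -(Complex.I * δ ^ 2) * v' (1, α t * b, -(α t * a))
        - δ ^ 2 * α t / 2 * oppositeProfile r α ρ f (t, a, b)
        + ((k - r t * (δ * b) : ℝ) : ℂ) * oppositeProfile r α ρ f (t, a, b) := by
  have hδc : (δ : ℂ) ≠ 0 := by exact_mod_cast hδ
  have h := hG.transport_equation ht hu hw
  simp only [add_apply, smul_apply, smul_eq_mul]
  push_cast
  field_simp
  linear_combination 2 * δ * h

/-- The opposite component of the residual: by `leading_normal` and `corrector_equation` only terms
of order `δ²` and the Taylor remainders of `k`, the value of `κ`, remain. -/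
lemma opposite_coefficient
    (hv : HasFDerivWithinAt (parallelProfile r α ρ q f) v' forwardTimes (t, a, b))
    {δ : ℝ} (hδ : δ ≠ 0) (k : ℝ) :
    -(Complex.I * δ) * ((δ : ℂ) • w') (1, α t * b, -(α t * a))
        - 2 * Complex.I * ((δ : ℂ) • w') (0, 1, 0)
        - δ * α t / 2 * (leadingProfile r f (t, a, b) + δ * parallelProfile r α ρ q f (t, a, b))
        + (u' + (δ : ℂ) • v') (0, 0, 1)
        + k / δ * (leadingProfile r f (t, a, b) + δ * parallelProfile r α ρ q f (t, a, b))
      = -(Complex.I * δ ^ 2) * w' (1, α t * b, -(α t * a))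
        - δ ^ 2 * α t / 2 * parallelProfile r α ρ q f (t, a, b)
        + (((k - r t * (δ * b) - (r t * α t * (δ * a) ^ 2 - 2 * ρ t * (δ * a) * (δ * b)
            + q t * (δ * b) ^ 2) / 2) / δ : ℝ) : ℂ) * leadingProfile r f (t, a, b)
        + ((k - r t * (δ * b) : ℝ) : ℂ) * parallelProfile r α ρ q f (t, a, b) := by
  have hδc : (δ : ℂ) ≠ 0 := by exact_mod_cast hδ
  have h := hG.corrector_equation ht hw hv
  simp only [add_apply, smul_apply, smul_eq_mul]
  rw [leading_normal ht hu]
  push_cast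
  field_simp
  linear_combination 2 * δ ^ 2 * h

end InterfaceGeometry

namespace InterfaceGeometry

/-- The amplitude `u₀ + δ u₁` of the edge spinor. -/
noncomputable def edgeAmplitude (r α ρ q : ℝ → ℝ) (f : 𝓢(ℝ, ℂ)) (δ : ℝ) (p : ℝ × ℝ × ℝ) : ℂ :=
  leadingProfile r f p + δ * parallelProfile r α ρ q f p

/-- The amplitude `δ w` of the opposite spinor. -/
noncomputable def oppositeAmplitude (r α ρ : ℝ → ℝ) (f : 𝓢(ℝ, ℂ)) (δ : ℝ) (p : ℝ × ℝ × ℝ) : ℂ :=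
  δ * oppositeProfile r α ρ f p

/-- The approximate solution `δ⁻¹ ((u₀ + δ u₁) s + δ w o)`, with `δ = √ε`. -/
noncomputable def edgeAnsatz (y : ℝ → Plane) (θ r α ρ q : ℝ → ℝ) (f : 𝓢(ℝ, ℂ)) (δ : ℝ) :
    ℝ → Plane → Spinor :=
  spinorAnsatz δ y θ (edgeAmplitude r α ρ q f δ) (oppositeAmplitude r α ρ f δ)

variable {κ : Plane → ℝ} {y : ℝ → Plane} {θ r α ρ q : ℝ → ℝ}
  (hG : InterfaceGeometry κ y θ r α ρ q) (f : 𝓢(ℝ, ℂ))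

lemma wavePacket_eq (δ t : ℝ) (hδ : 0 < δ) (x : Plane) :
    wavePacket (δ ^ 2) (y t) (edgeProfile (θ t) (r t) f) x
      = δ⁻¹ • leadingProfile r f (movingCoord δ y θ t x) • edgeSpinor (θ t) := by
  simp only [wavePacket, edgeProfile, Real.sqrt_sq hδ.le, leadingProfile, profileBlock, movingCoord,
    edgeSpinor, mul_assoc]

lemma norm_edge_add_opposite_le {E : ℝ} {c d : ℂ} (hc : ‖c‖ ≤ E) (hd : ‖d‖ ≤ E) (θ : ℝ) :
    ‖c • edgeSpinor θ + d • oppositeSpinor θ‖ ≤ 4 * E := by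
  have hE := (norm_nonneg _).trans hc
  refine (norm_add_le _ _).trans ?_
  rw [norm_smul, norm_smul]
  nlinarith [mul_le_mul hc (norm_edgeSpinor θ) (norm_nonneg _) hE,
    mul_le_mul hd (norm_oppositeSpinor θ) (norm_nonneg _) hE]

set_option maxHeartbeats 800000 in
include hG in
/-- Pointwise bounds for the approximate solution, with one constant for all times and all `δ`: its
size, its distance `O(δ)` to the wave packet, its time derivative, the residual `O(δ³)` of the
Dirac equation, and its spatial derivative. The last only serves to justify an integration by
parts, so that its growth in `δ` is harmless. -/
theorem exists_ansatz_bound : ∃ C, 0 ≤ C ∧ ∀ δ ∈ Ioc (0 : ℝ) 1, ∀ t ∈ Ici (0 : ℝ), ∀ x,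
    ‖edgeAnsatz y θ r α ρ q f δ t x‖
        ≤ δ⁻¹ * (C / transverseWeight (movingCoord δ y θ t x) ^ 2) ∧
    ‖edgeAnsatz y θ r α ρ q f δ t x - wavePacket (δ ^ 2) (y t) (edgeProfile (θ t) (r t) f) x‖
        ≤ δ⁻¹ * (C * δ / transverseWeight (movingCoord δ y θ t x) ^ 2) ∧
    (∃ d, HasDerivWithinAt (fun s => edgeAnsatz y θ r α ρ q f δ s x) d (Ici 0) t ∧
      ‖d‖ ≤ δ⁻¹ * (C * δ⁻¹ / transverseWeight (movingCoord δ y θ t x) ^ 2) ∧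
      ‖-(Complex.I * (δ : ℂ) ^ 2) • d + diracH κ (δ ^ 2) (edgeAnsatz y θ r α ρ q f δ t) x‖
        ≤ δ⁻¹ * (C * δ ^ 3 / transverseWeight (movingCoord δ y θ t x) ^ 2)) ∧
    ∃ L : Plane →L[ℝ] Spinor, HasFDerivAt (edgeAnsatz y θ r α ρ q f δ t) L x ∧
      ‖L‖ ≤ C * δ⁻¹ * ‖frameCLM δ (θ t)‖ := by
  obtain ⟨K₀, hK₀, hu₀⟩ := IsProfile.exists_nonneg_bound (hG.isProfile_leading f) 5
  obtain ⟨K₁, hK₁, hu₁⟩ := IsProfile.exists_nonneg_bound (hG.isProfile_opposite f) 5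
  obtain ⟨K₂, hK₂, hu₂⟩ := IsProfile.exists_nonneg_bound (hG.isProfile_parallel f) 5
  obtain ⟨_, A, hA⟩ := hG.bdd_α
  obtain ⟨M, hM⟩ := hG.taylor_one
  obtain ⟨M', hM'⟩ := hG.taylor_two
  have hA0 : 0 ≤ A := (abs_nonneg _).trans (hA 0 self_mem_Ici).2.1
  have hM0 : 0 ≤ M := by simpa using (abs_nonneg _).trans (hM 0 self_mem_Ici 1 0)
  have hM0' : 0 ≤ M' := by simpa using (abs_nonneg _).trans (hM' 0 self_mem_Ici 1 0)
  -- the fifth power of the weight allows for the cubic growth of the Taylor remainders and still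
  -- leaves the second power, which is square integrable in the plane
  set K := K₀ + K₁ + K₂ with hK
  refine ⟨16 * (1 + A + M + M') * K, by positivity, fun δ hδ t ht x => ?_⟩
  have hδ0 := hδ.1
  have hδ1 := hδ.2
  have hδn := hδ0.ne'
  have hαt : |α t| ≤ A := (hA t ht).2.1
  obtain ⟨a, b, hp⟩ : ∃ a b, movingCoord δ y θ t x = (t, a, b) := ⟨_, _, rfl⟩
  have hmem : (t, a, b) ∈ forwardTimes := ⟨ht, mem_univ _⟩
  have hx := eq_add_movingCoord hδn y θ t x
  rw [hp] at hx
  dsimp only at hx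
  obtain ⟨n0, u', du, nu⟩ := hu₀ _ hmem
  obtain ⟨n1, w', dw, nw⟩ := hu₁ _ hmem
  obtain ⟨n2, v', dv, nv⟩ := hu₂ _ hmem
  set V := transverseWeight (t, a, b) with hV
  have hV1 : 1 ≤ V := one_le_transverseWeight _
  have hV0 : 0 < V := transverseWeight_pos _
  set e := K / V ^ 5 with he
  have he0 : 0 ≤ e := by positivity
  have le0 : K₀ / V ^ 5 ≤ e := by rw [he]; gcongr; linarith
  have le1 : K₁ / V ^ 5 ≤ e := by rw [he]; gcongr; linarith
  have le2 : K₂ / V ^ 5 ≤ e := by rw [he]; gcongr; linarith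
  replace n0 := n0.trans le0; replace nu := nu.trans le0
  replace n1 := n1.trans le1; replace nw := nw.trans le1
  replace n2 := n2.trans le2; replace nv := nv.trans le2
  have heV : e * V ^ 3 = K / V ^ 2 := by rw [he]; field_simp
  have hV3 : 1 ≤ V ^ 3 := one_le_pow₀ hV1
  have heV' : e ≤ e * V ^ 3 := le_mul_of_one_le_right he0 hV3
  have heS : e ≤ (1 + A + M + M') * (e * V ^ 3) :=
    heV'.trans (le_mul_of_one_le_left (by positivity) (by linarith))
  have hVV : V ≤ V ^ 3 := le_self_pow₀ hV1 (by norm_num)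
  have hV2 : V ^ 2 ≤ V ^ 3 := pow_le_pow_right₀ hV1 (by norm_num)
  have dU : HasFDerivWithinAt (edgeAmplitude r α ρ q f δ) (u' + (δ : ℂ) • v') forwardTimes
      (movingCoord δ y θ t x) := by
    rw [hp]; exact du.add (dv.const_mul (δ : ℂ))
  have dW : HasFDerivWithinAt (oppositeAmplitude r α ρ f δ) ((δ : ℂ) • w') forwardTimes
      (movingCoord δ y θ t x) := by
    rw [hp]; exact dw.const_mul (δ : ℂ)
  have nδ : ‖(δ : ℂ)‖ = δ := by rw [Complex.norm_real, Real.norm_of_nonneg hδ0.le]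
  have hU : ‖edgeAmplitude r α ρ q f δ (t, a, b)‖ ≤ 2 * e := by
    refine (norm_add_le _ _).trans ?_
    rw [norm_mul, nδ]
    nlinarith [norm_nonneg (parallelProfile r α ρ q f (t, a, b))]
  have hW : ‖oppositeAmplitude r α ρ f δ (t, a, b)‖ ≤ δ * e := by
    rw [oppositeAmplitude, norm_mul, nδ]; gcongr
  have hW2 : ‖oppositeAmplitude r α ρ f δ (t, a, b)‖ ≤ 2 * e := hW.trans (by nlinarith)
  have hU' : ‖u' + (δ : ℂ) • v'‖ ≤ 2 * e := by
    refine (norm_add_le _ _).trans ?_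
    rw [norm_smul, nδ]
    nlinarith [norm_nonneg v']
  have hW' : ‖(δ : ℂ) • w'‖ ≤ 2 * e := by
    rw [norm_smul, nδ]
    nlinarith [norm_nonneg w']
  have hδi : 1 ≤ δ⁻¹ := (one_le_inv₀ hδ0).2 hδ1
  have hk1 := hM t ht (δ * a) (δ * b)
  have hk2 := hM' t ht (δ * a) (δ * b)
  rw [← hx] at hk1 hk2
  have hab : |δ * a| + |δ * b| ≤ δ * V := by
    rw [abs_mul, abs_mul, abs_of_pos hδ0, hV]
    simp only [transverseWeight]
    nlinarith
  have hk1' : |κ x - r t * (δ * b)| ≤ M * (δ * V) ^ 2 := hk1.trans (by gcongr)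
  have hk2' := hk2.trans (show _ ≤ M' * (δ * V) ^ 3 by gcongr)
  rw [hp, ← hV]
  refine ⟨?_, ?_, ?_, ?_⟩
  · rw [edgeAnsatz, spinorAnsatz, norm_smul, Real.norm_of_nonneg (by positivity), hp]
    refine mul_le_mul_of_nonneg_left ?_ (by positivity)
    refine (norm_edge_add_opposite_le hU hW2 _).trans ?_
    rw [mul_div_assoc, ← heV]
    linarith
  · rw [wavePacket_eq f δ t hδ0, edgeAnsatz, spinorAnsatz, ← smul_sub, norm_smul,
      Real.norm_of_nonneg (by positivity), hp]
    refine mul_le_mul_of_nonneg_left ?_ (by positivity)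
    have e1 : edgeAmplitude r α ρ q f δ (t, a, b) • edgeSpinor (θ t)
        + oppositeAmplitude r α ρ f δ (t, a, b) • oppositeSpinor (θ t)
        - leadingProfile r f (t, a, b) • edgeSpinor (θ t)
        = (δ * parallelProfile r α ρ q f (t, a, b)) • edgeSpinor (θ t)
          + oppositeAmplitude r α ρ f δ (t, a, b) • oppositeSpinor (θ t) := by
      simp only [edgeAmplitude]; module
    rw [e1]
    refine (norm_edge_add_opposite_le (E := δ * e) ?_ hW _).trans ?_
    · rw [norm_mul, nδ]; gcongr
    · rw [mul_right_comm, mul_div_assoc, ← heV]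
      have h1 : 0 ≤ δ * e := by positivity
      have h2 : δ * e ≤ δ * ((1 + A + M + M') * (e * V ^ 3)) := by gcongr
      linarith
  · have hd := hasDerivWithinAt_spinorAnsatz dU dW (hG.hasDeriv_y t ht) (hG.hasDeriv_θ t ht)
    refine ⟨_, hd, ?_, ?_⟩
    · rw [hp, norm_smul, Real.norm_of_nonneg (by positivity)]
      dsimp only
      refine mul_le_mul_of_nonneg_left ?_ (by positivity)
      have gen : ∀ (L : ℝ × ℝ × ℝ →L[ℝ] ℂ) (z : ℂ), ‖L‖ ≤ 2 * e → ‖z‖ ≤ 2 * e →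
          ‖L (1, α t * b + δ⁻¹, -(α t * a)) - Complex.I * α t / 2 * z‖
            ≤ 4 * (1 + A) * (δ⁻¹ * (e * V ^ 3)) := by
        intro L z hL hz
        have hs : L (1, α t * b + δ⁻¹, -(α t * a))
            = L (1, α t * b, -(α t * a)) + L (0, δ⁻¹, 0) := by
          rw [← map_add]; simp
        have h1 := norm_apply_transport_le (t := t) L (a := a) (b := b) hαt
        have h2 : ‖L (0, δ⁻¹, 0)‖ ≤ ‖L‖ * δ⁻¹ := by
          refine (L.le_opNorm _).trans (mul_le_mul_of_nonneg_left ?_ (norm_nonneg _))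
          simp [abs_of_pos hδ0, hδ0.le]
        have h3 : ‖Complex.I * α t / 2 * z‖ ≤ A * e := by
          rw [norm_mul, norm_div, norm_mul, Complex.norm_I, Complex.norm_real, Real.norm_eq_abs,
            Complex.norm_ofNat]
          nlinarith [norm_nonneg z, abs_nonneg (α t), mul_le_mul hαt hz (norm_nonneg _) hA0]
        rw [hs]
        refine (norm_sub_le _ _).trans ((add_le_add ((norm_add_le _ _).trans
          (add_le_add h1 h2)) h3).trans ?_)
        rw [← hV]
        have i1 : (1 + A) * V * ‖L‖ ≤ 2 * (1 + A) * (δ⁻¹ * (e * V ^ 3)) := by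
          calc (1 + A) * V * ‖L‖ ≤ (1 + A) * V ^ 3 * (2 * e) := by gcongr
            _ = 2 * (1 + A) * (1 * (e * V ^ 3)) := by ring
            _ ≤ _ := by gcongr
        have i2 : ‖L‖ * δ⁻¹ ≤ 2 * (δ⁻¹ * (e * V ^ 3)) := by
          calc ‖L‖ * δ⁻¹ ≤ (2 * (e * V ^ 3)) * δ⁻¹ := by gcongr; linarith
            _ = _ := by ring
        have i3 : A * e ≤ A * (δ⁻¹ * (e * V ^ 3)) := by
          gcongr
          nlinarith [mul_nonneg he0 (hV0.le.trans hVV)]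
        have : 0 ≤ A * (δ⁻¹ * (e * V ^ 3)) := by positivity
        linarith
      refine (norm_edge_add_opposite_le (gen _ _ hU' hW2) (gen _ _ hW' hU) _).trans ?_
      have : 0 ≤ (M + M') * (δ⁻¹ * (e * V ^ 3)) := by positivity
      calc _ = 16 * (1 + A) * (δ⁻¹ * (e * V ^ 3)) := by ring
        _ ≤ 16 * (1 + A + M + M') * (δ⁻¹ * (e * V ^ 3)) := by linarith
        _ = _ := by rw [heV]; ring
    · have hres := residual_spinorAnsatz dU dW κ (α := α t) hδn ht hp
      rw [hp]
      dsimp only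
      have hF : edgeAnsatz y θ r α ρ q f δ t = spinorAnsatz δ y θ (edgeAmplitude r α ρ q f δ)
        (oppositeAmplitude r α ρ f δ) t := rfl
      rw [hF, hres]
      simp only [edgeAmplitude, oppositeAmplitude]
      rw [hG.edge_coefficient ht du dw hδn (κ x), hG.opposite_coefficient ht du dw dv hδn (κ x)]
      have gen : ∀ (L : ℝ × ℝ × ℝ →L[ℝ] ℂ) (z : ℂ), ‖L‖ ≤ e → ‖z‖ ≤ e →
          ‖-(Complex.I * (δ : ℂ) ^ 2) * L (1, α t * b, -(α t * a)) - (δ : ℂ) ^ 2 * α t / 2 * z‖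
            ≤ (1 + 2 * A) * (δ ^ 2 * (e * V ^ 3)) := by
        intro L z hL hz
        have h1 := norm_apply_transport_le (t := t) L (a := a) (b := b) hαt
        refine (norm_sub_le _ _).trans ?_
        rw [norm_mul, norm_mul, norm_neg, norm_mul, Complex.norm_I, norm_div, norm_mul, norm_pow,
          nδ, Complex.norm_real, Real.norm_eq_abs, Complex.norm_ofNat, one_mul]
        have i1 : δ ^ 2 * ‖L (1, α t * b, -(α t * a))‖ ≤ (1 + A) * (δ ^ 2 * (e * V ^ 3)) := by
          calc _ ≤ δ ^ 2 * ((1 + A) * V ^ 3 * e) := by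
                gcongr
                exact h1.trans (by rw [← hV]; gcongr)
            _ = _ := by ring
        have i2 : δ ^ 2 * |α t| / 2 * ‖z‖ ≤ A * (δ ^ 2 * (e * V ^ 3)) := by
          calc _ ≤ δ ^ 2 * A / 1 * (e * V ^ 3) := by
                gcongr
                · norm_num
                · exact hz.trans heV'
            _ = _ := by ring
        linarith
      have j1 : ∀ z : ℂ, ‖z‖ ≤ e → ‖((κ x - r t * (δ * b) : ℝ) : ℂ) * z‖
          ≤ M * (δ ^ 2 * (e * V ^ 3)) := by
        intro z hz
        rw [norm_mul, Complex.norm_real, Real.norm_eq_abs]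
        calc _ ≤ M * (δ * V) ^ 2 * e := by gcongr
          _ = M * (δ ^ 2 * (e * V ^ 2)) := by ring
          _ ≤ _ := by gcongr
      have j2 : ‖(((κ x - r t * (δ * b) - (r t * α t * (δ * a) ^ 2 - 2 * ρ t * (δ * a) * (δ * b)
            + q t * (δ * b) ^ 2) / 2) / δ : ℝ) : ℂ) * leadingProfile r f (t, a, b)‖
          ≤ M' * (δ ^ 2 * (e * V ^ 3)) := by
        rw [norm_mul, Complex.norm_real, Real.norm_eq_abs, abs_div, abs_of_pos hδ0]
        calc _ ≤ M' * (δ * V) ^ 3 / δ * e := by gcongr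
          _ = _ := by field_simp
      have hQ : 0 ≤ δ ^ 2 * (e * V ^ 3) := by positivity
      have b1 := (norm_add_le _ _).trans (add_le_add (gen v' _ nv n1) (j1 _ n1))
      have b2 := (norm_add_le _ _).trans (add_le_add ((norm_add_le _ _).trans
        (add_le_add (gen w' _ nw n2) j2)) (j1 _ n2))
      have hmax := mul_nonneg hM0' hQ
      have c1 := b1.trans (show _ ≤ (1 + 2 * A + M + M') * (δ ^ 2 * (e * V ^ 3)) by linarith)
      have c2 := b2.trans (show _ ≤ (1 + 2 * A + M + M') * (δ ^ 2 * (e * V ^ 3)) by linarith)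
      refine (norm_edge_add_opposite_le c1 c2 _).trans ?_
      have := mul_nonneg hA0 hQ
      have := mul_nonneg hM0 hQ
      calc _ ≤ 16 * (1 + A + M + M') * (δ ^ 2 * (e * V ^ 3)) := by linarith
        _ = _ := by rw [heV]; field_simp
  · obtain ⟨L, hL, hv⟩ := hasFDerivAt_spinorAnsatz dU dW ht
    refine ⟨L, hL, ?_⟩
    refine ContinuousLinearMap.opNorm_le_bound _ (by positivity) fun v => ?_
    rw [hv, norm_smul, Real.norm_of_nonneg (by positivity)]
    have gen : ∀ L : ℝ × ℝ × ℝ →L[ℝ] ℂ, ‖L‖ ≤ 2 * e →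
        ‖L (frameCLM δ (θ t) v)‖ ≤ 2 * K * (‖frameCLM δ (θ t)‖ * ‖v‖) := by
      intro L hL
      refine (L.le_opNorm _).trans (mul_le_mul ?_ ((frameCLM δ (θ t)).le_opNorm v)
        (norm_nonneg _) (by positivity))
      refine hL.trans ?_
      gcongr
      rw [he]
      exact div_le_self (by positivity) (one_le_pow₀ hV1)
    have h4 := norm_edge_add_opposite_le (gen _ hU') (gen _ hW') (θ t)
    have hF : 0 ≤ K * (‖frameCLM δ (θ t)‖ * ‖v‖) := by positivity
    have hAM := mul_nonneg (add_nonneg (add_nonneg hA0 hM0) hM0') hF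
    refine (mul_le_mul_of_nonneg_left (h4.trans (show _ ≤ 16 * (1 + A + M + M')
      * (K * (‖frameCLM δ (θ t)‖ * ‖v‖)) by linarith)) (by positivity)).trans_eq ?_
    ring

end InterfaceGeometry

/-! ### The approximate solution in the space of square integrable spinors -/

/-- A function dominated by `δ⁻¹` times the inverse square of the weight in the moving coordinates
has an `L²` norm bounded independently of the scale `δ` and of the position of the frame. -/
lemma exists_memLp_of_movingCoord_bound : ∃ K : ℝ, 0 ≤ K ∧ ∀ (δ : ℝ) (y : ℝ → Plane) (θ : ℝ → ℝ)
    (t C : ℝ) (F : Plane → Spinor), 0 < δ → 0 ≤ C → AEStronglyMeasurable F volume →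
    (∀ x, ‖F x‖ ≤ δ⁻¹ * (C / transverseWeight (movingCoord δ y θ t x) ^ 2)) →
    MemLp F 2 volume ∧ eLpNorm F 2 volume ≤ ENNReal.ofReal (C * K) := by
  have hI : Integrable (fun x : Plane => (1 + ‖x‖) ^ (-4 : ℝ)) volume :=
    integrable_one_add_norm (by simp; norm_num)
  set I := ∫ x : Plane, (1 + ‖x‖) ^ (-4 : ℝ) with hIdef
  have hI0 : 0 ≤ I := integral_nonneg fun x => by positivity
  refine ⟨√I, Real.sqrt_nonneg _, fun δ y θ t C F hδ hC hF hb => ?_⟩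
  set H : Plane → ℝ := fun x => (δ⁻¹ * C) ^ 2 * (1 + ‖δ⁻¹ • (x - y t)‖) ^ (-4 : ℝ) with hH
  have hHi : Integrable H volume :=
    ((hI.comp_smul (inv_ne_zero hδ.ne')).comp_sub_right (y t)).const_mul _
  have hHI : ∫ x, H x = C ^ 2 * I := by
    rw [hH, integral_const_mul,
      integral_sub_right_eq_self (fun x : Plane => (1 + ‖δ⁻¹ • x‖) ^ (-4 : ℝ)) (y t),
      Measure.integral_comp_inv_smul_of_nonneg volume
        (fun x : Plane => (1 + ‖x‖) ^ (-4 : ℝ)) hδ.le]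
    simp only [finrank_euclideanSpace, Fintype.card_fin, smul_eq_mul]
    field_simp
    rw [hIdef]
  have hle : ∀ x, ‖F x‖ ^ 2 ≤ H x := by
    intro x
    have hz : 0 < 1 + ‖δ⁻¹ • (x - y t)‖ := by positivity
    have hw := one_add_norm_le_transverseWeight δ y θ t x
    have h1 : ‖F x‖ ≤ δ⁻¹ * (C / (1 + ‖δ⁻¹ • (x - y t)‖) ^ 2) := (hb x).trans (by gcongr)
    calc ‖F x‖ ^ 2 ≤ (δ⁻¹ * (C / (1 + ‖δ⁻¹ • (x - y t)‖) ^ 2)) ^ 2 := by gcongr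
      _ = H x := by
        simp only [hH]
        rw [Real.rpow_neg hz.le, show (4 : ℝ) = ((4 : ℕ) : ℝ) by norm_num, Real.rpow_natCast]
        field_simp
  have hFi : Integrable (fun x => ‖F x‖ ^ 2) volume :=
    hHi.mono' (hF.norm.pow 2) (.of_forall fun x => by
      rw [Real.norm_of_nonneg (by positivity)]; exact hle x)
  have hFm : MemLp F 2 volume := (memLp_two_iff_integrable_sq_norm hF).2 hFi
  refine ⟨hFm, ?_⟩
  rw [hFm.eLpNorm_eq_integral_rpow_norm (by norm_num) (by norm_num)]
  refine ENNReal.ofReal_le_ofReal ?_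
  simp only [ENNReal.toReal_ofNat, Real.rpow_ofNat]
  rw [← one_div, ← Real.sqrt_eq_rpow]
  calc √(∫ x, ‖F x‖ ^ 2) ≤ √(C ^ 2 * I) := by
        rw [← hHI]
        exact Real.sqrt_le_sqrt (integral_mono hFi hHi hle)
    _ = C * √I := by rw [Real.sqrt_mul (sq_nonneg C), Real.sqrt_sq hC]

open Classical in
/-- The class of `F` in `L²`, with value `0` if `F` is not square integrable. -/
noncomputable def toL2 (F : Plane → Spinor) : SpinorL2 :=
  if h : MemLp F 2 volume then h.toLp F else 0

lemma coeFn_toL2 {F : Plane → Spinor} (h : MemLp F 2 volume) : toL2 F =ᵐ[volume] F := by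
  rw [toL2, dif_pos h]; exact h.coeFn_toLp

lemma norm_toL2_le {F : Plane → Spinor} {B : ℝ} (h : MemLp F 2 volume) (hB : 0 ≤ B)
    (hF : eLpNorm F 2 volume ≤ ENNReal.ofReal B) : ‖toL2 F‖ ≤ B := by
  rw [toL2, dif_pos h, Lp.norm_toLp]
  exact ENNReal.toReal_le_of_le_ofReal hB hF

lemma integral_inner_toL2 {F : Plane → Spinor} (h : MemLp F 2 volume) (G : Plane → Spinor) :
    ∫ x, (inner ℂ (G x) (toL2 F x) : ℂ) = ∫ x, (inner ℂ (G x) (F x) : ℂ) := by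
  refine integral_congr_ae ?_
  filter_upwards [coeFn_toL2 h] with x hx
  rw [hx]

lemma integral_inner_diracH_eq {κ : Plane → ℝ} {B : ℝ} (hc : Continuous κ) (hB : ∀ x, |κ x| ≤ B)
    (ε : ℝ) (φ : 𝓢(Plane, Spinor)) (u : SpinorL2) :
    ∫ x, (inner ℂ (diracH κ ε φ x) (u x) : ℂ) = inner ℂ (toL2 (diracH κ ε φ)) u := by
  have h : MemLp (diracH κ ε φ) 2 volume := by
    have e : diracH κ ε φ = fun x => _ := funext fun x => diracH_eq κ ε φ x
    rw [e]
    exact (((freeDirac φ).memLp 2).const_smul (ε : ℂ)).add (memLp_smul_pauliZ hc hB (φ.memLp 2))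
  rw [L2.inner_def]
  refine integral_congr_ae ?_
  filter_upwards [coeFn_toL2 h] with x hx
  rw [hx]

/-- A pointwise differentiable curve of functions is Lipschitz in `L²` if its derivative is bounded
in `L²`. The pointwise bound `B` only serves to differentiate under the integral sign. -/
lemma continuousOn_toL2 {Φ Φ' : ℝ → Plane → Spinor} {B L : ℝ}
    (hΦ : ∀ t ∈ Ici (0 : ℝ), Continuous (Φ t)) (hB : ∀ t ∈ Ici (0 : ℝ), ∀ x, ‖Φ t x‖ ≤ B)
    (hB' : ∀ t ∈ Ici (0 : ℝ), ∀ x, ‖Φ' t x‖ ≤ B)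
    (hd : ∀ t ∈ Ici (0 : ℝ), ∀ x, HasDerivWithinAt (fun s => Φ s x) (Φ' t x) (Ici 0) t)
    (hm : ∀ t ∈ Ici (0 : ℝ), MemLp (Φ t) 2 volume)
    (hm' : ∀ t, 0 < t → MemLp (Φ' t) 2 volume) (hL : ∀ t, 0 < t → ‖toL2 (Φ' t)‖ ≤ L) :
    ContinuousOn (fun t => toL2 (Φ t)) (Ici 0) := by
  have hlip : ∀ s ∈ Ici (0 : ℝ), ∀ t, s ≤ t → ‖toL2 (Φ t) - toL2 (Φ s)‖ ≤ L * (t - s) := by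
    intro s hs t hst
    have ht : (0 : ℝ) ≤ t := le_trans hs hst
    have hι : DenseRange diracGenerator.ι := diracGenerator.dense
    refine norm_sub_le_of_weak_hasDerivAt hι (T := t) (w := fun t => toL2 (Φ t))
      (G := fun t => toL2 (Φ' t)) (fun u hu => hL u hu.1) (fun φ => ?_) (fun φ u hu => ?_)
      ⟨hs, hst⟩ ⟨ht, le_rfl⟩ hst
    · simp only [← integral_inner_schwartz]
      have hc : ContinuousOn (fun u => ∫ x, (inner ℂ (φ x) (Φ u x) : ℂ)) (Ici 0) := by
        refine continuousOn_of_dominated (bound := fun x => ‖φ x‖ * B) (fun u hu => ?_)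
          (fun u hu => .of_forall fun x => ?_) ((φ.integrable (μ := volume)).norm.mul_const B)
          (.of_forall fun x u hu => ?_)
        · exact φ.continuous.aestronglyMeasurable.inner (hΦ u hu).aestronglyMeasurable
        · exact (norm_inner_le_norm _ _).trans (by gcongr; exact hB u hu x)
        · exact continuousWithinAt_const.inner (hd u hu x).continuousWithinAt
      exact (hc.congr fun u hu => integral_inner_toL2 (hm u hu) φ).mono fun u hu => hu.1
    · simp only [← integral_inner_schwartz]
      rw [integral_inner_toL2 (hm' u hu.1) φ]
      have := hasDerivAt_integral_inner_schwartz (fun t ht => hΦ t ht.le) (fun t ht => hB t ht.le)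
        (fun t ht x => (hd t ht.le x).hasDerivAt (Ici_mem_nhds ht)) (fun t ht => hB' t ht.le) φ hu.1
      refine this.congr_of_eventuallyEq ?_
      filter_upwards [Ioi_mem_nhds hu.1] with s hs
      exact integral_inner_toL2 (hm s (mem_Ioi.1 hs).le) φ
  have hLip : LipschitzOnWith L.toNNReal (fun t => toL2 (Φ t)) (Ici 0) := by
    refine LipschitzOnWith.of_dist_le_mul fun s hs t ht => ?_
    rw [dist_eq_norm, dist_eq_norm, Real.norm_eq_abs]
    rcases le_total s t with h | h
    · rw [norm_sub_rev, abs_sub_comm, abs_of_nonneg (sub_nonneg.2 h)]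
      exact (hlip s hs t h).trans (mul_le_mul_of_nonneg_right (Real.le_coe_toNNReal L)
        (sub_nonneg.2 h))
    · rw [abs_of_nonneg (sub_nonneg.2 h)]
      exact (hlip t ht s h).trans (mul_le_mul_of_nonneg_right (Real.le_coe_toNNReal L)
        (sub_nonneg.2 h))
  exact hLip.continuousOn

lemma continuous_wavePacket (ε θ r : ℝ) (y : Plane) (f : 𝓢(ℝ, ℂ)) :
    Continuous (wavePacket ε y (edgeProfile θ r f)) := by
  have h : Continuous (edgeProfile θ r f) := by
    have h0 : Continuous fun x => rotate θ x 0 := by simp only [rotate]; simp; fun_prop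
    have h1 : Continuous fun x => rotate θ x 1 := by simp only [rotate]; simp; fun_prop
    have hf := f.continuous.comp h0
    simp only [Function.comp_def] at hf
    unfold edgeProfile
    fun_prop
  unfold wavePacket
  fun_prop

namespace InterfaceGeometry

variable {κ : Plane → ℝ} {y : ℝ → Plane} {θ r α ρ q : ℝ → ℝ}

/-- A curve `w` in `L²` within `O(δ)` of the wave packet that solves the Dirac equation with
`ε = δ²` weakly, up to a residual `g` of size `O(δ)`. Here `g` is the residual `O(δ³)` of
`εD_t + H` divided by `ε`. -/
theorem exists_approximate_solution (hG : InterfaceGeometry κ y θ r α ρ q) {B : ℝ}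
    (hc : Continuous κ) (hκ : ∀ x, |κ x| ≤ B) (f : 𝓢(ℝ, ℂ)) :
    ∃ C : ℝ, 0 ≤ C ∧ ∀ δ ∈ Ioc (0 : ℝ) 1, ∃ w g : ℝ → SpinorL2,
      ContinuousOn w (Ici 0) ∧
      (∀ t ∈ Ici (0 : ℝ), MemLp (wavePacket (δ ^ 2) (y t) (edgeProfile (θ t) (r t) f)) 2 volume ∧
        eLpNorm (fun x => w t x - wavePacket (δ ^ 2) (y t) (edgeProfile (θ t) (r t) f) x) 2 volume
          ≤ ENNReal.ofReal (C * δ)) ∧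
      (∀ t, 0 < t → ‖g t‖ ≤ C * δ) ∧
      ∀ φ : 𝓢(Plane, Spinor), ∀ t, 0 < t →
        HasDerivAt (fun s => ∫ x, (inner ℂ (φ x) (w s x) : ℂ))
          (-(Complex.I / ((δ ^ 2 : ℝ) : ℂ)) * (∫ x, (inner ℂ (diracH κ (δ ^ 2) φ x) (w t x) : ℂ))
            + ∫ x, (inner ℂ (φ x) (g t x) : ℂ)) t := by
  obtain ⟨C, hC, hb⟩ := hG.exists_ansatz_bound f
  obtain ⟨K, hK, hL2⟩ := exists_memLp_of_movingCoord_bound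
  refine ⟨C * K, by positivity, fun δ hδ => ?_⟩
  have hδ0 := hδ.1
  have hδc : (δ : ℂ) ≠ 0 := by exact_mod_cast hδ0.ne'
  set Φ := edgeAnsatz y θ r α ρ q f δ with hΦdef
  set P := fun t => wavePacket (δ ^ 2) (y t) (edgeProfile (θ t) (r t) f) with hP
  replace hb := hb δ hδ
  choose! hb0 hb1 hb2 hb3 using hb
  choose! d hd hdb hres using hb2
  have hPc : ∀ t ∈ Ici (0 : ℝ), Continuous (P t) := fun t _ => continuous_wavePacket _ _ _ _ _
  have hdiff : ∀ t ∈ Ici (0 : ℝ), Differentiable ℝ (Φ t) := fun t ht x => by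
    obtain ⟨L, hL, _⟩ := hb3 t ht x
    exact hL.differentiableAt
  have hcont : ∀ t ∈ Ici (0 : ℝ), Continuous (Φ t) := fun t ht => (hdiff t ht).continuous
  have hw1 : ∀ c, 0 ≤ c → ∀ p, δ⁻¹ * (c / transverseWeight p ^ 2) ≤ δ⁻¹ * c := fun c hc p => by
    gcongr
    exact div_le_self hc (one_le_pow₀ (one_le_transverseWeight p))
  have hδi : 1 ≤ δ⁻¹ := (one_le_inv₀ hδ0).2 hδ.2
  have hB0 : ∀ t ∈ Ici (0 : ℝ), ∀ x, ‖Φ t x‖ ≤ δ⁻¹ * (C * δ⁻¹) := fun t ht x =>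
    (hb0 t ht x).trans ((hw1 C hC _).trans (by gcongr; exact le_mul_of_one_le_right hC hδi))
  have hB1 : ∀ t ∈ Ici (0 : ℝ), ∀ x, ‖d t x‖ ≤ δ⁻¹ * (C * δ⁻¹) := fun t ht x =>
    (hdb t ht x).trans (hw1 _ (by positivity) _)
  have hd' : ∀ t, 0 < t → ∀ x, HasDerivAt (fun s => Φ s x) (d t x) t := fun t ht x =>
    (hd t ht.le x).hasDerivAt (Ici_mem_nhds ht)
  have hdm : ∀ t, 0 < t → AEStronglyMeasurable (d t) volume := fun t ht =>
    aestronglyMeasurable_of_hasDerivAt ht (fun s hs => hcont s hs.le) (hd' t ht)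
  have hm := fun t ht => hL2 δ y θ t C (Φ t) hδ0 hC (hcont t ht).aestronglyMeasurable (hb0 t ht)
  have hmd := fun t (ht : 0 < t) => hL2 δ y θ t (C * δ⁻¹) (d t) hδ0 (by positivity) (hdm t ht)
    (hdb t ht.le)
  set g : ℝ → Plane → Spinor := fun t x =>
    d t x + (Complex.I / ((δ ^ 2 : ℝ) : ℂ)) • diracH κ (δ ^ 2) (Φ t) x with hg
  have hHm : ∀ t ∈ Ici (0 : ℝ), AEStronglyMeasurable (diracH κ (δ ^ 2) (Φ t)) volume :=
    fun t ht => aestronglyMeasurable_diracH hc _ (hcont t ht)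
  have hgb : ∀ t, 0 < t → ∀ x,
      ‖g t x‖ ≤ δ⁻¹ * (C * δ / transverseWeight (movingCoord δ y θ t x) ^ 2) := by
    intro t ht x
    have e1 : g t x = (Complex.I / ((δ ^ 2 : ℝ) : ℂ)) •
        (-(Complex.I * (δ : ℂ) ^ 2) • d t x + diracH κ (δ ^ 2) (Φ t) x) := by
      have hI := Complex.I_sq
      simp only [hg]
      match_scalars
      · field_simp
        linear_combination hI
      · simp
    rw [e1, norm_smul, norm_div, Complex.norm_I, Complex.norm_real,
      Real.norm_of_nonneg (by positivity)]
    refine (mul_le_mul_of_nonneg_left (hres t ht.le x) (by positivity)).trans_eq ?_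
    field_simp
  have hmg := fun t (ht : 0 < t) => hL2 δ y θ t (C * δ) (g t) hδ0 (by positivity)
    ((hdm t ht).add ((hHm t ht.le).const_smul (Complex.I / ((δ ^ 2 : ℝ) : ℂ)))) (hgb t ht)
  refine ⟨fun t => toL2 (Φ t), fun t => toL2 (g t), ?_, fun t ht => ?_, fun t ht => ?_,
    fun φ t ht => ?_⟩
  · exact continuousOn_toL2 hcont hB0 hB1 hd (fun t ht => (hm t ht).1) (fun t ht => (hmd t ht).1)
      (fun t ht => norm_toL2_le (hmd t ht).1 (by positivity) (hmd t ht).2)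
  · have h1 := hL2 δ y θ t (C * δ) (fun x => Φ t x - P t x) hδ0 (by positivity)
      ((hcont t ht).sub (hPc t ht)).aestronglyMeasurable (hb1 t ht)
    refine ⟨?_, ?_⟩
    · have e : P t = Φ t - fun x => Φ t x - P t x := by funext x; simp
      change MemLp (P t) 2 volume
      rw [e]
      exact (hm t ht).1.sub h1.1
    · rw [mul_right_comm]
      refine (eLpNorm_congr_ae ?_).trans_le h1.2
      filter_upwards [coeFn_toL2 (hm t ht).1] with x hx
      rw [hx]
  · rw [mul_right_comm]
    exact norm_toL2_le (hmg t ht).1 (by positivity) (hmg t ht).2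
  · have h1 := hasDerivAt_integral_inner_schwartz (fun t ht => hcont t ht.le)
      (fun t ht => hB0 t ht.le) hd' (fun t ht => hB1 t ht.le) φ ht
    have hfd : ∀ x, ‖fderiv ℝ (Φ t) x‖ ≤ C * δ⁻¹ * ‖frameCLM δ (θ t)‖ := fun x => by
      obtain ⟨L, hL, hLn⟩ := hb3 t ht.le x
      rw [hL.fderiv]; exact hLn
    have h2 := integral_inner_diracH_comm hc
      (B := max B (max (δ⁻¹ * (C * δ⁻¹)) (C * δ⁻¹ * ‖frameCLM δ (θ t)‖)))
      (fun x => (hκ x).trans (le_max_left _ _)) (δ ^ 2) φ (hdiff t ht.le)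
      (fun x => (hB0 t ht.le x).trans ((le_max_left _ _).trans (le_max_right _ _)))
      (fun x => (hfd x).trans ((le_max_right _ _).trans (le_max_right _ _)))
    have h3 : ∫ x, (inner ℂ (φ x) (d t x) : ℂ)
        = -(Complex.I / ((δ ^ 2 : ℝ) : ℂ)) * (∫ x, (inner ℂ (diracH κ (δ ^ 2) φ x) (Φ t x) : ℂ))
            + ∫ x, (inner ℂ (φ x) (g t x) : ℂ) := by
      have i1 := integrable_inner_schwartz φ (hdm t ht) (hB1 t ht.le)
      have i2 : Integrable (fun x => (inner ℂ (φ x) (g t x) : ℂ)) :=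
        integrable_inner_schwartz φ (hmg t ht).1.1 fun x =>
          (hgb t ht x).trans (hw1 _ (by positivity) _)
      have e1 : ∀ x, (inner ℂ (φ x) (diracH κ (δ ^ 2) (Φ t) x) : ℂ)
          = -(Complex.I * ((δ ^ 2 : ℝ) : ℂ)) * (inner ℂ (φ x) (g t x) - inner ℂ (φ x) (d t x)) := by
        intro x
        simp only [hg]
        rw [inner_add_right, inner_smul_right]
        have hI := Complex.I_sq
        push_cast
        field_simp
        linear_combination (inner ℂ (φ x) (diracH κ (δ ^ 2) (Φ t) x) : ℂ) * hI
      rw [h2]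
      simp only [e1]
      rw [integral_const_mul, integral_sub i2 i1]
      have hI := Complex.I_sq
      push_cast
      field_simp
      linear_combination ((∫ x, (inner ℂ (φ x) (d t x) : ℂ)) - ∫ x, (inner ℂ (φ x) (g t x) : ℂ)) * hI
    have hm0 := (hm t ht.le).1
    rw [integral_inner_toL2 hm0 (fun x => diracH κ (δ ^ 2) φ x),
      integral_inner_toL2 (hmg t ht).1 φ, ← h3]
    refine h1.congr_of_eventuallyEq ?_
    filter_upwards [Ioi_mem_nhds ht] with s hs
    exact integral_inner_toL2 (hm s (mem_Ioi.1 hs).le).1 φ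

end InterfaceGeometry

/-! ### Conclusion -/

theorem theorem2 (κ : Plane → ℝ) (hκ : SmoothBounded κ) (htrans : Transversal κ)
    (y : ℝ → Plane) (θ r : ℝ → ℝ) (hflow : IsInterfaceFlow κ y θ r) (f : 𝓢(ℝ, ℂ)) :
    (∀ ε ∈ Ioc (0 : ℝ) 1, ∃ ψ : ℝ → SpinorL2,
      IsDiracSolution κ ε (wavePacket ε (y 0) (edgeProfile (θ 0) (r 0) f)) ψ ∧
      ∀ ψ' : ℝ → SpinorL2,
        IsDiracSolution κ ε (wavePacket ε (y 0) (edgeProfile (θ 0) (r 0) f)) ψ' →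
        EqOn ψ' ψ (Ici 0)) ∧
    ∃ C : ℝ, 0 < C ∧ ∀ ε ∈ Ioc (0 : ℝ) 1, ∀ ψ : ℝ → SpinorL2,
      IsDiracSolution κ ε (wavePacket ε (y 0) (edgeProfile (θ 0) (r 0) f)) ψ →
      ∀ t : ℝ, 0 < t →
        eLpNorm (fun x : Plane => ψ t x - wavePacket ε (y t) (edgeProfile (θ t) (r t) f) x) 2 volume
          ≤ ENNReal.ofReal (C * √ε * √(1 + t ^ 2)) := by
  obtain ⟨B, hB⟩ := hκ.exists_bound
  have hc : Continuous κ := hκ.differentiable.continuous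
  obtain ⟨α, ρ, q, hG⟩ := hflow.interfaceGeometry hκ htrans
  obtain ⟨C, hC, happrox⟩ := hG.exists_approximate_solution hc hB f
  -- the approximate solution is built at the scale `δ = √ε`
  have hsqrt : ∀ ε ∈ Ioc (0 : ℝ) 1, √ε ∈ Ioc (0 : ℝ) 1 ∧ √ε ^ 2 = ε := fun ε hε =>
    ⟨⟨Real.sqrt_pos.2 hε.1, Real.sqrt_le_one.2 hε.2⟩, Real.sq_sqrt hε.1.le⟩
  -- initial error, accumulated residual and final error add up to `C √ε (2 + t)`, and both `1`
  -- and `t` are at most `√(1 + t²)`; the summand `1` in the constant makes it positive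
  refine ⟨fun ε hε => ?_, 3 * (C + 1), by positivity, fun ε hε ψ hψ t ht => ?_⟩
  · obtain ⟨hδ, hδε⟩ := hsqrt ε hε
    obtain ⟨w, g, -, hP, -⟩ := happrox (√ε) hδ
    rw [hδε] at hP
    obtain ⟨ψ, hψ⟩ := exists_isDiracSolution hc hB hε.1 (hP 0 self_mem_Ici).1
    exact ⟨ψ, hψ, fun ψ' hψ' => hψ.eqOn hc hB hε.1 hψ'⟩
  · obtain ⟨hδ, hδε⟩ := hsqrt ε hε
    obtain ⟨w, g, hwc, hP, hg, hw⟩ := happrox (√ε) hδ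
    rw [hδε] at hP hw
    have hCδ : 0 ≤ C * √ε := mul_nonneg hC hδ.1.le
    have hinner : ∀ (φ : 𝓢(Plane, Spinor)) (u v : SpinorL2),
        ∫ x, (inner ℂ (φ x) ((u - v : SpinorL2) x) : ℂ)
          = (∫ x, (inner ℂ (φ x) (u x) : ℂ)) - ∫ x, (inner ℂ (φ x) (v x) : ℂ) := fun φ u v => by
      simp only [integral_inner_schwartz, inner_sub_right]
    have h0 : ‖ψ 0 - w 0‖ ≤ C * √ε := by
      rw [Lp.norm_def]
      refine ENNReal.toReal_le_of_le_ofReal hCδ (le_trans (le_of_eq ?_) (hP 0 self_mem_Ici).2)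
      rw [← eLpNorm_neg]
      refine eLpNorm_congr_ae ?_
      filter_upwards [Lp.coeFn_sub (ψ 0) (w 0), hψ.initial] with x h1 h2
      rw [Pi.neg_apply, h1, Pi.sub_apply, h2, neg_sub]
    have hen := norm_le_of_dirac_residual hc hB hε.1 (w := fun s => ψ s - w s) (g := fun s => -g s)
      (M := C * √ε) (hψ.continuous.sub hwc) (fun s hs => by rw [norm_neg]; exact hg s hs)
      (fun φ s hs => ?_) ht.le
    · have h1 : eLpNorm (fun x => (ψ t - w t : SpinorL2) x) 2 volume
          ≤ ENNReal.ofReal (C * √ε + C * √ε * t) := by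
        have : eLpNorm (fun x => (ψ t - w t : SpinorL2) x) 2 volume
            = ENNReal.ofReal ‖ψ t - w t‖ := by
          rw [Lp.norm_def, ENNReal.ofReal_toReal (Lp.eLpNorm_ne_top _)]
        rw [this]
        exact ENNReal.ofReal_le_ofReal (hen.trans (by gcongr))
      have h2 := (hP t ht.le).2
      have h3 : 1 ≤ √(1 + t ^ 2) := Real.one_le_sqrt.2 (by nlinarith)
      have h4 : t ≤ √(1 + t ^ 2) := Real.le_sqrt_of_sq_le (by linarith)
      have hm1 : AEStronglyMeasurable (fun x => (ψ t - w t : SpinorL2) x) volume :=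
        Lp.aestronglyMeasurable _
      have hm2 : AEStronglyMeasurable (fun x => w t x
          - wavePacket ε (y t) (edgeProfile (θ t) (r t) f) x) volume :=
        (Lp.aestronglyMeasurable _).sub (hP t ht.le).1.1
      calc eLpNorm (fun x : Plane => ψ t x
            - wavePacket ε (y t) (edgeProfile (θ t) (r t) f) x) 2 volume
          = eLpNorm ((fun x => (ψ t - w t : SpinorL2) x) + fun x => w t x
            - wavePacket ε (y t) (edgeProfile (θ t) (r t) f) x) 2 volume := by
            refine eLpNorm_congr_ae ?_
            filter_upwards [Lp.coeFn_sub (ψ t) (w t)] with x hx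
            rw [Pi.add_apply, hx, Pi.sub_apply]
            abel
        _ ≤ ENNReal.ofReal (C * √ε + C * √ε * t) + ENNReal.ofReal (C * √ε) :=
            (eLpNorm_add_le hm1 hm2 (by norm_num)).trans (add_le_add h1 h2)
        _ = ENNReal.ofReal (C * √ε + C * √ε * t + C * √ε) :=
            (ENNReal.ofReal_add (by positivity) hCδ).symm
        _ ≤ ENNReal.ofReal (3 * (C + 1) * √ε * √(1 + t ^ 2)) := by
            refine ENNReal.ofReal_le_ofReal ?_
            have := mul_le_mul_of_nonneg_left h3 hCδ
            have := mul_le_mul_of_nonneg_left h4 hCδ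
            have : 0 ≤ √ε * √(1 + t ^ 2) := by positivity
            nlinarith
    · have e1 := ((hψ.equation φ s hs.le).hasDerivAt (Ici_mem_nhds hs)).sub (hw φ s hs)
      have hHinner : ∫ x, (inner ℂ (diracH κ ε φ x) ((ψ s - w s : SpinorL2) x) : ℂ)
          = (∫ x, (inner ℂ (diracH κ ε φ x) (ψ s x) : ℂ))
            - ∫ x, (inner ℂ (diracH κ ε φ x) (w s x) : ℂ) := by
        simp only [integral_inner_diracH_eq hc hB, inner_sub_right]
      have hneg : ∫ x, (inner ℂ (φ x) ((-g s : SpinorL2) x) : ℂ)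
          = -∫ x, (inner ℂ (φ x) (g s x) : ℂ) := by
        simp only [integral_inner_schwartz, inner_neg_right]
      simp only [hinner, hHinner, hneg]
      refine e1.congr_deriv ?_
      ring
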